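/- **Conventions.** Write $\Delta$ for the open unit disc and $\mathbb C^n=\mathbb C^d\times\mathbb C^{m}$ with coordinates $(z,w)$, $z=x+iy$. For $0<\alpha<1$, a continuous function $\sigma$ on $\partial\Delta$ (with values in a finite-dimensional normed space), written as a function of $\theta$ with $\tau=e^{i\theta}$, is in $\mathcal F^{2,\alpha}$ if it is $C^2$ off $\tau=1$ and $$\|\sigma\|_{\mathcal F^{2,\alpha}}=\|\sigma\|_{C^0}+\|\theta\sigma'\|_{C^\alpha[-\pi,\pi]}+\|\theta^2\sigma''\|_{C^\alpha[-\pi,\pi]}<\infty .$$ An $\mathcal F^{2,\alpha}$ disc is a map $A:\overline\Delta\to\mathbb C^n$, continuous on $\overline\Delta$, holomorphic in $\Delta$, with $A|_{\partial\Delta}\in\mathcal F^{2,\alpha}$; its norm is $\|A|_{\partial\Delta}\|_{\mathcal F^{2,\alpha}}$. Vectors are measured in the maximum norm. **Data.** Let $k\ge 3$ be an integer, $0<\alpha<1$, $k\alpha>1$, and let $M=\{y=h(x,w)\}$, where $h:\mathbb R^d\times\mathbb C^m\to\mathbb R^d$ is of class $C^{k+2}$, $h(0)=0$, $\partial h(0)=0$.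 Suppose that $M$ has weighted vanishing order $\ge k$ at $p=0$: $$h(x,w)=P(w,\bar w)+x\,O(|x|^{k-1}+|w|^{k-1})+O(|w|^k)\quad\text{near }0,$$ with $P$ a real homogeneous polynomial map of degree $k-1$ (possibly $0$). Put $r=y-h(x,w)$ and $\partial' r=(\partial r_l/\partial z_j)_{l,j=1}^d$. **Theorem.** There is $\delta>0$, depending only on $d,m,k,\alpha,h$, such that the following holds for every $\mathcal F^{2,\alpha}$ disc $A$ with $\|A\|_{\mathcal F^{2,\alpha}}<\delta$ that is attached to $M$ ($A(\partial\Delta)\subset M$), with $A(1)=p=0$, and tangent to $M$ at $p$ (the radial derivative at $\tau=1$ of the component $y$ of $A$ exists and is $0$). 1. There is a unique continuous real $d\times d$ matrix function $G$ on $\partial\Delta$ with $G(1)=\mathrm{id}$ such that $G\cdot(\partial' r\circ A)$ extends continuously to $\overline\Delta$ and holomorphically to $\Delta$. 2. Let $q=A(-1)$ and let $M'=\{y=H(x,w,t),\ t\ge0\}$, where $H:\mathbb R^d\times\mathbb C^m\times[0,\infty)\to\mathbb R^d$ is of class $C^{k+2}$ with $H(\cdot,\cdot,0)=h$ and $\partial_tH(q)\neq0$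 (the one-sided derivative at $t=0$ over $q$). Put $v^1=i\,\partial_tH(q)\in i\mathbb R^d$ and $v^0=G(-1)v^1\in i\mathbb R^d$. Then for every $\epsilon>0$ there is $\rho>0$ such that for every smooth $\chi:\partial\Delta\to[0,\infty)$ with $\chi(-1)=1$ and $\chi(\tau)=0$ whenever $|\tau+1|\ge\rho$: * For some $\eta_0>0$ and each $\eta\in[0,\eta_0]$ there is a unique $\mathcal F^{2,\alpha}$ disc $A^\eta=(z^\eta,w^\eta)$ of norm $<\delta$ with the same $w$-component as $A$, with $A^\eta(1)=p$, and with $\operatorname{Im}z^\eta=H(\operatorname{Re}z^\eta,w^\eta,\eta\chi)$ on $\partial\Delta$; moreover $A^0=A$. * The derivative $\dot A=\frac{d}{d\eta}A^\eta|_{\eta=0^+}$ exists in the $\mathcal F^{2,\alpha}$ norm and is an $\mathcal F^{2,\alpha}$ disc. * $\dot A$ has a complex derivative $\partial_\tau\dot A|_{1}$ at $\tau=1$ (relative to $\overline\Delta$), and with $$c=\frac1{4\pi}\int_{-\pi}^{\pi}\chi(e^{i\theta})\,d\theta>0$$ one has $$\bigl|-\partial_\tau\dot A|_{1}-c\,(v^0,0)\bigr|<\epsilon\,c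 .$$ -/

import Mathlib

open scoped NNReal ENNReal Topology

/-- The coordinates `(x, w)` of `ℝ^d × ℂ^m`, where `n = d + m`. -/
abbrev RealCoord (d m : ℕ) : Type := (Fin d → ℝ) × (Fin m → ℂ)

/-- The ambient space `ℂ^n = ℂ^d × ℂ^m` with coordinates `(z, w)`. -/
abbrev Ambient (d m : ℕ) : Type := (Fin d → ℂ) × (Fin m → ℂ)

/-- The point `(x, w)` below `(z, w)`, where `z = x + i y`. -/
def baseOf {d m : ℕ} (p : Ambient d m) : RealCoord d m := (fun j => (p.1 j).re, p.2)

/-- The boundary values of `f` on the unit circle as a function of the angle. -/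
noncomputable def bdry {E : Type*} (f : ℂ → E) (θ : ℝ) : E := f (Complex.exp (θ * Complex.I))

/-- The `C^α` norm over the interval `[-π, π]` (sup norm plus Hölder seminorm). -/
noncomputable def holderENorm {E : Type*} [NormedAddCommGroup E] (α : ℝ≥0) (f : ℝ → E) : ℝ≥0∞ :=
  (⨆ θ : Set.Icc (-Real.pi) Real.pi, ‖f θ‖ₑ) +
    eHolderNorm α ((Set.Icc (-Real.pi) Real.pi).domRestrict f)

/-- The norm `‖σ‖_{C^0} + ‖θ σ'‖_{C^α} + ‖θ² σ''‖_{C^α}` of the boundary values `σ` of `f`. -/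
noncomputable def f2Norm {E : Type*} [NormedAddCommGroup E] [NormedSpace ℝ E]
    (α : ℝ≥0) (f : ℂ → E) : ℝ≥0∞ :=
  (⨆ θ : ℝ, ‖bdry f θ‖ₑ) + holderENorm α (fun θ => θ • deriv (bdry f) θ) +
    holderENorm α (fun θ => θ ^ 2 • iteratedDeriv 2 (bdry f) θ)

/-- The boundary values of `f` are of class `F^{2,α}` on the unit circle: continuous, twice
continuously differentiable off the point `1`, and of finite norm. -/
structure MemF2 {E : Type*} [NormedAddCommGroup E] [NormedSpace ℝ E]
    (α : ℝ≥0) (f : ℂ → E) : Prop where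
  cont : Continuous (bdry f)
  contDiffOn : ContDiffOn ℝ 2 (bdry f) {θ : ℝ | Complex.exp (θ * Complex.I) ≠ 1}
  finite : f2Norm α f < ⊤

/-- An analytic disc of class `F^{2,α}`: holomorphic in the open unit disc, continuous on the
closed one, with boundary values in `F^{2,α}`. -/
structure IsF2Disc {d m : ℕ} (α : ℝ≥0) (A : ℂ → Ambient d m) : Prop where
  holo : DiffContOnCl ℂ A (Metric.ball 0 1)
  mem : MemF2 α A

/-- The graph `M : y = h (x, w)` has weighted vanishing order at least `k` at `0`:
`h = P (w, w̄) + x O (x^{k-1}, |w|^{k-1}) + O^k (w, w̄)`, where `P` is a real homogeneous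
polynomial map of degree `k - 1` in `w, w̄` (the zero map is allowed). -/
def WeightedOrderGE {d m : ℕ} (k : ℕ) (h : RealCoord d m → Fin d → ℝ) : Prop :=
  ∃ P : ContinuousMultilinearMap ℝ (fun _ : Fin (k - 1) => Fin m → ℂ) (Fin d → ℝ),
    (fun p : RealCoord d m => h p - P (fun _ => p.2)) =O[𝓝 0]
      fun p : RealCoord d m => ‖p.1‖ * (‖p.1‖ ^ (k - 1) + ‖p.2‖ ^ (k - 1)) + ‖p.2‖ ^ k

/-- The boundary of the disc `A` lies in the graph `M : y = h (x, w)`. -/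
def AttachedTo {d m : ℕ} (h : RealCoord d m → Fin d → ℝ) (A : ℂ → Ambient d m) : Prop :=
  ∀ τ ∈ Metric.sphere (0 : ℂ) 1, ∀ j, ((A τ).1 j).im = h (baseOf (A τ)) j

/-- `A` is tangent to `M` at `A 1 = 0`: the component of its radial derivative at `τ = 1` normal
to `T_0 M = {y = 0}` vanishes. -/
def TangentAtOne {d m : ℕ} (A : ℂ → Ambient d m) : Prop :=
  ∀ j, HasDerivWithinAt (fun s : ℝ => ((A (s : ℂ)).1 j).im) 0 (Set.Icc 0 1) 1

/-- The defining functions `r_j = y_j - h_j (x, w)` of `M`. -/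
def defFun {d m : ℕ} (h : RealCoord d m → Fin d → ℝ) (p : Ambient d m) : Fin d → ℝ :=
  fun j => (p.1 j).im - h (baseOf p) j

/-- The complex Jacobian `(∂ r_l / ∂ z_j)_{l, j}` in the variables `z_1, …, z_d`, where
`∂ / ∂ z_j = (∂ / ∂ x_j - i ∂ / ∂ y_j) / 2`. -/
noncomputable def dzDefFun {d m : ℕ} (h : RealCoord d m → Fin d → ℝ) (p : Ambient d m) :
    Matrix (Fin d) (Fin d) ℂ :=
  Matrix.of fun l j =>
    (1 / 2 : ℂ) * ((fderiv ℝ (defFun h) p (Pi.single j 1, 0) l : ℂ) -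
      Complex.I * (fderiv ℝ (defFun h) p (Pi.single j Complex.I, 0) l : ℂ))

/-- A continuous real matrix function `G` on the unit circle with `G 1 = id` such that
`G ⬝ (∂r/∂z ∘ A)` extends holomorphically from the circle to the disc. -/
structure IsTransport {d m : ℕ} (h : RealCoord d m → Fin d → ℝ) (A : ℂ → Ambient d m)
    (G : ℂ → Matrix (Fin d) (Fin d) ℝ) : Prop where
  cont : ContinuousOn G (Metric.sphere 0 1)
  one : G 1 = 1
  extends_holo : ∀ i j, ∃ g : ℂ → ℂ, DiffContOnCl ℂ g (Metric.ball 0 1) ∧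
    ∀ τ ∈ Metric.sphere (0 : ℂ) 1, g τ = ((G τ).map Complex.ofReal * dzDefFun h (A τ)) i j

/-- `H (x, w, t)`, `t ≥ 0`, is a `C^{k+2}` extension of `h = H (·, ·, 0)`; it defines the manifold
`M' : y = H (x, w, t)` with boundary `M`. -/
structure IsExtension {d m : ℕ} (k : ℕ) (h : RealCoord d m → Fin d → ℝ)
    (H : RealCoord d m × ℝ → Fin d → ℝ) : Prop where
  smooth : ContDiffOn ℝ ((k + 2 : ℕ) : WithTop ℕ∞) H (Set.univ ×ˢ Set.Ici 0)
  zero : ∀ p, H (p, 0) = h p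

/-- The one-sided derivative `∂_t H` at `t = 0` over the base of a point `q`. -/
noncomputable def tDeriv {d m : ℕ} (H : RealCoord d m × ℝ → Fin d → ℝ) (q : Ambient d m) :
    Fin d → ℝ :=
  derivWithin (fun t : ℝ => H (baseOf q, t)) (Set.Ici 0) 0

/-- The vector `v⁰ = G (-1) v¹` of `i ℝ^d ⊂ ℂ^d`, where `v¹ = i ∂_t H (q)` and `q = A (-1)`. -/
noncomputable def transported {d m : ℕ} (G : ℂ → Matrix (Fin d) (Fin d) ℝ)
    (H : RealCoord d m × ℝ → Fin d → ℝ) (A : ℂ → Ambient d m) : Fin d → ℂ :=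
  ((G (-1)).map Complex.ofReal).mulVec fun j => Complex.I * (tDeriv H (A (-1)) j : ℂ)

/-- A smooth nonnegative function on the unit circle with value `1` at `-1` which vanishes
at distance at least `r` from `-1`. -/
structure IsCutoff (χ : ℂ → ℝ) (r : ℝ) : Prop where
  smooth : ContDiff ℝ ((⊤ : ℕ∞) : WithTop ℕ∞) (bdry χ)
  nonneg : ∀ τ ∈ Metric.sphere (0 : ℂ) 1, 0 ≤ χ τ
  value : χ (-1) = 1
  supp : ∀ τ ∈ Metric.sphere (0 : ℂ) 1, χ τ ≠ 0 → dist τ (-1) < r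

/-- `B` is an `F^{2,α}` disc attached to `M ∪ M'` with `B 1 = 0`, with the same CR component `w`
as `A`, and with `t`-component `η χ` on the circle. -/
structure IsDeformed {d m : ℕ} (α : ℝ≥0) (H : RealCoord d m × ℝ → Fin d → ℝ)
    (A : ℂ → Ambient d m) (χ : ℂ → ℝ) (η : ℝ) (B : ℂ → Ambient d m) : Prop where
  disc : IsF2Disc α B
  cr : ∀ τ ∈ Metric.closedBall (0 : ℂ) 1, (B τ).2 = (A τ).2
  one : B 1 = 0
  attached : ∀ τ ∈ Metric.sphere (0 : ℂ) 1, ∀ j,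
    ((B τ).1 j).im = H (baseOf (B τ), η * χ τ) j

/-! A disc with prescribed component `w` and value `0` at `1` is determined by `x = Re z` on the
circle, and attaching it to `y = H(x, w, ηχ)` amounts to Bishop's equation `x = T(H(x, w, ηχ))`.
Here `T` turns the boundary imaginary part of a holomorphic function into its real part, normalized
to vanish at `1`.

The analytic core is that `T` is bounded on `F^{2,α}`. Privalov's theorem (kernel estimates plus
Hardy–Littlewood) bounds the Cauchy transform on `C^α`. The field `(e^{iθ} - 1) ∂_θ` vanishes at `1`
and is carried by the Cauchy transform to `(τ - 1) iτ ∂_τ` up to a constant, so two applications of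
it bring the weighted derivatives `θσ'` and `θ²σ''` back to the `C^α` case
(`F2Bound.exists_cauchy_extension`).

Since `dh(0) = 0`, Hadamard's factorization `h(u) - h(v) = Λ(u, v)(u - v)` has `Λ` small along small
maps, and Bishop's equation is a contraction for small `η`. This gives existence, uniqueness and, by
comparison with the linearized equation, differentiability at `η = 0`
(`IsSmallFactor.exists_deformation`).

Writing `a = h_x` along the disc, `∂'r = -(i/2)(1 - ia)`. The transport matrix comes from a
factorization `F = g(1 - ia)` on the circle with `g` real and `F` holomorphic and invertible, whose
rows solve a linear Bishop equation; `F₁ F⁻¹` is then real on the circle for any competing `F₁`,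
hence constant, which gives uniqueness.

The `z`-component `y + iv` of the derivative disc satisfies `v = ay + b` on the circle, with `b = χ
∂_tH`. Hence `F(y + iv) = g(y + av) + i gb`, so this product is the explicit holomorphic map with
imaginary part `gb`. As `gb` vanishes near `1`, that map extends holomorphically across `1`, with
derivative `-(i/π) ∫ gb / |e^{iθ} - 1|²` there; since it vanishes at `1` and `F(1) = 1`,
multiplication by `F⁻¹` keeps this derivative. When `χ` is concentrated near `-1`, where `|ζ - 1|² =
4`, the integral is close to `π c G(-1) ∂_tH(q)`. -/

set_option linter.unusedSectionVars false

/-! ### Calculus of the weighted Hölder class in the angle variable -/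

section F2Calculus
open Set Filter

variable {E F G : Type*} [NormedAddCommGroup E] [NormedSpace ℝ E] [NormedAddCommGroup F]
  [NormedSpace ℝ F] [NormedAddCommGroup G] [NormedSpace ℝ G] {α : ℝ}

/-- `f` is bounded by `C` on `[-π, π]`, and `α`-Hölder continuous there with constant `C`. -/
def HB {E : Type*} [NormedAddCommGroup E] (α : ℝ) (f : ℝ → E) (C : ℝ) : Prop :=
  (∀ θ ∈ Icc (-Real.pi) Real.pi, ‖f θ‖ ≤ C) ∧
    ∀ θ ∈ Icc (-Real.pi) Real.pi, ∀ φ ∈ Icc (-Real.pi) Real.pi, ‖f θ - f φ‖ ≤ C * |θ - φ| ^ α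

namespace HB

lemma zero_mem : (0 : ℝ) ∈ Icc (-Real.pi) Real.pi :=
  ⟨by linarith [Real.pi_pos], Real.pi_pos.le⟩

lemma nonneg {f : ℝ → E} {C : ℝ} (h : HB α f C) : 0 ≤ C :=
  (norm_nonneg _).trans (h.1 0 zero_mem)

lemma mono {f : ℝ → E} {C D : ℝ} (h : HB α f C) (hCD : C ≤ D) : HB α f D :=
  ⟨fun θ hθ => (h.1 θ hθ).trans hCD, fun θ hθ φ hφ => (h.2 θ hθ φ hφ).trans (by gcongr)⟩

lemma congr {f g : ℝ → E} {C : ℝ} (h : HB α f C)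
    (hfg : ∀ θ ∈ Icc (-Real.pi) Real.pi, g θ = f θ) : HB α g C :=
  ⟨fun θ hθ => by rw [hfg θ hθ]; exact h.1 θ hθ,
    fun θ hθ φ hφ => by rw [hfg θ hθ, hfg φ hφ]; exact h.2 θ hθ φ hφ⟩

lemma const (c : E) : HB α (fun _ => c) ‖c‖ :=
  ⟨fun _ _ => le_rfl, fun _ _ _ _ => by simp; positivity⟩

lemma add {f g : ℝ → E} {C D : ℝ} (hf : HB α f C) (hg : HB α g D) :
    HB α (fun θ => f θ + g θ) (C + D) :=
  ⟨fun θ hθ => norm_add_le_of_le (hf.1 θ hθ) (hg.1 θ hθ), fun θ hθ φ hφ => by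
    rw [add_sub_add_comm, add_mul]; exact norm_add_le_of_le (hf.2 θ hθ φ hφ) (hg.2 θ hθ φ hφ)⟩

lemma clm_comp {f : ℝ → E} {C : ℝ} (hf : HB α f C) (L : E →L[ℝ] F) :
    HB α (fun θ => L (f θ)) (‖L‖ * C) :=
  ⟨fun θ hθ => L.le_of_opNorm_le_of_le le_rfl (hf.1 θ hθ), fun θ hθ φ hφ => by
    rw [← map_sub, mul_assoc]; exact L.le_of_opNorm_le_of_le le_rfl (hf.2 θ hθ φ hφ)⟩

lemma bilin {f : ℝ → E} {g : ℝ → F} {C D : ℝ} (hf : HB α f C) (hg : HB α g D)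
    (B : E →L[ℝ] F →L[ℝ] G) : HB α (fun θ => B (f θ) (g θ)) (2 * ‖B‖ * C * D) := by
  have hC := hf.nonneg
  have hD := hg.nonneg
  refine ⟨fun θ hθ => ?_, fun θ hθ φ hφ => ?_⟩
  · calc ‖B (f θ) (g θ)‖ ≤ ‖B‖ * ‖f θ‖ * ‖g θ‖ := B.le_opNorm₂ _ _
      _ ≤ ‖B‖ * C * D := by gcongr; exacts [hf.1 θ hθ, hg.1 θ hθ]
      _ ≤ 2 * ‖B‖ * C * D := by nlinarith [mul_nonneg (mul_nonneg (norm_nonneg B) hC) hD]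
  · have h1 : B (f θ) (g θ) - B (f φ) (g φ) = B (f θ - f φ) (g θ) + B (f φ) (g θ - g φ) := by
      simp only [map_sub, sub_apply]; abel
    rw [h1]
    calc _ ≤ ‖B‖ * ‖f θ - f φ‖ * ‖g θ‖ + ‖B‖ * ‖f φ‖ * ‖g θ - g φ‖ :=
          norm_add_le_of_le (B.le_opNorm₂ _ _) (B.le_opNorm₂ _ _)
      _ ≤ ‖B‖ * (C * |θ - φ| ^ α) * D + ‖B‖ * C * (D * |θ - φ| ^ α) := by
          gcongr
          exacts [hf.2 θ hθ φ hφ, hg.1 θ hθ, hf.1 φ hφ, hg.2 θ hθ φ hφ]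
      _ = _ := by ring

lemma clm_apply {f : ℝ → E →L[ℝ] F} {g : ℝ → E} {C D : ℝ} (hf : HB α f C) (hg : HB α g D) :
    HB α (fun θ => f θ (g θ)) (2 * C * D) := by
  have hC := hf.nonneg
  have hD := hg.nonneg
  refine (hf.bilin hg (ContinuousLinearMap.id ℝ (E →L[ℝ] F))).mono ?_
  have := ContinuousLinearMap.norm_id_le (𝕜 := ℝ) (E := E →L[ℝ] F)
  gcongr
  linarith

lemma pi {ι : Type*} [Fintype ι] {f : ℝ → ι → E} {C : ℝ} (hC : 0 ≤ C)
    (h : ∀ i, HB α (fun θ => f θ i) C) : HB α f C :=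
  ⟨fun θ hθ => (pi_norm_le_iff_of_nonneg hC).2 fun i => (h i).1 θ hθ,
    fun θ hθ φ hφ => (pi_norm_le_iff_of_nonneg (by positivity)).2 fun i => (h i).2 θ hθ φ hφ⟩

lemma comp_lipschitz {f : ℝ → E} {C M : ℝ} (hf : HB α f C) (hM : 0 ≤ M) {Φ : E → F}
    (h0 : ∀ x, ‖x‖ ≤ C → ‖Φ x‖ ≤ M)
    (h1 : ∀ x y, ‖x‖ ≤ C → ‖y‖ ≤ C → ‖Φ x - Φ y‖ ≤ M * ‖x - y‖) :
    HB α (fun θ => Φ (f θ)) (M * (1 + C)) := by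
  have hC := hf.nonneg
  refine ⟨fun θ hθ => (h0 _ (hf.1 θ hθ)).trans (by nlinarith), fun θ hθ φ hφ => ?_⟩
  calc _ ≤ M * ‖f θ - f φ‖ := h1 _ _ (hf.1 θ hθ) (hf.1 φ hφ)
    _ ≤ M * (C * |θ - φ| ^ α) := by gcongr; exact hf.2 θ hθ φ hφ
    _ ≤ M * (1 + C) * |θ - φ| ^ α := by
      have : 0 ≤ |θ - φ| ^ α := by positivity
      nlinarith [mul_nonneg hM this]

lemma continuousOn {f : ℝ → E} {C : ℝ} (h : HB α f C) (hα : 0 < α) :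
    ContinuousOn f (Icc (-Real.pi) Real.pi) := by
  intro θ hθ
  rw [ContinuousWithinAt, tendsto_iff_norm_sub_tendsto_zero]
  refine squeeze_zero' (.of_forall fun _ => norm_nonneg _)
    (eventually_mem_nhdsWithin.mono fun φ hφ => h.2 φ hφ θ hθ) ?_
  have : ContinuousAt (fun φ : ℝ => C * |φ - θ| ^ α) θ :=
    continuousAt_const.mul (ContinuousAt.rpow_const (by fun_prop) (Or.inr hα.le))
  have := this.tendsto
  simp [hα.ne'] at this
  exact this.mono_left nhdsWithin_le_nhds

end HB

lemma isOpen_exp_ne_one : IsOpen {θ : ℝ | Complex.exp (θ * Complex.I) ≠ 1} :=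
  isOpen_ne_fun (by fun_prop) continuous_const

lemma exp_ne_one_of_mem {θ : ℝ} (h : θ ∈ Icc (-Real.pi) Real.pi) (h0 : θ ≠ 0) :
    Complex.exp (θ * Complex.I) ≠ 1 := by
  intro he
  obtain ⟨n, hn⟩ := Complex.exp_eq_one_iff.1 he
  have h1 : (θ : ℂ) = ((n * (2 * Real.pi) : ℝ) : ℂ) := by
    have := mul_right_cancel₀ Complex.I_ne_zero
      (hn.trans (by ring : (n : ℂ) * (2 * Real.pi * Complex.I) = (n * (2 * Real.pi)) * Complex.I))
    rw [this]; push_cast; ring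
  have h2 : θ = n * (2 * Real.pi) := by exact_mod_cast h1
  have hn0 : n ≠ 0 := by rintro rfl; simp at h2; exact h0 h2
  have h3 : (1 : ℝ) ≤ |(n : ℝ)| := by exact_mod_cast Int.one_le_abs hn0
  have h4 : |θ| ≤ Real.pi := abs_le.2 h
  rw [h2, abs_mul, abs_of_pos (by positivity : (0 : ℝ) < 2 * Real.pi)] at h4
  nlinarith [Real.pi_pos]

/-- `σ` is `2π`-periodic and twice differentiable off `2πℤ`, and `σ`, `θ σ'`, `θ² σ''` are
bounded by `C` in `C^α[-π, π]`. -/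
structure F2Bound {E : Type*} [NormedAddCommGroup E] [NormedSpace ℝ E] (α : ℝ) (σ : ℝ → E)
    (C : ℝ) : Prop where
  periodic : Function.Periodic σ (2 * Real.pi)
  diff : ∀ θ : ℝ, Complex.exp (θ * Complex.I) ≠ 1 → DifferentiableAt ℝ σ θ
  diff2 : ∀ θ : ℝ, Complex.exp (θ * Complex.I) ≠ 1 → DifferentiableAt ℝ (deriv σ) θ
  b0 : HB α σ C
  b1 : HB α (fun θ => θ • deriv σ θ) C
  b2 : HB α (fun θ => θ ^ 2 • deriv (deriv σ) θ) C

namespace F2Bound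

/-- The derivatives need only be known off `1`: at `θ = 0` the weights `θ` and `θ²` annihilate
whatever value `deriv` takes there, so the weighted bounds transfer to all of `[-π, π]`. -/
lemma of_hasDerivAt {σ σ₁ σ₂ : ℝ → E} {C : ℝ} (hp : Function.Periodic σ (2 * Real.pi))
    (h1 : ∀ θ : ℝ, Complex.exp (θ * Complex.I) ≠ 1 → HasDerivAt σ (σ₁ θ) θ)
    (h2 : ∀ θ : ℝ, Complex.exp (θ * Complex.I) ≠ 1 → HasDerivAt σ₁ (σ₂ θ) θ)
    (b0 : HB α σ C) (b1 : HB α (fun θ => θ • σ₁ θ) C) (b2 : HB α (fun θ => θ ^ 2 • σ₂ θ) C) :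
    F2Bound α σ C := by
  have key : ∀ θ : ℝ, Complex.exp (θ * Complex.I) ≠ 1 → HasDerivAt (deriv σ) (σ₂ θ) θ := by
    intro θ hθ
    refine (h2 θ hθ).congr_of_eventuallyEq ?_
    filter_upwards [isOpen_exp_ne_one.mem_nhds hθ] with φ hφ using (h1 φ hφ).deriv
  refine ⟨hp, fun θ hθ => (h1 θ hθ).differentiableAt, fun θ hθ => (key θ hθ).differentiableAt,
    b0, b1.congr fun θ hθ => ?_, b2.congr fun θ hθ => ?_⟩
  · rcases eq_or_ne θ 0 with rfl | h0
    · simp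
    · simp only [(h1 θ (exp_ne_one_of_mem hθ h0)).deriv]
  · rcases eq_or_ne θ 0 with rfl | h0
    · simp
    · simp only [(key θ (exp_ne_one_of_mem hθ h0)).deriv]

lemma nonneg {σ : ℝ → E} {C : ℝ} (h : F2Bound α σ C) : 0 ≤ C := h.b0.nonneg

lemma mono {σ : ℝ → E} {C D : ℝ} (h : F2Bound α σ C) (hCD : C ≤ D) : F2Bound α σ D :=
  ⟨h.periodic, h.diff, h.diff2, h.b0.mono hCD, h.b1.mono hCD, h.b2.mono hCD⟩

lemma const (c : E) : F2Bound α (fun _ => c) ‖c‖ :=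
  of_hasDerivAt (σ₁ := fun _ => 0) (σ₂ := fun _ => 0) (fun _ => rfl)
    (fun θ _ => hasDerivAt_const θ c) (fun θ _ => hasDerivAt_const θ 0) (HB.const c)
    (((HB.const (0 : E)).mono (by simp)).congr (by simp))
    (((HB.const (0 : E)).mono (by simp)).congr (by simp))

lemma add {σ τ : ℝ → E} {C D : ℝ} (hσ : F2Bound α σ C) (hτ : F2Bound α τ D) :
    F2Bound α (fun θ => σ θ + τ θ) (C + D) :=
  of_hasDerivAt (fun θ => by simp only [hσ.periodic θ, hτ.periodic θ])
    (fun θ hθ => (hσ.diff θ hθ).hasDerivAt.add (hτ.diff θ hθ).hasDerivAt)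
    (fun θ hθ => (hσ.diff2 θ hθ).hasDerivAt.add (hτ.diff2 θ hθ).hasDerivAt)
    (hσ.b0.add hτ.b0) ((hσ.b1.add hτ.b1).congr fun θ _ => by simp only [smul_add])
    ((hσ.b2.add hτ.b2).congr fun θ _ => by simp only [smul_add])

lemma clm_comp {σ : ℝ → E} {C : ℝ} (hσ : F2Bound α σ C) (L : E →L[ℝ] F) :
    F2Bound α (fun θ => L (σ θ)) (‖L‖ * C) :=
  of_hasDerivAt (fun θ => by simp only [hσ.periodic θ])
    (fun θ hθ => L.hasFDerivAt.comp_hasDerivAt θ (hσ.diff θ hθ).hasDerivAt)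
    (fun θ hθ => L.hasFDerivAt.comp_hasDerivAt θ (hσ.diff2 θ hθ).hasDerivAt)
    (hσ.b0.clm_comp L) ((hσ.b1.clm_comp L).congr fun θ _ => by simp)
    ((hσ.b2.clm_comp L).congr fun θ _ => by simp)

lemma clm_comp_le {σ : ℝ → E} {C M : ℝ} (hσ : F2Bound α σ C) (L : E →L[ℝ] F) (hL : ‖L‖ ≤ M) :
    F2Bound α (fun θ => L (σ θ)) (M * C) :=
  (hσ.clm_comp L).mono (mul_le_mul_of_nonneg_right hL hσ.nonneg)

lemma const_smul {σ : ℝ → E} {C : ℝ} (hσ : F2Bound α σ C) (c : ℝ) :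
    F2Bound α (fun θ => c • σ θ) (|c| * C) :=
  hσ.clm_comp_le (c • ContinuousLinearMap.id ℝ E) <| by
    refine (norm_smul_le c (ContinuousLinearMap.id ℝ E)).trans ?_
    have := ContinuousLinearMap.norm_id_le (𝕜 := ℝ) (E := E)
    rw [Real.norm_eq_abs]
    nlinarith [abs_nonneg c]

lemma neg {σ : ℝ → E} {C : ℝ} (hσ : F2Bound α σ C) : F2Bound α (fun θ => -σ θ) C := by
  simpa using hσ.const_smul (-1)

lemma sub {σ τ : ℝ → E} {C D : ℝ} (hσ : F2Bound α σ C) (hτ : F2Bound α τ D) :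
    F2Bound α (fun θ => σ θ - τ θ) (C + D) := by
  simpa only [sub_eq_add_neg] using hσ.add hτ.neg

/-- The constant `8` comes from the second derivative: the product rule, with its mixed term counted
twice, gives four terms, each costing a factor `2` in `C^α`. -/
lemma bilin {f : ℝ → E} {g : ℝ → F} {C D : ℝ} (hf : F2Bound α f C) (hg : F2Bound α g D)
    (B : E →L[ℝ] F →L[ℝ] G) : F2Bound α (fun θ => B (f θ) (g θ)) (8 * ‖B‖ * C * D) := by
  have hBCD : 0 ≤ ‖B‖ * C * D := mul_nonneg (mul_nonneg (norm_nonneg B) hf.nonneg) hg.nonneg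
  have hd : ∀ (p : ℝ → E) (q : ℝ → F) (p' : E) (q' : F) (θ : ℝ), HasDerivAt p p' θ →
      HasDerivAt q q' θ → HasDerivAt (fun θ => B (p θ) (q θ)) (B p' (q θ) + B (p θ) q') θ := by
    intro p q p' q' θ hp hq
    have := (B.hasFDerivAt.comp_hasDerivAt θ hp).clm_apply hq
    simpa using this
  refine of_hasDerivAt (fun θ => by simp only [hf.periodic θ, hg.periodic θ])
    (fun θ hθ => hd _ _ _ _ θ (hf.diff θ hθ).hasDerivAt (hg.diff θ hθ).hasDerivAt)
    (fun θ hθ => (hd _ _ _ _ θ (hf.diff2 θ hθ).hasDerivAt (hg.diff θ hθ).hasDerivAt).add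
      (hd _ _ _ _ θ (hf.diff θ hθ).hasDerivAt (hg.diff2 θ hθ).hasDerivAt))
    ((hf.b0.bilin hg.b0 B).mono (by nlinarith))
    (HB.congr (((hf.b1.bilin hg.b0 B).add (hf.b0.bilin hg.b1 B)).mono (by nlinarith))
      fun θ _ => ?_)
    (HB.congr ((((hf.b2.bilin hg.b0 B).add (hf.b1.bilin hg.b1 B)).add
      ((hf.b1.bilin hg.b1 B).add (hf.b0.bilin hg.b2 B))).mono (by nlinarith)) fun θ _ => ?_)
  · simp
  · simp [smul_smul, pow_two]

lemma clm_apply {f : ℝ → E →L[ℝ] F} {g : ℝ → E} {C D : ℝ} (hf : F2Bound α f C)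
    (hg : F2Bound α g D) : F2Bound α (fun θ => f θ (g θ)) (8 * C * D) := by
  have hC := hf.nonneg
  have hD := hg.nonneg
  refine (hf.bilin hg (ContinuousLinearMap.id ℝ (E →L[ℝ] F))).mono ?_
  have := ContinuousLinearMap.norm_id_le (𝕜 := ℝ) (E := E →L[ℝ] F)
  gcongr
  linarith

lemma smul {f : ℝ → ℝ} {g : ℝ → E} {C D : ℝ} (hf : F2Bound α f C)
    (hg : F2Bound α g D) : F2Bound α (fun θ => f θ • g θ) (8 * C * D) := by
  have hC := hf.nonneg
  have hD := hg.nonneg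
  refine (hf.bilin hg (ContinuousLinearMap.lsmul ℝ ℝ)).mono ?_
  have := ContinuousLinearMap.opNorm_lsmul_le (𝕜 := ℝ) (R := ℝ) (E := E)
  gcongr
  linarith

lemma pi {ι : Type*} [Fintype ι] {f : ℝ → ι → E} {C : ℝ} (hC : 0 ≤ C)
    (h : ∀ i, F2Bound α (fun θ => f θ i) C) : F2Bound α f C := by
  refine of_hasDerivAt (fun θ => funext fun i => (h i).periodic θ)
    (σ₁ := fun θ i => deriv (fun θ => f θ i) θ)
    (σ₂ := fun θ i => deriv (deriv (fun θ => f θ i)) θ)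
    (fun θ hθ => hasDerivAt_pi.2 fun i => ((h i).diff θ hθ).hasDerivAt)
    (fun θ hθ => hasDerivAt_pi.2 fun i => ((h i).diff2 θ hθ).hasDerivAt)
    (HB.pi hC fun i => (h i).b0) (HB.pi hC fun i => (h i).b1) (HB.pi hC fun i => (h i).b2)

lemma apply {ι : Type*} [Fintype ι] {f : ℝ → ι → E} {C : ℝ} (h : F2Bound α f C) (i : ι) :
    F2Bound α (fun θ => f θ i) C := by
  refine (h.clm_comp_le (ContinuousLinearMap.proj (R := ℝ) (φ := fun _ : ι => E) i) (M := 1)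
    (ContinuousLinearMap.opNorm_le_bound _ zero_le_one fun x => ?_)).mono (by simp)
  simpa using norm_le_pi_norm x i

lemma fst {f : ℝ → E × F} {C : ℝ} (h : F2Bound α f C) : F2Bound α (fun θ => (f θ).1) C :=
  (h.clm_comp_le (ContinuousLinearMap.fst ℝ E F)
    (ContinuousLinearMap.norm_fst_le ℝ E F)).mono (by simp)

lemma snd {f : ℝ → E × F} {C : ℝ} (h : F2Bound α f C) : F2Bound α (fun θ => (f θ).2) C :=
  (h.clm_comp_le (ContinuousLinearMap.snd ℝ E F)
    (ContinuousLinearMap.norm_snd_le ℝ E F)).mono (by simp)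

lemma prodMk {f : ℝ → E} {g : ℝ → F} {C D : ℝ} (hf : F2Bound α f C) (hg : F2Bound α g D) :
    F2Bound α (fun θ => (f θ, g θ)) (C + D) := by
  have h1 := hf.clm_comp_le (ContinuousLinearMap.inl ℝ E F)
    (ContinuousLinearMap.norm_inl_le_one ℝ E F)
  have h2 := hg.clm_comp_le (ContinuousLinearMap.inr ℝ E F)
    (ContinuousLinearMap.norm_inr_le_one ℝ E F)
  simpa using h1.add h2

end F2Bound

lemma exists_bound_lipschitz_closedBall [FiniteDimensional ℝ E] {Φ : E → F}
    (hΦ : ContDiff ℝ 1 Φ) (R : ℝ) : ∃ M, 0 ≤ M ∧ (∀ x, ‖x‖ ≤ R → ‖Φ x‖ ≤ M) ∧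
      ∀ x y, ‖x‖ ≤ R → ‖y‖ ≤ R → ‖Φ x - Φ y‖ ≤ M * ‖x - y‖ := by
  have := FiniteDimensional.proper ℝ E
  obtain ⟨M₁, h1⟩ := (isCompact_closedBall (0 : E) R).exists_bound_of_continuousOn
    hΦ.continuous.continuousOn
  obtain ⟨M₂, h2⟩ := (isCompact_closedBall (0 : E) R).exists_bound_of_continuousOn
    (hΦ.continuous_fderiv one_ne_zero).continuousOn
  refine ⟨max (max M₁ M₂) 0, le_max_right _ _, fun x hx => (h1 x (by simpa using hx)).trans
    ((le_max_left _ _).trans (le_max_left _ _)), fun x y hx hy => ?_⟩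
  refine (convex_closedBall (0 : E) R).norm_image_sub_le_of_norm_hasFDerivWithin_le
    (f := Φ) (f' := fderiv ℝ Φ)
    (fun z _ => ((hΦ.differentiable one_ne_zero) z).hasFDerivAt.hasFDerivWithinAt)
    (fun z hz => (h2 z hz).trans ((le_max_right _ _).trans (le_max_left _ _)))
    (by simpa using hy) (by simpa using hx)

/-- Composition with a `C³` map is bounded on balls. -/
lemma F2Bound.exists_comp [FiniteDimensional ℝ E] {Φ : E → F} (hΦ : ContDiff ℝ 3 Φ) (α R : ℝ) :
    ∃ C, 0 ≤ C ∧ ∀ u : ℝ → E, F2Bound α u R → F2Bound α (fun θ => Φ (u θ)) C := by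
  have hΦ1 : ContDiff ℝ 2 (fderiv ℝ Φ) := hΦ.fderiv_right (by norm_num)
  have hΦ2 : ContDiff ℝ 1 (fderiv ℝ (fderiv ℝ Φ)) := hΦ1.fderiv_right (by norm_num)
  obtain ⟨M₀, p0, b0, l0⟩ := exists_bound_lipschitz_closedBall (hΦ.of_le (by norm_num)) R
  obtain ⟨M₁, p1, b1, l1⟩ := exists_bound_lipschitz_closedBall (hΦ1.of_le (by norm_num)) R
  obtain ⟨M₂, p2, b2, l2⟩ := exists_bound_lipschitz_closedBall hΦ2 R
  -- These bound `Φ(u)`, `Φ'(u)·θu'` and `Φ''(u)(θu', θu') + Φ'(u)·θ²u''` in `C^α`. Three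
  -- derivatives of `Φ` are used because `Φ''(u)` is estimated through a Lipschitz bound for `Φ''`.
  set C₀ := M₀ * (1 + R)
  set C₁ := 2 * (M₁ * (1 + R)) * R
  set C₂ := 2 * (2 * (M₂ * (1 + R)) * R) * R + 2 * (M₁ * (1 + R)) * R
  refine ⟨max 0 (max C₀ (max C₁ C₂)), le_max_left _ _, fun u hu => ?_⟩
  have hd : Differentiable ℝ Φ := hΦ.differentiable (by norm_num)
  have hd1 : Differentiable ℝ (fderiv ℝ Φ) := hΦ1.differentiable (by norm_num)
  have c1 : HB α (fun θ => fderiv ℝ Φ (u θ)) (M₁ * (1 + R)) := hu.b0.comp_lipschitz p1 b1 l1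
  have c2 : HB α (fun θ => fderiv ℝ (fderiv ℝ Φ) (u θ)) (M₂ * (1 + R)) :=
    hu.b0.comp_lipschitz p2 b2 l2
  refine F2Bound.of_hasDerivAt (fun θ => by simp only [hu.periodic θ])
    (σ₁ := fun θ => fderiv ℝ Φ (u θ) (deriv u θ))
    (σ₂ := fun θ => fderiv ℝ (fderiv ℝ Φ) (u θ) (deriv u θ) (deriv u θ) +
      fderiv ℝ Φ (u θ) (deriv (deriv u) θ))
    (fun θ hθ => (hd (u θ)).hasFDerivAt.comp_hasDerivAt θ (hu.diff θ hθ).hasDerivAt)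
    (fun θ hθ => ((hd1 (u θ)).hasFDerivAt.comp_hasDerivAt θ (hu.diff θ hθ).hasDerivAt).clm_apply
      (hu.diff2 θ hθ).hasDerivAt)
    ((hu.b0.comp_lipschitz p0 b0 l0).mono ((le_max_left _ _).trans (le_max_right _ _)))
    (((c1.clm_apply hu.b1).mono (((le_max_left _ _).trans (le_max_right _ _)).trans
      (le_max_right _ _))).congr fun θ _ => by simp)
    (((((c2.clm_apply hu.b1).clm_apply hu.b1).add (c1.clm_apply hu.b2)).mono
      (((le_max_right _ _).trans (le_max_right _ _)).trans
      (le_max_right _ _))).congr fun θ _ => by simp [smul_smul, pow_two])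

end F2Calculus

/-! ### Completeness of the class and the contraction principle -/

section Picard
open Set Filter Topology

variable {E : Type*} [NormedAddCommGroup E] [NormedSpace ℝ E] {α : ℝ}

lemma exists_sub_int_mul_mem_Icc (θ : ℝ) :
    ∃ n : ℤ, θ - n * (2 * Real.pi) ∈ Icc (-Real.pi) Real.pi := by
  refine ⟨toIocDiv Real.two_pi_pos (-Real.pi) θ, ?_⟩
  have := sub_toIocDiv_zsmul_mem_Ioc Real.two_pi_pos (-Real.pi) θ
  rw [zsmul_eq_mul] at this
  exact ⟨this.1.le, by linarith [this.2]⟩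

lemma exp_sub_int_mul (θ : ℝ) (n : ℤ) :
    Complex.exp ((θ - n * (2 * Real.pi) : ℝ) * Complex.I) = Complex.exp (θ * Complex.I) := by
  rw [← Complex.exp_periodic.sub_int_mul_eq n (x := (θ * Complex.I))]
  push_cast; ring_nf

lemma norm_exp_sub_one_le (θ : ℝ) : ‖Complex.exp (θ * Complex.I) - 1‖ ≤ |θ| := by
  rw [mul_comm]; simpa using Real.norm_exp_I_mul_ofReal_sub_one_le (x := θ)

lemma Function.Periodic.deriv_real {σ : ℝ → E} {c : ℝ} (h : Function.Periodic σ c) :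
    Function.Periodic (deriv σ) c := by
  intro θ
  rw [← deriv_comp_add_const]
  congr 1
  exact funext h

lemma HB.of_tendsto {f : ℕ → ℝ → E} {g : ℝ → E} {C : ℝ} (h : ∀ᶠ n in atTop, HB α (f n) C)
    (hlim : ∀ θ ∈ Icc (-Real.pi) Real.pi, Tendsto (fun n => f n θ) atTop (𝓝 (g θ))) :
    HB α g C :=
  ⟨fun θ hθ => le_of_tendsto (hlim θ hθ).norm (h.mono fun _ hn => hn.1 θ hθ),
    fun θ hθ φ hφ => le_of_tendsto ((hlim θ hθ).sub (hlim φ hφ)).norm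
      (h.mono fun _ hn => hn.2 θ hθ φ hφ)⟩

lemma HB.of_forall_lt {f : ℝ → E} {C : ℝ} (h : ∀ D, C < D → HB α f D) : HB α f C := by
  have h1 : Tendsto (fun D : ℝ => D) (𝓝[>] C) (𝓝 C) := nhdsWithin_le_nhds
  refine ⟨fun θ hθ => ge_of_tendsto h1 (eventually_mem_nhdsWithin.mono fun D hD => (h D hD).1 θ hθ),
    fun θ hθ φ hφ => ge_of_tendsto (h1.mul_const _)
      (eventually_mem_nhdsWithin.mono fun D hD => (h D hD).2 θ hθ φ hφ)⟩

namespace F2Bound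

lemma of_forall_lt {f : ℝ → E} {C : ℝ} (h : ∀ D, C < D → F2Bound α f D) : F2Bound α f C :=
  ⟨(h (C + 1) (by simp)).periodic, (h (C + 1) (by simp)).diff, (h (C + 1) (by simp)).diff2,
    .of_forall_lt fun D hD => (h D hD).b0, .of_forall_lt fun D hD => (h D hD).b1,
    .of_forall_lt fun D hD => (h D hD).b2⟩

lemma norm_le {σ : ℝ → E} {C : ℝ} (h : F2Bound α σ C) (θ : ℝ) : ‖σ θ‖ ≤ C := by
  obtain ⟨n, hn⟩ := exists_sub_int_mul_mem_Icc θ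
  rw [← h.periodic.sub_int_mul_eq n]
  exact h.b0.1 _ hn

/-- The weight `θ` is not periodic, so outside `[-π, π]` it is replaced by the smaller periodic
weight `|e^{iθ} - 1|`. -/
lemma norm_deriv_le {σ : ℝ → E} {C : ℝ} (h : F2Bound α σ C) (θ : ℝ) :
    ‖Complex.exp (θ * Complex.I) - 1‖ * ‖deriv σ θ‖ ≤ C := by
  obtain ⟨n, hn⟩ := exists_sub_int_mul_mem_Icc θ
  rw [← h.periodic.deriv_real.sub_int_mul_eq n, ← exp_sub_int_mul θ n]
  refine le_trans ?_ (h.b1.1 _ hn)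
  rw [norm_smul, Real.norm_eq_abs]
  gcongr
  exact norm_exp_sub_one_le _

lemma norm_deriv2_le {σ : ℝ → E} {C : ℝ} (h : F2Bound α σ C) (θ : ℝ) :
    ‖Complex.exp (θ * Complex.I) - 1‖ ^ 2 * ‖deriv (deriv σ) θ‖ ≤ C := by
  obtain ⟨n, hn⟩ := exists_sub_int_mul_mem_Icc θ
  rw [← h.periodic.deriv_real.deriv_real.sub_int_mul_eq n, ← exp_sub_int_mul θ n]
  refine le_trans ?_ (h.b2.1 _ hn)
  rw [norm_smul, norm_pow, Real.norm_eq_abs]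
  gcongr
  exact norm_exp_sub_one_le _

lemma eq_zero {σ : ℝ → E} (h : F2Bound α σ 0) (θ : ℝ) : σ θ = 0 :=
  norm_le_zero_iff.1 (h.norm_le θ)

lemma deriv_sub {σ τ : ℝ → E} {C D : ℝ} (hσ : F2Bound α σ C) (hτ : F2Bound α τ D) {θ : ℝ}
    (hθ : Complex.exp (θ * Complex.I) ≠ 1) :
    deriv (fun θ => σ θ - τ θ) θ = deriv σ θ - deriv τ θ :=
  ((hσ.diff θ hθ).hasDerivAt.sub (hτ.diff θ hθ).hasDerivAt).deriv

lemma deriv2_sub {σ τ : ℝ → E} {C D : ℝ} (hσ : F2Bound α σ C) (hτ : F2Bound α τ D) {θ : ℝ}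
    (hθ : Complex.exp (θ * Complex.I) ≠ 1) :
    deriv (deriv (fun θ => σ θ - τ θ)) θ = deriv (deriv σ) θ - deriv (deriv τ) θ := by
  refine HasDerivAt.deriv ?_
  refine ((hσ.diff2 θ hθ).hasDerivAt.sub (hτ.diff2 θ hθ).hasDerivAt).congr_of_eventuallyEq ?_
  filter_upwards [isOpen_exp_ne_one.mem_nhds hθ] with φ hφ using hσ.deriv_sub hτ hφ

end F2Bound

lemma exists_limit_of_weighted_cauchy [CompleteSpace E] {f : ℕ → ℝ → E} {w : ℝ → ℝ} {ε : ℕ → ℝ}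
    (hε : Tendsto ε atTop (𝓝 0))
    (h : ∀ n m, n ≤ m → ∀ θ, 0 < w θ → w θ * ‖f m θ - f n θ‖ ≤ ε n) :
    ∃ g : ℝ → E, ∀ θ, 0 < w θ → Tendsto (fun n => f n θ) atTop (𝓝 (g θ)) := by
  have : ∀ θ, ∃ y, 0 < w θ → Tendsto (fun n => f n θ) atTop (𝓝 y) := by
    intro θ
    by_cases hθ : 0 < w θ
    · have hc : CauchySeq fun n => f n θ := by
        refine cauchySeq_of_le_tendsto_0' (fun n => ε n / w θ) (fun n m hnm => ?_)
          (by simpa using hε.div_const (w θ))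
        rw [dist_comm, dist_eq_norm, le_div_iff₀ hθ, mul_comm]
        exact h n m hnm θ hθ
      obtain ⟨y, hy⟩ := cauchySeq_tendsto_of_complete hc
      exact ⟨y, fun _ => hy⟩
    · exact ⟨0, fun h => absurd h hθ⟩
  choose g hg using this
  exact ⟨g, hg⟩

lemma weighted_dist_limit_le {f : ℕ → ℝ → E} {g : ℝ → E} {w : ℝ → ℝ} {ε : ℕ → ℝ}
    (h : ∀ n m, n ≤ m → ∀ θ, 0 < w θ → w θ * ‖f m θ - f n θ‖ ≤ ε n)
    (hg : ∀ θ, 0 < w θ → Tendsto (fun n => f n θ) atTop (𝓝 (g θ))) (n : ℕ) (θ : ℝ)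
    (hθ : 0 < w θ) : w θ * ‖g θ - f n θ‖ ≤ ε n :=
  le_of_tendsto (((hg θ hθ).sub_const _).norm.const_mul _)
    ((eventually_ge_atTop n).mono fun m hm => h n m hm θ hθ)

/-- Near a point where `e^{iθ} ≠ 1` the weight is bounded below, so weighted convergence of the
derivatives is locally uniform and limits may be differentiated. -/
lemma hasDerivAt_of_weighted_cauchy {f f' : ℕ → ℝ → E} {g g' : ℝ → E} {ε : ℕ → ℝ} {p : ℕ}
    (hε : Tendsto ε atTop (𝓝 0))
    (hd : ∀ n, ∀ θ : ℝ, Complex.exp (θ * Complex.I) ≠ 1 → HasDerivAt (f n) (f' n θ) θ)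
    (hg : ∀ θ : ℝ, Complex.exp (θ * Complex.I) ≠ 1 → Tendsto (fun n => f n θ) atTop (𝓝 (g θ)))
    (hb : ∀ n, ∀ θ : ℝ, Complex.exp (θ * Complex.I) ≠ 1 →
      ‖Complex.exp (θ * Complex.I) - 1‖ ^ p * ‖g' θ - f' n θ‖ ≤ ε n) (θ : ℝ)
    (hθ : Complex.exp (θ * Complex.I) ≠ 1) : HasDerivAt g (g' θ) θ := by
  set c := ‖Complex.exp (θ * Complex.I) - 1‖ / 2 with hc
  have hc0 : 0 < c := by rw [hc]; have := norm_pos_iff.2 (sub_ne_zero.2 hθ); linarith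
  have hO : IsOpen {φ : ℝ | c < ‖Complex.exp (φ * Complex.I) - 1‖} :=
    isOpen_lt continuous_const (by fun_prop)
  have hOff : ∀ φ : ℝ, c < ‖Complex.exp (φ * Complex.I) - 1‖ → Complex.exp (φ * Complex.I) ≠ 1 := by
    intro φ hφ he
    simp only [he, sub_self, norm_zero] at hφ
    linarith
  refine hasDerivAt_of_tendstoUniformlyOn hO (f := f) (f' := f') (l := atTop) ?_
    (.of_forall fun n φ hφ => hd n φ (hOff φ hφ)) (fun φ hφ => hg φ (hOff φ hφ))
    (x := θ) (by show c < _; linarith)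
  rw [Metric.tendstoUniformlyOn_iff]
  intro e he
  have : Tendsto (fun n => ε n / c ^ p) atTop (𝓝 0) := by simpa using hε.div_const (c ^ p)
  filter_upwards [this.eventually (gt_mem_nhds he)] with n hn φ hφ
  refine lt_of_le_of_lt ?_ hn
  rw [dist_eq_norm, le_div_iff₀ (by positivity), mul_comm]
  refine le_trans ?_ (hb n φ (hOff φ hφ))
  have : c ≤ ‖Complex.exp (φ * Complex.I) - 1‖ := le_of_lt hφ
  gcongr

/-- Completeness: the functions and their first two derivatives converge pointwise off `1` by the
weighted sup bounds, and the Hölder inequalities pass to pointwise limits. At `θ = 0` the weighted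
derivatives are zero, so nothing has to converge there. -/
lemma F2Bound.exists_limit [CompleteSpace E] {x : ℕ → ℝ → E} {C ε : ℕ → ℝ}
    (hx : ∀ n, F2Bound α (x n) (C n))
    (hε : Tendsto ε atTop (𝓝 0)) (h : ∀ n m, n ≤ m → F2Bound α (fun θ => x m θ - x n θ) (ε n)) :
    ∃ y : ℝ → E, ∀ n, F2Bound α (fun θ => y θ - x n θ) (ε n) := by
  have w0 : ∀ θ : ℝ, Complex.exp (θ * Complex.I) ≠ 1 → 0 < ‖Complex.exp (θ * Complex.I) - 1‖ :=
    fun θ hθ => norm_pos_iff.2 (sub_ne_zero.2 hθ)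
  have w1 : ∀ θ : ℝ, 0 < ‖Complex.exp (θ * Complex.I) - 1‖ → Complex.exp (θ * Complex.I) ≠ 1 :=
    fun θ hθ => sub_ne_zero.1 (norm_pos_iff.1 hθ)
  have c0 : ∀ n m, n ≤ m → ∀ θ : ℝ, (0 : ℝ) < 1 → (1 : ℝ) * ‖x m θ - x n θ‖ ≤ ε n :=
    fun n m hnm θ _ => by rw [one_mul]; exact (h n m hnm).norm_le θ
  have c1 : ∀ n m, n ≤ m → ∀ θ : ℝ, 0 < ‖Complex.exp (θ * Complex.I) - 1‖ ^ 1 →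
      ‖Complex.exp (θ * Complex.I) - 1‖ ^ 1 * ‖deriv (x m) θ - deriv (x n) θ‖ ≤ ε n := by
    intro n m hnm θ hθ
    rw [pow_one] at hθ ⊢
    rw [← (hx m).deriv_sub (hx n) (w1 θ hθ)]
    exact (h n m hnm).norm_deriv_le θ
  have c2 : ∀ n m, n ≤ m → ∀ θ : ℝ, 0 < ‖Complex.exp (θ * Complex.I) - 1‖ ^ 2 →
      ‖Complex.exp (θ * Complex.I) - 1‖ ^ 2 * ‖deriv (deriv (x m)) θ - deriv (deriv (x n)) θ‖
        ≤ ε n := by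
    intro n m hnm θ hθ
    rw [← (hx m).deriv2_sub (hx n) (w1 θ ((norm_nonneg _).lt_of_ne fun h0 => by simp [← h0] at hθ))]
    exact (h n m hnm).norm_deriv2_le θ
  obtain ⟨y0, hy0⟩ := exists_limit_of_weighted_cauchy hε c0
  obtain ⟨y1, hy1⟩ := exists_limit_of_weighted_cauchy hε c1
  obtain ⟨y2, hy2⟩ := exists_limit_of_weighted_cauchy hε c2
  have hy0' : ∀ θ, Tendsto (fun n => x n θ) atTop (𝓝 (y0 θ)) := fun θ => hy0 θ one_pos
  have d1 : ∀ θ : ℝ, Complex.exp (θ * Complex.I) ≠ 1 → HasDerivAt y0 (y1 θ) θ :=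
    hasDerivAt_of_weighted_cauchy hε (fun n θ hθ => ((hx n).diff θ hθ).hasDerivAt)
      (fun θ _ => hy0' θ)
      (fun n θ hθ => weighted_dist_limit_le c1 hy1 n θ (pow_pos (w0 θ hθ) _))
  have d2 : ∀ θ : ℝ, Complex.exp (θ * Complex.I) ≠ 1 → HasDerivAt y1 (y2 θ) θ :=
    hasDerivAt_of_weighted_cauchy hε (fun n θ hθ => ((hx n).diff2 θ hθ).hasDerivAt)
      (fun θ hθ => hy1 θ (pow_pos (w0 θ hθ) _))
      (fun n θ hθ => weighted_dist_limit_le c2 hy2 n θ (pow_pos (w0 θ hθ) _))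
  refine ⟨y0, fun n => F2Bound.of_hasDerivAt (fun θ => ?_)
    (fun θ hθ => (d1 θ hθ).sub ((hx n).diff θ hθ).hasDerivAt)
    (fun θ hθ => (d2 θ hθ).sub ((hx n).diff2 θ hθ).hasDerivAt)
    (HB.of_tendsto ((eventually_ge_atTop n).mono fun m hm => (h n m hm).b0)
      fun θ _ => (hy0' θ).sub_const _)
    (HB.of_tendsto ((eventually_ge_atTop n).mono fun m hm => (h n m hm).b1) fun θ hθ => ?_)
    (HB.of_tendsto ((eventually_ge_atTop n).mono fun m hm => (h n m hm).b2) fun θ hθ => ?_)⟩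
  · have : y0 (θ + 2 * Real.pi) = y0 θ :=
      tendsto_nhds_unique (hy0' _) (by simpa only [(hx _).periodic θ] using hy0' θ)
    simp only [this, (hx n).periodic θ]
  · rcases eq_or_ne θ 0 with rfl | h0
    · simp
    · have hθ' := exp_ne_one_of_mem hθ h0
      simp only [(hx _).deriv_sub (hx n) hθ']
      exact ((hy1 θ (pow_pos (w0 θ hθ') _)).sub_const _).const_smul θ
  · rcases eq_or_ne θ 0 with rfl | h0
    · simp
    · have hθ' := exp_ne_one_of_mem hθ h0
      simp only [(hx _).deriv2_sub (hx n) hθ']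
      exact ((hy2 θ (pow_pos (w0 θ hθ') _)).sub_const _).const_smul (θ ^ 2)

/-- Contraction principle in a ball of `F^{2,α}`. -/
lemma F2Bound.exists_fixedPoint [CompleteSpace E] {Ψ : (ℝ → E) → ℝ → E} {x₀ : ℝ → E} {r C₀ : ℝ}
    (h0 : F2Bound α x₀ C₀)
    (hΨ : ∀ x y, F2Bound α (fun θ => x θ - x₀ θ) r → F2Bound α (fun θ => y θ - x₀ θ) r →
      ∀ C, F2Bound α (fun θ => x θ - y θ) C → F2Bound α (fun θ => Ψ x θ - Ψ y θ) (C / 2))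
    (hr : F2Bound α (fun θ => Ψ x₀ θ - x₀ θ) (r / 2)) :
    ∃ x, Ψ x = x ∧ F2Bound α (fun θ => x θ - x₀ θ) r := by
  have hr0 : 0 ≤ r := by linarith [hr.nonneg]
  set x : ℕ → ℝ → E := fun n => Ψ^[n] x₀ with hxdef
  have hsucc : ∀ n, x (n + 1) = Ψ (x n) := fun n => Function.iterate_succ_apply' Ψ n x₀
  -- The distance to the centre is carried as `r(1 - 2⁻ⁿ)`, which keeps every iterate in the ball
  -- where the contraction hypothesis is available.
  have hstep : ∀ n, F2Bound α (fun θ => x n θ - x₀ θ) (r * (1 - (1 / 2) ^ n)) ∧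
      F2Bound α (fun θ => x (n + 1) θ - x n θ) (r * (1 / 2) ^ (n + 1)) := by
    intro n
    induction n with
    | zero =>
      refine ⟨?_, ?_⟩
      · simpa [hxdef] using F2Bound.const (α := α) (0 : E)
      · simpa [hxdef, div_eq_mul_inv] using hr
    | succ n ih =>
      have hn : F2Bound α (fun θ => x (n + 1) θ - x₀ θ) (r * (1 - (1 / 2) ^ (n + 1))) := by
        have := ih.2.add ih.1
        simp only [sub_add_sub_cancel] at this
        exact this.mono (le_of_eq (by ring))
      have hle : ∀ m, r * (1 - (1 / 2 : ℝ) ^ m) ≤ r := fun m => by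
        have : (0 : ℝ) ≤ (1 / 2) ^ m := by positivity
        nlinarith
      refine ⟨hn, ?_⟩
      have := hΨ _ _ (hn.mono (hle _)) (ih.1.mono (hle _)) _ ih.2
      rw [← hsucc, ← hsucc] at this
      exact this.mono (le_of_eq (by ring))
  have hdist : ∀ n m, n ≤ m → F2Bound α (fun θ => x m θ - x n θ)
      (r * ((1 / 2) ^ n - (1 / 2) ^ m)) := by
    intro n m hnm
    induction m, hnm using Nat.le_induction with
    | base => simpa using F2Bound.const (α := α) (0 : E)
    | succ m _ ih =>
      have := (hstep m).2.add ih
      simp only [sub_add_sub_cancel] at this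
      exact this.mono (le_of_eq (by ring))
  have hε : Tendsto (fun n : ℕ => r * (1 / 2 : ℝ) ^ n) atTop (𝓝 0) := by
    simpa using (tendsto_pow_atTop_nhds_zero_of_lt_one (r := (1 / 2 : ℝ)) (by norm_num)
      (by norm_num)).const_mul r
  obtain ⟨y, hy⟩ := F2Bound.exists_limit (C := fun n => r * (1 - (1 / 2) ^ n) + C₀)
    (fun n => by simpa using (hstep n).1.add h0) hε
    (fun n m hnm => (hdist n m hnm).mono (by
      have : (0 : ℝ) ≤ (1 / 2) ^ m := by positivity
      nlinarith))
  have hyr : F2Bound α (fun θ => y θ - x₀ θ) r := by simpa [hxdef] using hy 0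
  refine ⟨y, funext fun θ => ?_, hyr⟩
  have hxr : ∀ n, F2Bound α (fun θ => x n θ - x₀ θ) r := fun n => (hstep n).1.mono (by
    have : (0 : ℝ) ≤ (1 / 2) ^ n := by positivity
    nlinarith)
  have l1 : Tendsto (fun n => x n θ) atTop (𝓝 (y θ)) := by
    rw [tendsto_iff_norm_sub_tendsto_zero]
    refine squeeze_zero (fun _ => norm_nonneg _) (fun n => ?_) hε
    rw [norm_sub_rev]
    exact (hy n).norm_le θ
  have l2 : Tendsto (fun n => x (n + 1) θ) atTop (𝓝 (Ψ y θ)) := by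
    rw [tendsto_iff_norm_sub_tendsto_zero]
    have hε2 := hε.div_const 2
    rw [zero_div] at hε2
    refine squeeze_zero (fun _ => norm_nonneg _) (fun n => ?_) hε2
    rw [norm_sub_rev, hsucc]
    exact (hΨ _ _ hyr (hxr n) _ (hy n)).norm_le θ
  exact tendsto_nhds_unique l2 (l1.comp (tendsto_add_atTop_nat 1))

/-- A bound that improves by halving up to a fixed error is controlled by the error. -/
lemma F2Bound.of_half {σ : ℝ → E} {C₀ D : ℝ} (h0 : F2Bound α σ C₀)
    (h : ∀ C, F2Bound α σ C → F2Bound α σ (C / 2 + D)) : F2Bound α σ (2 * D) := by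
  have hn : ∀ n : ℕ, F2Bound α σ (C₀ * (1 / 2) ^ n + 2 * D * (1 - (1 / 2) ^ n)) := by
    intro n
    induction n with
    | zero => simpa using h0
    | succ n ih => exact (h _ ih).mono (le_of_eq (by ring))
  have hlim : Tendsto (fun n : ℕ => C₀ * (1 / 2 : ℝ) ^ n + 2 * D * (1 - (1 / 2) ^ n)) atTop
      (𝓝 (2 * D)) := by
    have := tendsto_pow_atTop_nhds_zero_of_lt_one (r := (1 / 2 : ℝ)) (by norm_num) (by norm_num)
    simpa using (this.const_mul C₀).add ((this.const_sub 1).const_mul (2 * D))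
  refine .of_forall_lt fun D' hD' => ?_
  obtain ⟨n, hn'⟩ := (hlim.eventually (gt_mem_nhds hD')).exists
  exact (hn n).mono hn'.le

end Picard

/-! ### Hadamard's lemma and extension across the boundary of a half space -/

section Extension
open Set Filter Topology MeasureTheory

universe u

/-- Induction on the order by differentiating under the integral. The target changes from `W` to `V
→L[ℝ] W`, so `W` is generalized inside the induction and shares the universe of `V`. -/
lemma contDiff_integral_unit_interval {V : Type u} [NormedAddCommGroup V] [NormedSpace ℝ V]
    [FiniteDimensional ℝ V] (n : ℕ) : ∀ {W : Type u} [NormedAddCommGroup W] [NormedSpace ℝ W]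
    [CompleteSpace W] {f : V × ℝ → W}, ContDiff ℝ n f →
      ContDiff ℝ n (fun p => ∫ s in (0 : ℝ)..1, f (p, s)) := by
  have := FiniteDimensional.proper ℝ V
  induction n with
  | zero =>
    intro W _ _ _ f hf
    rw [Nat.cast_zero, contDiff_zero] at hf ⊢
    exact intervalIntegral.continuous_parametric_intervalIntegral_of_continuous'
      (f := fun p s => f (p, s)) hf 0 1
  | succ n ih =>
    intro W _ _ _ f hf
    rw [Nat.cast_succ, contDiff_succ_iff_hasFDerivAt] at *
    obtain ⟨f', hf', hd⟩ := hf
    have hfc : Continuous f := continuous_iff_continuousAt.2 fun p => (hd p).continuousAt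
    set g : V × ℝ → V →L[ℝ] W := fun q => (f' q).comp (ContinuousLinearMap.inl ℝ V ℝ) with hg
    have hgn : ContDiff ℝ n g := hf'.clm_comp contDiff_const
    refine ⟨fun p => ∫ s in (0 : ℝ)..1, g (p, s), ih hgn, fun p => ?_⟩
    obtain ⟨M, hM⟩ := ((isCompact_closedBall p 1).prod
      (isCompact_Icc (a := (0 : ℝ)) (b := 1))).exists_bound_of_continuousOn
      hgn.continuous.continuousOn
    refine (intervalIntegral.hasFDerivAt_integral_of_dominated_of_fderiv_le
      (F := fun p s => f (p, s)) (F' := fun p s => g (p, s)) (bound := fun _ => M)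
      (Metric.ball_mem_nhds p one_pos) (.of_forall fun q => ?_) ?_ ?_ ?_ ?_ ?_)
    · exact (Continuous.aestronglyMeasurable (by fun_prop))
    · exact Continuous.intervalIntegrable (by fun_prop) _ _
    · have := hgn.continuous
      exact (Continuous.aestronglyMeasurable (by fun_prop))
    · refine .of_forall fun s hs q hq => hM (q, s) ⟨Metric.ball_subset_closedBall hq, ?_⟩
      rw [uIoc_of_le zero_le_one] at hs
      exact ⟨hs.1.le, hs.2⟩
    · exact intervalIntegrable_const
    · refine .of_forall fun s _ q _ => ?_
      have h1 : HasFDerivAt (fun q : V => (q, s)) (ContinuousLinearMap.inl ℝ V ℝ) q :=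
        hasFDerivAt_prodMk_left q s
      exact (hd (q, s)).comp q h1

/-- Hadamard's lemma. -/
lemma ContDiff.exists_factor {V W : Type u} [NormedAddCommGroup V] [NormedSpace ℝ V]
    [FiniteDimensional ℝ V] [NormedAddCommGroup W] [NormedSpace ℝ W] [CompleteSpace W] {n : ℕ}
    {Φ : V → W} (hΦ : ContDiff ℝ (n + 1 : ℕ) Φ) :
    ∃ Λ : V × V → V →L[ℝ] W, ContDiff ℝ n Λ ∧ (∀ u v, Φ u - Φ v = Λ (u, v) (u - v)) ∧
      ∀ u, Λ (u, u) = fderiv ℝ Φ u := by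
  have hd : Differentiable ℝ Φ := hΦ.differentiable (by simp)
  have h1 : ContDiff ℝ n (fderiv ℝ Φ) := hΦ.fderiv_right (by norm_cast)
  have hc := h1.continuous
  refine ⟨fun p => ∫ s in (0 : ℝ)..1, fderiv ℝ Φ (p.2 + s • (p.1 - p.2)), ?_, fun u v => ?_,
    fun u => by simp⟩
  · refine contDiff_integral_unit_interval n
      (f := fun q : (V × V) × ℝ => fderiv ℝ Φ (q.1.2 + q.2 • (q.1.1 - q.1.2))) ?_
    exact h1.comp (by fun_prop)
  · rw [ContinuousLinearMap.intervalIntegral_apply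
      (Continuous.intervalIntegrable (by fun_prop) _ _)]
    have hder : ∀ s : ℝ, HasDerivAt (fun s : ℝ => Φ (v + s • (u - v)))
        (fderiv ℝ Φ (v + s • (u - v)) (u - v)) s := by
      intro s
      refine (hd _).hasFDerivAt.comp_hasDerivAt s ?_
      simpa using ((hasDerivAt_id s).smul_const (u - v)).const_add v
    rw [intervalIntegral.integral_eq_sub_of_hasDerivAt (fun s _ => hder s)
      (Continuous.intervalIntegrable (by fun_prop) _ _)]
    simp

/-- Extension of a `C^n` function across the boundary of a half space by reflections. -/
lemma ContDiffOn.contDiff_reflect {E : Type u} [NormedAddCommGroup E] [NormedSpace ℝ E]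
    {ι : Type*} [Fintype ι] {μ : ι → ℝ} (hμ : ∀ j, 0 < μ j) (n : ℕ) :
    ∀ {F : Type u} [NormedAddCommGroup F] [NormedSpace ℝ F] {L : ι → F →L[ℝ] F},
      (∀ i ≤ n, ∀ y, ∑ j, (-μ j) ^ i • L j y = y) → ∀ {a : E × ℝ → F},
      ContDiffOn ℝ n a (univ ×ˢ Ici 0) →
      ContDiff ℝ n fun q : E × ℝ => if 0 ≤ q.2 then a q else ∑ j, L j (a (q.1, -μ j * q.2)) := by
  have hS : IsClosed ((univ : Set E) ×ˢ Ici (0 : ℝ)) := isClosed_univ.prod isClosed_Ici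
  have hT : IsClosed ((univ : Set E) ×ˢ Iic (0 : ℝ)) := isClosed_univ.prod isClosed_Iic
  have hST : (univ : Set E) ×ˢ Ici (0 : ℝ) ∪ (univ : Set E) ×ˢ Iic (0 : ℝ) = univ := by
    rw [← prod_union, Ici_union_Iic, univ_prod_univ]
  have hu : UniqueDiffOn ℝ ((univ : Set E) ×ˢ Ici (0 : ℝ)) :=
    uniqueDiffOn_univ.prod (uniqueDiffOn_Ici 0)
  have hneg : ∀ {F : Type u} [NormedAddCommGroup F] [NormedSpace ℝ F] {L : ι → F →L[ℝ] F}
      (_ : ∀ y, ∑ j, L j y = y) (a : E × ℝ → F), ∀ q ∈ (univ : Set E) ×ˢ Iic (0 : ℝ),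
      (if 0 ≤ q.2 then a q else ∑ j, L j (a (q.1, -μ j * q.2))) =
        ∑ j, L j (a (q.1, -μ j * q.2)) := by
    rintro F _ _ L hL a ⟨p, t⟩ ⟨-, ht⟩
    rcases eq_or_lt_of_le (show t ≤ 0 from ht) with rfl | h
    · simp [hL]
    · simp [not_le.2 h]
  have hmaps : ∀ j, MapsTo (fun q : E × ℝ => (q.1, -μ j * q.2)) ((univ : Set E) ×ˢ Iic (0 : ℝ))
      ((univ : Set E) ×ˢ Ici (0 : ℝ)) := by
    rintro j ⟨p, t⟩ ⟨-, ht⟩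
    have h1 : t ≤ 0 := ht
    exact ⟨mem_univ _, show 0 ≤ -μ j * t by nlinarith [hμ j]⟩
  induction n with
  | zero =>
    intro F _ _ L hL a ha
    have hL0 : ∀ y, ∑ j, L j y = y := by simpa using hL 0 le_rfl
    rw [Nat.cast_zero] at *
    rw [contDiffOn_zero] at ha
    rw [contDiff_zero, ← continuousOn_univ, ← hST]
    refine ContinuousOn.union_of_isClosed (ha.congr fun q hq => if_pos hq.2) ?_ hS hT
    refine ContinuousOn.congr ?_ (hneg hL0 a)
    refine continuousOn_finsetSum _ fun j _ => (L j).continuous.comp_continuousOn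
      (ha.comp (by fun_prop) (hmaps j))
  | succ n ih =>
    intro F _ _ L hL a ha
    have hL0 : ∀ y, ∑ j, L j y = y := by simpa using hL 0 (Nat.zero_le _)
    rw [Nat.cast_succ] at *
    rw [contDiffOn_succ_iff_fderivWithin hu] at ha
    obtain ⟨hda, -, ha'⟩ := ha
    set a' := fderivWithin ℝ a (univ ×ˢ Ici 0)
    let ρ : ι → E × ℝ →L[ℝ] E × ℝ := fun j =>
      (ContinuousLinearMap.fst ℝ E ℝ).prod ((-μ j) • ContinuousLinearMap.snd ℝ E ℝ)
    -- The derivative of a reflected term is `L j ∘ a' ∘ ρ j`, again a reflection formula but with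
    -- operator coefficients; this is why `L` is operator-valued in the statement. The `t`-direction
    -- contributes an extra `-μ j`, so the moment identities of order `i` for `L'` use those of
    -- orders `i` and `i + 1` for `L`.
    let L' : ι → (E × ℝ →L[ℝ] F) →L[ℝ] (E × ℝ →L[ℝ] F) := fun j =>
      (ContinuousLinearMap.compL ℝ (E × ℝ) F F (L j)).comp
        ((ContinuousLinearMap.compL ℝ (E × ℝ) (E × ℝ) F).flip (ρ j))
    have hL' : ∀ i ≤ n, ∀ ℓ, ∑ j, (-μ j) ^ i • L' j ℓ = ℓ := by
      intro i hi ℓ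
      refine ContinuousLinearMap.ext fun q => ?_
      have hq : ∀ j, (-μ j) ^ i • L j (ℓ (q.1, -μ j * q.2)) =
          (-μ j) ^ i • L j (ℓ (q.1, 0)) + (-μ j) ^ (i + 1) • L j (q.2 • ℓ (0, 1)) := by
        intro j
        have : ((q.1, -μ j * q.2) : E × ℝ) = (q.1, 0) + (-μ j) • q.2 • ((0 : E), (1 : ℝ)) := by
          simp
        rw [this]
        simp only [map_add, map_smul, smul_add, smul_smul, pow_succ, mul_assoc]
      calc (∑ j, (-μ j) ^ i • L' j ℓ) q = ∑ j, (-μ j) ^ i • L j (ℓ (q.1, -μ j * q.2)) := by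
            simp [L', ρ]
        _ = ℓ (q.1, 0) + q.2 • ℓ (0, 1) := by
            simp only [hq, Finset.sum_add_distrib]
            rw [hL i (by omega), hL (i + 1) (by omega)]
        _ = ℓ q := by
            rw [← map_smul, ← map_add]; simp
    rw [contDiff_succ_iff_hasFDerivAt]
    refine ⟨_, ih hL' ha', fun q => ?_⟩
    rw [← hasFDerivWithinAt_univ, ← hST]
    refine HasFDerivWithinAt.union ?_ ?_
    · by_cases hq : q ∈ (univ : Set E) ×ˢ Ici (0 : ℝ)
      · rw [if_pos (show 0 ≤ q.2 from hq.2)]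
        exact (hda q hq).hasFDerivWithinAt.congr (fun q hq => if_pos hq.2) (if_pos hq.2)
      · exact HasFDerivWithinAt.of_notMem_closure (by rwa [hS.closure_eq])
    · by_cases hq : q ∈ (univ : Set E) ×ˢ Iic (0 : ℝ)
      · rw [hneg (by simpa using hL' 0 (Nat.zero_le _)) a' q hq]
        refine HasFDerivWithinAt.congr ?_ (hneg hL0 a) (hneg hL0 a q hq)
        refine HasFDerivWithinAt.fun_sum fun j _ => ?_
        have h1 : HasFDerivWithinAt (fun q : E × ℝ => (q.1, -μ j * q.2)) (ρ j)
            (univ ×ˢ Iic 0) q := (ρ j).hasFDerivWithinAt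
        have h2 := (hda _ (hmaps j hq)).hasFDerivWithinAt.comp q h1 (hmaps j)
        exact (L j).hasFDerivAt.comp_hasFDerivWithinAt q h2
      · exact HasFDerivWithinAt.of_notMem_closure (by rwa [hT.closure_eq])

/-- The reflection ratios `1, …, n + 1` are distinct, so the Vandermonde system `∑ c_j (-μ_j)^i =
1`, `i ≤ n`, is solvable and all derivatives up to order `n` match across `t = 0`. -/
lemma ContDiffOn.exists_extension_halfSpace {E F : Type u} [NormedAddCommGroup E]
    [NormedSpace ℝ E] [NormedAddCommGroup F] [NormedSpace ℝ F] {n : ℕ} {a : E × ℝ → F}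
    (ha : ContDiffOn ℝ n a (univ ×ˢ Ici 0)) :
    ∃ b : E × ℝ → F, ContDiff ℝ n b ∧ ∀ p, ∀ t, 0 ≤ t → b (p, t) = a (p, t) := by
  let x : Fin (n + 1) → ℝ := fun j => -((j : ℝ) + 1)
  have hx : Function.Injective x := fun i j hij => by
    simpa [x, Fin.val_inj] using hij
  have hdet : IsUnit (Matrix.vandermonde x) := by
    rw [Matrix.isUnit_iff_isUnit_det]
    exact (Matrix.det_vandermonde_ne_zero_iff.2 hx).isUnit
  obtain ⟨c, hc⟩ := Matrix.vecMul_surjective_iff_isUnit.2 hdet (fun _ => 1)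
  refine ⟨_, ha.contDiff_reflect (μ := fun j : Fin (n + 1) => (j : ℝ) + 1)
    (fun j => by positivity) n (L := fun j => c j • ContinuousLinearMap.id ℝ F)
    (fun i hi y => ?_), fun p t ht => if_pos ht⟩
  have := congrFun hc ⟨i, by omega⟩
  simp only [Matrix.vecMul, dotProduct, Matrix.vandermonde_apply, x] at this
  simp only [smul_apply, ContinuousLinearMap.id_apply, smul_smul]
  rw [← Finset.sum_smul]
  simp only [mul_comm] at this ⊢
  rw [this, one_smul]

/-- Hadamard's lemma for the extension, between `(p, t)` and `(p, 0)`. The transverse factor lives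
on the whole space, so no one-sided calculus is needed afterwards. -/
lemma ContDiffOn.exists_eq_add_smul_halfSpace {E F : Type u} [NormedAddCommGroup E]
    [NormedSpace ℝ E] [FiniteDimensional ℝ E] [NormedAddCommGroup F] [NormedSpace ℝ F]
    [CompleteSpace F] {n : ℕ} {a : E × ℝ → F}
    (ha : ContDiffOn ℝ (n + 1 : ℕ) a (univ ×ˢ Ici 0)) :
    ∃ K : E × ℝ → F, ContDiff ℝ n K ∧ ∀ p, ∀ t, 0 ≤ t → a (p, t) = a (p, 0) + t • K (p, t) := by
  obtain ⟨b, hb, hab⟩ := ha.exists_extension_halfSpace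
  obtain ⟨Λ, hΛ, h1, -⟩ := hb.exists_factor
  refine ⟨fun q => Λ (q, (q.1, 0)) (0, 1), ?_, fun p t ht => ?_⟩
  · exact (hΛ.comp (by fun_prop)).clm_apply contDiff_const
  · rw [← hab p t ht, ← hab p 0 le_rfl, ← sub_eq_iff_eq_add', h1, ← map_smul]
    simp

end Extension

/-! ### The Cauchy transform in the disc and the growth of its derivative -/

section CauchyTransform
open Set Filter Topology MeasureTheory

/-- The point `e^{iθ}` of the unit circle. -/
noncomputable def expI (θ : ℝ) : ℂ := Complex.exp (θ * Complex.I)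

lemma norm_expI (θ : ℝ) : ‖expI θ‖ = 1 := Complex.norm_exp_ofReal_mul_I θ

lemma expI_ne_zero (θ : ℝ) : expI θ ≠ 0 := Complex.exp_ne_zero _

lemma expI_zero : expI 0 = 1 := by simp [expI]

lemma contDiff_expI {n : WithTop ℕ∞} : ContDiff ℝ n expI :=
  (Complex.ofRealCLM.contDiff.mul contDiff_const).cexp

@[fun_prop]
lemma continuous_expI : Continuous expI := contDiff_expI.continuous (n := 0)

lemma hasDerivAt_expI (θ : ℝ) : HasDerivAt expI (Complex.I * expI θ) θ := by
  have := ((Complex.ofRealCLM.hasDerivAt (x := θ)).mul_const Complex.I).cexp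
  exact this.congr_deriv (by simp [expI, mul_comm])

lemma periodic_expI : Function.Periodic expI (2 * Real.pi) := fun θ => by
  simp [expI, add_mul, Complex.exp_add, Complex.exp_two_pi_mul_I]

lemma expI_sub (θ φ : ℝ) : expI (θ - φ) * expI φ = expI θ := by
  rw [expI, expI, expI, ← Complex.exp_add]; push_cast; ring_nf

lemma norm_expI_sub_expI_le (θ φ : ℝ) : ‖expI θ - expI φ‖ ≤ |θ - φ| := by
  rw [← expI_sub θ φ, ← sub_one_mul, norm_mul, norm_expI, mul_one]
  exact norm_exp_sub_one_le _

lemma le_norm_expI_sub_one {θ : ℝ} (h : |θ| ≤ Real.pi) :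
    2 / Real.pi * |θ| ≤ ‖expI θ - 1‖ := by
  have h1 : ‖expI θ - 1‖ = 2 * |Real.sin (θ / 2)| := by
    rw [expI, mul_comm, Complex.norm_exp_I_mul_ofReal_sub_one, norm_mul]; simp
  have h2 := Real.mul_abs_le_abs_sin (x := θ / 2)
    (by rw [abs_div, abs_of_pos (zero_lt_two' ℝ)]; linarith)
  rw [abs_div, abs_of_pos (zero_lt_two' ℝ)] at h2
  rw [h1]
  linarith

lemma expI_mem_sphere (θ : ℝ) : expI θ ∈ Metric.sphere (0 : ℂ) 1 := by simp [norm_expI]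

lemma expI_mem_closedBall (θ : ℝ) : expI θ ∈ Metric.closedBall (0 : ℂ) 1 := by simp [norm_expI]

lemma exists_expI_eq {ζ : ℂ} (h : ‖ζ‖ = 1) : ∃ θ ∈ Icc (-Real.pi) Real.pi, expI θ = ζ := by
  refine ⟨ζ.arg, ⟨(Complex.neg_pi_lt_arg ζ).le, Complex.arg_le_pi ζ⟩, ?_⟩
  have := Complex.norm_mul_exp_arg_mul_I ζ
  rwa [h, Complex.ofReal_one, one_mul] at this

lemma exists_norm_mul_expI_eq (τ : ℂ) :
    ∃ φ ∈ Icc (-Real.pi) Real.pi, (‖τ‖ : ℂ) * expI φ = τ :=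
  ⟨τ.arg, ⟨(Complex.neg_pi_lt_arg τ).le, Complex.arg_le_pi τ⟩, Complex.norm_mul_exp_arg_mul_I τ⟩

lemma expI_sub_ne_zero {τ : ℂ} (hτ : τ ∈ Metric.ball (0 : ℂ) 1) (θ : ℝ) : expI θ - τ ≠ 0 := by
  rw [sub_ne_zero]
  rintro rfl
  simp [norm_expI] at hτ

lemma one_sub_norm_le (θ : ℝ) (τ : ℂ) : 1 - ‖τ‖ ≤ ‖expI θ - τ‖ := by
  simpa [norm_expI] using norm_sub_norm_le (expI θ) τ

/-- The distance from `e^{iθ}` to `r e^{iφ}` is at least `1 - r`, and at least the chord minus `1 -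
r`. Adding the two bounds gives half the chord, which Jordan's inequality estimates. -/
lemma abs_div_pi_le_norm_expI_sub {r θ φ : ℝ} (hr0 : 0 ≤ r) (hr : r < 1) (h : |θ - φ| ≤ Real.pi) :
    |θ - φ| / Real.pi ≤ ‖expI θ - r * expI φ‖ := by
  have h1 := le_norm_expI_sub_one h
  have h2 : ‖expI θ - expI φ‖ = ‖expI (θ - φ) - 1‖ := by
    rw [← expI_sub θ φ, ← sub_one_mul, norm_mul, norm_expI, mul_one]
  have h3 : ‖expI θ - expI φ‖ ≤ ‖expI θ - r * expI φ‖ + ‖r * expI φ - expI φ‖ :=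
    norm_sub_le_norm_sub_add_norm_sub _ _ _
  have h4 : ‖r * expI φ - expI φ‖ = 1 - r := by
    rw [← sub_one_mul, norm_mul, norm_expI, mul_one, ← Complex.ofReal_one, ← Complex.ofReal_sub,
      Complex.norm_real, Real.norm_eq_abs, abs_of_neg (by linarith)]
    ring
  have h5 := one_sub_norm_le θ (r * expI φ)
  rw [norm_mul, norm_expI, mul_one, Complex.norm_real, Real.norm_eq_abs, abs_of_nonneg hr0] at h5
  have h6 : 2 / Real.pi * |θ - φ| = 2 * (|θ - φ| / Real.pi) := by ring
  linarith

/-- `v` is `α`-Hölder at distances up to `π`. -/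
def HolderCircle {E : Type*} [NormedAddCommGroup E] (α : ℝ) (v : ℝ → E) (D : ℝ) : Prop :=
  ∀ θ φ, |θ - φ| ≤ Real.pi → ‖v θ - v φ‖ ≤ D * |θ - φ| ^ α

lemma HolderCircle.continuous {E : Type*} [NormedAddCommGroup E] {α D : ℝ} {v : ℝ → E}
    (h : HolderCircle α v D) (hα : 0 < α) : Continuous v := by
  refine continuous_iff_continuousAt.2 fun φ => ?_
  rw [ContinuousAt, tendsto_iff_norm_sub_tendsto_zero]
  have h1 : ContinuousAt (fun θ : ℝ => D * |θ - φ| ^ α) φ :=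
    continuousAt_const.mul (ContinuousAt.rpow_const (by fun_prop) (Or.inr hα.le))
  have h2 := h1.tendsto
  simp only [sub_self, abs_zero, Real.zero_rpow hα.ne', mul_zero] at h2
  refine squeeze_zero' (.of_forall fun _ => norm_nonneg _) ?_ h2
  filter_upwards [Metric.closedBall_mem_nhds φ Real.pi_pos] with θ hθ
  exact h θ φ (by simpa [Real.dist_eq] using hθ)

/-- Two points closer than `π` may lie on opposite sides of the seam `±π`; passing through the seam
costs the factor `2`. -/
lemma HB.holderCircle {E : Type*} [NormedAddCommGroup E] [NormedSpace ℝ E] {α C : ℝ} {v : ℝ → E}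
    (h : HB α v C) (hα : 0 < α) (hp : Function.Periodic v (2 * Real.pi)) :
    HolderCircle α v (2 * C) := by
  have hC := h.nonneg
  have hpi := Real.pi_pos
  have hend : v Real.pi = v (-Real.pi) := by rw [← hp (-Real.pi)]; congr 1; ring
  have key : ∀ θ, ∀ φ ∈ Icc (-Real.pi) Real.pi, |θ - φ| ≤ Real.pi →
      ‖v θ - v φ‖ ≤ 2 * C * |θ - φ| ^ α := by
    intro θ φ hφ hθφ
    have hab := abs_le.1 hθφ
    have h2 : ∀ x, 0 ≤ x → x ≤ |θ - φ| → C * x ^ α ≤ C * |θ - φ| ^ α := fun x hx hx' => by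
      gcongr
    by_cases h1 : θ ∈ Icc (-Real.pi) Real.pi
    · have := h.2 θ h1 φ hφ
      have h3 : 0 ≤ C * |θ - φ| ^ α := by positivity
      linarith
    · rcases lt_or_ge Real.pi θ with h3 | h3
      · have e1 := h.2 (θ - 2 * Real.pi) ⟨by linarith, by linarith [hφ.2]⟩ (-Real.pi)
          ⟨le_rfl, by linarith⟩
        have e2 := h.2 Real.pi ⟨by linarith, le_rfl⟩ φ hφ
        rw [hp.sub_eq] at e1
        rw [hend] at e2
        rw [abs_of_nonneg (by linarith)] at e1
        rw [abs_of_nonneg (by linarith [hφ.2])] at e2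
        have e3 := h2 _ (by linarith) (show θ - 2 * Real.pi - -Real.pi ≤ |θ - φ| by
          rw [abs_of_nonneg (by linarith [hφ.2])]; linarith [hφ.2])
        have e4 := h2 _ (by linarith [hφ.2]) (show Real.pi - φ ≤ |θ - φ| by
          rw [abs_of_nonneg (by linarith [hφ.2])]; linarith [hφ.2])
        have := norm_sub_le_norm_sub_add_norm_sub (v θ) (v (-Real.pi)) (v φ)
        linarith
      · have h3' : θ < -Real.pi := by
          by_contra h4
          exact h1 ⟨not_lt.1 h4, h3⟩
        have e1 := h.2 (θ + 2 * Real.pi) ⟨by linarith [hφ.1], by linarith⟩ Real.pi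
          ⟨by linarith, le_rfl⟩
        have e2 := h.2 (-Real.pi) ⟨le_rfl, by linarith⟩ φ hφ
        rw [hp] at e1
        rw [← hend] at e2
        rw [abs_of_nonpos (by linarith)] at e1
        rw [abs_of_nonpos (by linarith [hφ.1])] at e2
        have e3 := h2 _ (by linarith) (show -(θ + 2 * Real.pi - Real.pi) ≤ |θ - φ| by
          rw [abs_of_nonpos (by linarith [hφ.1])]; linarith [hφ.1])
        have e4 := h2 _ (by linarith [hφ.1]) (show -(-Real.pi - φ) ≤ |θ - φ| by
          rw [abs_of_nonpos (by linarith [hφ.1])]; linarith [hφ.1])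
        have := norm_sub_le_norm_sub_add_norm_sub (v θ) (v Real.pi) (v φ)
        linarith
  intro θ φ hθφ
  obtain ⟨n, hn⟩ := exists_sub_int_mul_mem_Icc φ
  have := key (θ - n * (2 * Real.pi)) _ hn (by rwa [sub_sub_sub_cancel_right])
  rwa [sub_sub_sub_cancel_right, hp.sub_int_mul_eq, hp.sub_int_mul_eq] at this

lemma integral_add_abs_div_pi_rpow_le {α s : ℝ} (hα1 : α < 1) (hs : 0 < s) :
    ∫ t in (-Real.pi)..Real.pi, (s + |t| / Real.pi) ^ (α - 2) ≤
      2 * Real.pi / (1 - α) * s ^ (α - 1) := by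
  have hpi := Real.pi_pos
  have hc : Continuous fun t : ℝ => (s + |t| / Real.pi) ^ (α - 2) :=
    Continuous.rpow_const (by fun_prop) fun t => Or.inl (by positivity)
  have h0 : ∫ t in (0 : ℝ)..Real.pi, (s + |t| / Real.pi) ^ (α - 2) ≤
      Real.pi / (1 - α) * s ^ (α - 1) := by
    have hd : ∀ t ∈ uIcc 0 Real.pi, HasDerivAt
        (fun t : ℝ => -(Real.pi / (1 - α)) * (s + t / Real.pi) ^ (α - 1))
        ((s + |t| / Real.pi) ^ (α - 2)) t := by
      intro t ht
      rw [uIcc_of_le hpi.le] at ht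
      have hp : 0 < s + t / Real.pi := by have := ht.1; positivity
      have h1 : HasDerivAt (fun t : ℝ => s + t / Real.pi) (1 / Real.pi) t :=
        ((hasDerivAt_id t).div_const _).const_add s
      have := (h1.rpow_const (p := α - 1) (Or.inl hp.ne')).const_mul (-(Real.pi / (1 - α)))
      refine this.congr_deriv ?_
      rw [abs_of_nonneg ht.1, show α - 1 - 1 = α - 2 by ring]
      have : 1 - α ≠ 0 := by linarith
      field_simp
      ring
    rw [intervalIntegral.integral_eq_sub_of_hasDerivAt hd (hc.intervalIntegrable _ _)]
    have : 0 ≤ Real.pi / (1 - α) * (s + Real.pi / Real.pi) ^ (α - 1) := by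
      have : 0 ≤ 1 - α := by linarith
      positivity
    simp only [zero_div, add_zero]
    linarith
  have h1 : ∫ t in (-Real.pi)..0, (s + |t| / Real.pi) ^ (α - 2) =
      ∫ t in (0 : ℝ)..Real.pi, (s + |t| / Real.pi) ^ (α - 2) := by
    have := intervalIntegral.integral_comp_neg (a := 0) (b := Real.pi)
      (fun t : ℝ => (s + |t| / Real.pi) ^ (α - 2))
    simpa using this.symm
  rw [← intervalIntegral.integral_add_adjacent_intervals (hc.intervalIntegrable _ 0)
    (hc.intervalIntegrable _ _), h1]
  calc _ ≤ Real.pi / (1 - α) * s ^ (α - 1) + Real.pi / (1 - α) * s ^ (α - 1) := add_le_add h0 h0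
    _ = _ := by ring

/-- The distance `M` in the denominator dominates both `1 - r` and `|θ - φ|/π`, hence half their sum
`S`. The numerator is at most `D π M^α`, so the integrand is `O(M^{α-2}) = O(S^{α-2})`, whose
integral is explicit. -/
lemma HolderCircle.integral_norm_sub_div_le {E : Type*} [NormedAddCommGroup E] {α D r φ : ℝ}
    {v : ℝ → E} (h : HolderCircle α v D) (hD : 0 ≤ D) (hα : 0 < α) (hα1 : α < 1) (hr0 : 0 ≤ r)
    (hr : r < 1) :
    ∫ θ in (φ - Real.pi)..(φ + Real.pi), ‖v θ - v φ‖ / ‖expI θ - r * expI φ‖ ^ 2 ≤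
      8 * Real.pi ^ 2 / (1 - α) * D * (1 - r) ^ (α - 1) := by
  have hpi := Real.pi_pos
  have hs : 0 < 1 - r := by linarith
  have hτ : (r : ℂ) * expI φ ∈ Metric.ball (0 : ℂ) 1 := by
    simp [norm_expI, abs_of_nonneg hr0, hr]
  have hcv := h.continuous hα
  have hc1 : Continuous fun θ => ‖v θ - v φ‖ / ‖expI θ - r * expI φ‖ ^ 2 :=
    (by fun_prop : Continuous fun θ => ‖v θ - v φ‖).div (by fun_prop)
      fun θ => pow_ne_zero _ (norm_ne_zero_iff.2 (expI_sub_ne_zero hτ θ))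
  have hc2 : Continuous fun θ : ℝ => 4 * Real.pi * D *
      ((1 - r) + |θ - φ| / Real.pi) ^ (α - 2) :=
    continuous_const.mul (Continuous.rpow_const (by fun_prop) fun t => Or.inl (by positivity))
  have hle : ∀ θ ∈ Icc (φ - Real.pi) (φ + Real.pi),
      ‖v θ - v φ‖ / ‖expI θ - r * expI φ‖ ^ 2 ≤
        4 * Real.pi * D * ((1 - r) + |θ - φ| / Real.pi) ^ (α - 2) := by
    intro θ hθ
    have hθ' : |θ - φ| ≤ Real.pi := abs_le.2 ⟨by linarith [hθ.1], by linarith [hθ.2]⟩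
    set M := ‖expI θ - r * expI φ‖ with hM
    have h1 : 1 - r ≤ M := by
      have := one_sub_norm_le θ (r * expI φ)
      rwa [norm_mul, norm_expI, mul_one, Complex.norm_real, Real.norm_eq_abs,
        abs_of_nonneg hr0] at this
    have h2 : |θ - φ| / Real.pi ≤ M := abs_div_pi_le_norm_expI_sub hr0 hr hθ'
    have hM0 : 0 < M := by linarith
    have hpi1 : (1 : ℝ) ≤ Real.pi := by linarith [Real.pi_gt_three]
    have h3 : |θ - φ| ^ α ≤ Real.pi * M ^ α := by
      calc |θ - φ| ^ α ≤ (Real.pi * M) ^ α := by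
            gcongr; rw [div_le_iff₀ hpi] at h2; linarith
        _ = Real.pi ^ α * M ^ α := Real.mul_rpow hpi.le hM0.le
        _ ≤ Real.pi ^ (1 : ℝ) * M ^ α := by gcongr
        _ = _ := by rw [Real.rpow_one]
    have h4 : M ^ (α - 2) = M ^ α / M ^ 2 := by
      rw [Real.rpow_sub hM0]; norm_num
    have h5 : M ^ (α - 2) ≤ 4 * ((1 - r) + |θ - φ| / Real.pi) ^ (α - 2) := by
      set S := (1 - r) + |θ - φ| / Real.pi with hS
      have hS0 : 0 < S := by positivity
      calc M ^ (α - 2) ≤ (2⁻¹ * S) ^ (α - 2) :=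
            Real.rpow_le_rpow_of_nonpos (by positivity) (by linarith) (by linarith)
        _ = (2⁻¹) ^ (α - 2) * S ^ (α - 2) := Real.mul_rpow (by norm_num) hS0.le
        _ = 2 ^ (2 - α) * S ^ (α - 2) := by
            rw [Real.inv_rpow (by norm_num), ← Real.rpow_neg (by norm_num), neg_sub]
        _ ≤ 2 ^ (2 : ℝ) * S ^ (α - 2) := by
            gcongr
            · norm_num
            · linarith
        _ = _ := by norm_num
    calc ‖v θ - v φ‖ / M ^ 2 ≤ D * (Real.pi * M ^ α) / M ^ 2 := by
          gcongr; exact (h θ φ hθ').trans (by gcongr)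
      _ = Real.pi * D * M ^ (α - 2) := by rw [h4]; ring
      _ ≤ Real.pi * D * (4 * ((1 - r) + |θ - φ| / Real.pi) ^ (α - 2)) := by gcongr
      _ = _ := by ring
  calc _ ≤ ∫ θ in (φ - Real.pi)..(φ + Real.pi), 4 * Real.pi * D *
        ((1 - r) + |θ - φ| / Real.pi) ^ (α - 2) :=
        intervalIntegral.integral_mono_on (by linarith) (hc1.intervalIntegrable _ _)
          (hc2.intervalIntegrable _ _) hle
    _ = 4 * Real.pi * D * ∫ t in (-Real.pi)..Real.pi, ((1 - r) + |t| / Real.pi) ^ (α - 2) := by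
        rw [intervalIntegral.integral_const_mul]
        congr 1
        have := intervalIntegral.integral_comp_sub_right
          (a := φ - Real.pi) (b := φ + Real.pi)
          (fun t : ℝ => ((1 - r) + |t| / Real.pi) ^ (α - 2)) φ
        rw [this]
        congr 1 <;> ring
    _ ≤ 4 * Real.pi * D * (2 * Real.pi / (1 - α) * (1 - r) ^ (α - 1)) := by
        gcongr
        exact integral_add_abs_div_pi_rpow_le hα1 hs
    _ = _ := by ring

/-- The Cauchy transform of a function on the unit circle, written in the angle. -/
noncomputable def cauchyTransform (v : ℝ → ℂ) (τ : ℂ) : ℂ :=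
  (2 * Real.pi : ℂ)⁻¹ * ∫ θ in (-Real.pi)..Real.pi, v θ * (expI θ / (expI θ - τ))

/-- The derivative of the Cauchy transform. -/
noncomputable def cauchyTransformDeriv (v : ℝ → ℂ) (τ : ℂ) : ℂ :=
  (2 * Real.pi : ℂ)⁻¹ * ∫ θ in (-Real.pi)..Real.pi, v θ * (expI θ / (expI θ - τ) ^ 2)

lemma continuous_kernel {τ : ℂ} (hτ : τ ∈ Metric.ball (0 : ℂ) 1) :
    Continuous fun θ => expI θ / (expI θ - τ) :=
  continuous_expI.div (by fun_prop) (expI_sub_ne_zero hτ)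

lemma continuous_kernel_sq {τ : ℂ} (hτ : τ ∈ Metric.ball (0 : ℂ) 1) :
    Continuous fun θ => expI θ / (expI θ - τ) ^ 2 :=
  continuous_expI.div (by fun_prop) fun θ => pow_ne_zero _ (expI_sub_ne_zero hτ θ)

lemma hasDerivAt_cauchyTransform {v : ℝ → ℂ} (hv : Continuous v) {τ : ℂ}
    (hτ : τ ∈ Metric.ball (0 : ℂ) 1) :
    HasDerivAt (cauchyTransform v) (cauchyTransformDeriv v τ) τ := by
  rw [mem_ball_zero_iff] at hτ
  have hs : 0 < (1 - ‖τ‖) / 2 := by linarith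
  have hball : ∀ σ ∈ Metric.ball τ ((1 - ‖τ‖) / 2), ‖σ‖ < 1 - (1 - ‖τ‖) / 2 := by
    intro σ hσ
    rw [mem_ball_iff_norm] at hσ
    have := norm_sub_norm_le σ τ
    linarith
  have hball' : ∀ σ ∈ Metric.ball τ ((1 - ‖τ‖) / 2), σ ∈ Metric.ball (0 : ℂ) 1 := by
    intro σ hσ
    have := hball σ hσ
    rw [mem_ball_zero_iff]; linarith
  refine HasDerivAt.const_mul _ ?_
  refine (intervalIntegral.hasDerivAt_integral_of_dominated_loc_of_deriv_le
    (F := fun τ θ => v θ * (expI θ / (expI θ - τ)))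
    (F' := fun τ θ => v θ * (expI θ / (expI θ - τ) ^ 2))
    (bound := fun θ => ‖v θ‖ / ((1 - ‖τ‖) / 2) ^ 2)
    (Metric.ball_mem_nhds τ hs) ?_ ?_ ?_ ?_ ?_ ?_).2
  · filter_upwards [Metric.ball_mem_nhds τ hs] with σ hσ
    exact (hv.mul (continuous_kernel (hball' σ hσ))).aestronglyMeasurable
  · exact (hv.mul (continuous_kernel (by simpa using hτ))).intervalIntegrable _ _
  · exact (hv.mul (continuous_kernel_sq (by simpa using hτ))).aestronglyMeasurable
  · refine .of_forall fun θ _ σ hσ => ?_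
    rw [norm_mul, norm_div, norm_expI, norm_pow, div_eq_mul_one_div ‖v θ‖]
    have h1 := one_sub_norm_le θ σ
    have h2 := hball σ hσ
    gcongr
    linarith
  · exact (hv.norm.div_const _).intervalIntegrable _ _
  · refine .of_forall fun θ _ σ hσ => ?_
    have h1 : HasDerivAt (fun σ : ℂ => expI θ - σ) (-1) σ := (hasDerivAt_id σ).const_sub _
    have h2 := ((hasDerivAt_const σ (expI θ)).div h1
      (expI_sub_ne_zero (hball' σ hσ) θ)).const_mul (v θ)
    simpa using h2

lemma hasDerivAt_kernel {τ : ℂ} (hτ : τ ∈ Metric.ball (0 : ℂ) 1) (θ : ℝ) :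
    HasDerivAt (fun θ => expI θ / (expI θ - τ))
      (-(Complex.I * τ * (expI θ / (expI θ - τ) ^ 2))) θ := by
  have h := (hasDerivAt_expI θ).div ((hasDerivAt_expI θ).sub_const τ) (expI_sub_ne_zero hτ θ)
  refine h.congr_deriv ?_
  have := expI_sub_ne_zero hτ θ
  field_simp
  ring

lemma integral_periodic_shift {E : Type*} [NormedAddCommGroup E] [NormedSpace ℝ E] {f : ℝ → E}
    (hf : Function.Periodic f (2 * Real.pi)) (φ : ℝ) :
    ∫ θ in (-Real.pi)..Real.pi, f θ = ∫ θ in (φ - Real.pi)..(φ + Real.pi), f θ := by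
  have := hf.intervalIntegral_add_eq (-Real.pi) (φ - Real.pi)
  convert this using 2 <;> ring

lemma expI_pi : expI Real.pi = -1 := Complex.exp_pi_mul_I

lemma expI_neg_pi : expI (-Real.pi) = -1 := by
  rw [← expI_pi, ← periodic_expI (-Real.pi)]; congr 1; ring

lemma cauchyTransform_one {τ : ℂ} (hτ : τ ∈ Metric.ball (0 : ℂ) 1) :
    ∫ θ in (-Real.pi)..Real.pi, expI θ / (expI θ - τ) = 2 * Real.pi := by
  have h := circleIntegral.integral_sub_inv_of_mem_ball (c := 0) (R := 1) hτ
  rw [circleIntegral] at h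
  have hper : Function.Periodic (fun θ => expI θ / (expI θ - τ)) (2 * Real.pi) := fun θ => by
    simp only [periodic_expI θ]
  rw [integral_periodic_shift hper Real.pi, sub_self, ← two_mul]
  have h2 : ∀ θ : ℝ, deriv (circleMap 0 1) θ • (circleMap 0 1 θ - τ)⁻¹ =
      Complex.I * (expI θ / (expI θ - τ)) := by
    intro θ
    simp [circleMap, expI, div_eq_mul_inv]
    ring
  simp only [h2, intervalIntegral.integral_const_mul] at h
  refine mul_left_cancel₀ Complex.I_ne_zero (h.trans ?_)
  ring

lemma integral_kernel_sq {τ : ℂ} (hτ : τ ∈ Metric.ball (0 : ℂ) 1) :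
    ∫ θ in (-Real.pi)..Real.pi, expI θ / (expI θ - τ) ^ 2 = 0 := by
  have hd : ∀ θ ∈ uIcc (-Real.pi) Real.pi, HasDerivAt (fun θ => Complex.I * (expI θ - τ)⁻¹)
      (expI θ / (expI θ - τ) ^ 2) θ := by
    intro θ _
    have h := (((hasDerivAt_expI θ).sub_const τ).inv (expI_sub_ne_zero hτ θ)).const_mul Complex.I
    refine h.congr_deriv ?_
    have := Complex.I_mul_I
    linear_combination (-(expI θ / (expI θ - τ) ^ 2)) * this
  rw [intervalIntegral.integral_eq_sub_of_hasDerivAt hd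
    ((continuous_kernel_sq hτ).intervalIntegrable _ _), expI_pi, expI_neg_pi, sub_self]

/-- The kernel of the derivative has integral zero, so the value of `v` at the argument `φ` of `τ`
can be subtracted, after which the Hölder bound absorbs part of the singularity. -/
lemma HolderCircle.norm_cauchyTransformDeriv_le {α D : ℝ} {v : ℝ → ℂ} (h : HolderCircle α v D)
    (hp : Function.Periodic v (2 * Real.pi)) (hD : 0 ≤ D) (hα : 0 < α) (hα1 : α < 1) {τ : ℂ}
    (hτ : τ ∈ Metric.ball (0 : ℂ) 1) :
    ‖cauchyTransformDeriv v τ‖ ≤ 4 * Real.pi / (1 - α) * D * (1 - ‖τ‖) ^ (α - 1) := by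
  have hpi := Real.pi_pos
  obtain ⟨φ, -, hφ⟩ := exists_norm_mul_expI_eq τ
  have hv := h.continuous hα
  have h1 : cauchyTransformDeriv v τ = (2 * Real.pi : ℂ)⁻¹ *
      ∫ θ in (φ - Real.pi)..(φ + Real.pi), (v θ - v φ) * (expI θ / (expI θ - τ) ^ 2) := by
    have hper : Function.Periodic (fun θ => (v θ - v φ) * (expI θ / (expI θ - τ) ^ 2))
        (2 * Real.pi) := fun θ => by simp only [periodic_expI θ, hp θ]
    rw [← integral_periodic_shift hper, cauchyTransformDeriv]
    simp only [sub_mul]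
    have hk := continuous_kernel_sq hτ
    rw [intervalIntegral.integral_sub
      (Continuous.intervalIntegrable (by fun_prop) _ _)
      (Continuous.intervalIntegrable (by fun_prop) _ _),
      intervalIntegral.integral_const_mul, integral_kernel_sq hτ, mul_zero, sub_zero]
  have h2 : ‖∫ θ in (φ - Real.pi)..(φ + Real.pi), (v θ - v φ) * (expI θ / (expI θ - τ) ^ 2)‖ ≤
      8 * Real.pi ^ 2 / (1 - α) * D * (1 - ‖τ‖) ^ (α - 1) := by
    refine (intervalIntegral.norm_integral_le_integral_norm (by linarith)).trans ?_
    refine le_trans (le_of_eq ?_) (h.integral_norm_sub_div_le (φ := φ) hD hα hα1 (norm_nonneg τ)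
      (by simpa using hτ))
    refine intervalIntegral.integral_congr fun θ _ => ?_
    simp only [norm_mul, norm_div, norm_expI, norm_pow, hφ]
    ring
  rw [h1, norm_mul]
  have h3 : ‖(2 * Real.pi : ℂ)⁻¹‖ = (2 * Real.pi)⁻¹ := by
    rw [norm_inv, norm_mul]; simp [abs_of_pos hpi]
  rw [h3]
  calc _ ≤ (2 * Real.pi)⁻¹ * (8 * Real.pi ^ 2 / (1 - α) * D * (1 - ‖τ‖) ^ (α - 1)) := by gcongr
    _ = _ := by
      have : 1 - α ≠ 0 := by linarith
      field_simp
      ring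

end CauchyTransform

/-! ### Privalov's theorem and the boundary values of the Poisson integral -/

section BoundaryValues
open Set Filter Topology MeasureTheory

/-- Integrate along the inward segment `s ↦ (1 - s)a`, whose distance to the circle is at least `s +
c`. The shift `c > 0` keeps `(s + c)^α` differentiable at `s = 0`; subadditivity of the power
removes it at the end. -/
lemma norm_sub_le_of_norm_deriv_le_radial {f : ℂ → ℂ} {α K : ℝ} (hα : 0 < α) (hα1 : α < 1)
    (hK : 0 ≤ K) (hf : DifferentiableOn ℂ f (Metric.ball 0 1))
    (hd : ∀ τ ∈ Metric.ball (0 : ℂ) 1, ‖deriv f τ‖ ≤ K * (1 - ‖τ‖) ^ (α - 1)) {a : ℂ}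
    (ha : a ∈ Metric.ball (0 : ℂ) 1) {ℓ : ℝ} (h0 : 0 ≤ ℓ) (h1 : ℓ < 1) :
    ‖f ((1 - ℓ : ℝ) • a) - f a‖ ≤ K / α * ℓ ^ α := by
  rw [mem_ball_zero_iff] at ha
  set c := (1 - ‖a‖) * (1 - ℓ) with hc
  have hc0 : 0 < c := mul_pos (by linarith) (by linarith)
  have hmem : ∀ s ∈ Icc 0 ℓ, (1 - s : ℝ) • a ∈ Metric.ball (0 : ℂ) 1 ∧
      s + c ≤ 1 - ‖(1 - s : ℝ) • a‖ := by
    intro s hs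
    have hn : ‖(1 - s : ℝ) • a‖ = (1 - s) * ‖a‖ := by
      rw [norm_smul, Real.norm_eq_abs, abs_of_nonneg (by linarith [hs.2])]
    rw [mem_ball_zero_iff, hn]
    have := norm_nonneg a
    constructor
    · nlinarith [hs.1, hs.2]
    · rw [hc]; nlinarith [hs.1, hs.2, mul_nonneg (sub_nonneg.2 ha.le) (sub_nonneg.2 hs.2)]
  have hder : ∀ s ∈ Icc 0 ℓ, HasDerivAt (fun s : ℝ => f ((1 - s : ℝ) • a) - f a)
      (-a * deriv f ((1 - s : ℝ) • a)) s := by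
    intro s hs
    have e1 : HasDerivAt (fun s : ℝ => (1 - s : ℝ) • a) ((-1 : ℝ) • a) s :=
      ((hasDerivAt_id s).const_sub 1).smul_const a
    have e2 := (hf.differentiableAt (Metric.isOpen_ball.mem_nhds (hmem s hs).1)).hasDerivAt
    have := (e2.scomp s e1).sub_const (f a)
    refine this.congr_deriv ?_
    simp
  have key := image_norm_le_of_norm_deriv_right_le_deriv_boundary'
    (f := fun s : ℝ => f ((1 - s : ℝ) • a) - f a)
    (f' := fun s => -a * deriv f ((1 - s : ℝ) • a)) (a := 0) (b := ℓ)
    (fun s hs => (hder s hs).continuousAt.continuousWithinAt)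
    (fun s hs => (hder s ⟨hs.1, hs.2.le⟩).hasDerivWithinAt)
    (B := fun s => K / α * ((s + c) ^ α - c ^ α)) (B' := fun s => K * (s + c) ^ (α - 1))
    (by simp)
    (by
      refine ContinuousOn.mul continuousOn_const (ContinuousOn.sub ?_ continuousOn_const)
      exact ContinuousOn.rpow_const (by fun_prop) fun _ _ => Or.inr hα.le)
    (fun s hs => by
      have e1 : HasDerivAt (fun s : ℝ => s + c) 1 s := (hasDerivAt_id s).add_const c
      have e2 := ((e1.rpow_const (p := α) (Or.inl (by linarith [hs.1]))).sub_const
        (c ^ α)).const_mul (K / α)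
      refine (e2.congr_deriv ?_).hasDerivWithinAt
      field_simp)
    (fun s hs => by
      obtain ⟨m1, m2⟩ := hmem s ⟨hs.1, hs.2.le⟩
      rw [norm_mul, norm_neg]
      have e1 := hd _ m1
      have e2 : (1 - ‖(1 - s : ℝ) • a‖) ^ (α - 1) ≤ (s + c) ^ (α - 1) :=
        Real.rpow_le_rpow_of_nonpos (by linarith [hs.1]) m2 (by linarith)
      calc ‖a‖ * ‖deriv f ((1 - s : ℝ) • a)‖ ≤ 1 * (K * (s + c) ^ (α - 1)) := by
            gcongr; exact e1.trans (by gcongr)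
        _ = _ := one_mul _)
    (show ℓ ∈ Icc 0 ℓ from ⟨h0, le_rfl⟩)
  refine key.trans ?_
  have := Real.rpow_add_le_add_rpow h0 hc0.le hα.le hα1.le
  gcongr
  linarith

/-- The theorem of Hardy and Littlewood. -/
lemma norm_sub_le_of_norm_deriv_le {f : ℂ → ℂ} {α K : ℝ} (hα : 0 < α) (hα1 : α < 1)
    (hK : 0 ≤ K) (hf : DifferentiableOn ℂ f (Metric.ball 0 1))
    (hd : ∀ τ ∈ Metric.ball (0 : ℂ) 1, ‖deriv f τ‖ ≤ K * (1 - ‖τ‖) ^ (α - 1)) {a b : ℂ}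
    (ha : a ∈ Metric.ball (0 : ℂ) 1) (hb : b ∈ Metric.ball (0 : ℂ) 1) :
    ‖f a - f b‖ ≤ (2 / α + 4) * K * ‖a - b‖ ^ α := by
  rcases eq_or_ne a b with rfl | hab
  · simp [Real.zero_rpow hα.ne']
  have hab0 : 0 < ‖a - b‖ := norm_pos_iff.2 (sub_ne_zero.2 hab)
  -- Both points are pulled in by the factor `1 - ℓ` and compared in the disc of radius `1 - ℓ`,
  -- where the derivative is at most `K ℓ^{α-1}`. Dividing by `4` ensures `ℓ < 1`, since `|a - b| <
  -- 2`.
  set ℓ := ‖a - b‖ / 4 with hℓ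
  have ha' := mem_ball_zero_iff.1 ha
  have hb' := mem_ball_zero_iff.1 hb
  have h0 : 0 < ℓ := by positivity
  have h1 : ℓ < 1 := by have := norm_sub_le a b; linarith
  have r1 := norm_sub_le_of_norm_deriv_le_radial hα hα1 hK hf hd ha h0.le h1
  have r2 := norm_sub_le_of_norm_deriv_le_radial hα hα1 hK hf hd hb h0.le h1
  have hmem : ∀ x ∈ Metric.ball (0 : ℂ) 1, (1 - ℓ : ℝ) • x ∈ Metric.closedBall (0 : ℂ) (1 - ℓ) := by
    intro x hx
    rw [mem_ball_zero_iff] at hx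
    rw [mem_closedBall_zero_iff, norm_smul, Real.norm_eq_abs, abs_of_nonneg (by linarith)]
    nlinarith
  have hsub : Metric.closedBall (0 : ℂ) (1 - ℓ) ⊆ Metric.ball 0 1 :=
    Metric.closedBall_subset_ball (by linarith)
  have r3 : ‖f ((1 - ℓ : ℝ) • a) - f ((1 - ℓ : ℝ) • b)‖ ≤
      K * ℓ ^ (α - 1) * ‖(1 - ℓ : ℝ) • a - (1 - ℓ : ℝ) • b‖ := by
    refine (convex_closedBall (0 : ℂ) (1 - ℓ)).norm_image_sub_le_of_norm_deriv_le
      (fun x hx => hf.differentiableAt (Metric.isOpen_ball.mem_nhds (hsub hx)))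
      (fun x hx => (hd x (hsub hx)).trans ?_) (hmem b hb) (hmem a ha)
    rw [mem_closedBall_zero_iff] at hx
    have := Real.rpow_le_rpow_of_nonpos h0 (show ℓ ≤ 1 - ‖x‖ by linarith)
      (show α - 1 ≤ 0 by linarith)
    gcongr
  have r4 : ‖(1 - ℓ : ℝ) • a - (1 - ℓ : ℝ) • b‖ ≤ 4 * ℓ := by
    rw [← smul_sub, norm_smul, Real.norm_eq_abs, abs_of_nonneg (by linarith)]
    nlinarith
  have r5 : ℓ ^ (α - 1) * ℓ = ℓ ^ α := by
    rw [← Real.rpow_add_one h0.ne']; ring_nf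
  have r6 : ℓ ^ α ≤ ‖a - b‖ ^ α := by gcongr; linarith
  have e : f a - f b = -(f ((1 - ℓ : ℝ) • a) - f a) +
      (f ((1 - ℓ : ℝ) • a) - f ((1 - ℓ : ℝ) • b)) + (f ((1 - ℓ : ℝ) • b) - f b) := by ring
  calc ‖f a - f b‖ ≤ K / α * ℓ ^ α + K * ℓ ^ (α - 1) * (4 * ℓ) + K / α * ℓ ^ α := by
        rw [e]
        refine norm_add_le_of_le (norm_add_le_of_le (by rwa [norm_neg]) (r3.trans ?_)) r2
        gcongr
    _ = (2 / α + 4) * K * ℓ ^ α := by rw [← r5]; ring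
    _ ≤ _ := by gcongr

/-- The Hölder bound makes `f` uniformly continuous, so it extends to the closure, and the bound
persists there by continuity. -/
lemma exists_diffContOnCl_of_holder {f : ℂ → ℂ} {α L : ℝ} (hα : 0 < α)
    (hf : DifferentiableOn ℂ f (Metric.ball 0 1))
    (h : ∀ a ∈ Metric.ball (0 : ℂ) 1, ∀ b ∈ Metric.ball (0 : ℂ) 1,
      ‖f a - f b‖ ≤ L * ‖a - b‖ ^ α) :
    ∃ g : ℂ → ℂ, DiffContOnCl ℂ g (Metric.ball 0 1) ∧ EqOn g f (Metric.ball 0 1) ∧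
      ∀ a ∈ Metric.closedBall (0 : ℂ) 1, ∀ b ∈ Metric.closedBall (0 : ℂ) 1,
        ‖g a - g b‖ ≤ L * ‖a - b‖ ^ α := by
  have hcl : closure (Metric.ball (0 : ℂ) 1) = Metric.closedBall 0 1 :=
    closure_ball 0 one_ne_zero
  have hlim : ∀ x ∈ Metric.closedBall (0 : ℂ) 1, ∃ y,
      Tendsto f (𝓝[Metric.ball 0 1] x) (𝓝 y) := by
    intro x hx
    rw [← hcl] at hx
    have := mem_closure_iff_nhdsWithin_neBot.1 hx
    have h2 : Tendsto (fun p : ℂ × ℂ => L * ‖p.1 - p.2‖ ^ α)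
        (𝓝[Metric.ball 0 1] x ×ˢ 𝓝[Metric.ball 0 1] x) (𝓝 0) := by
      have h3 : ContinuousAt (fun p : ℂ × ℂ => L * ‖p.1 - p.2‖ ^ α) (x, x) :=
        continuousAt_const.mul (ContinuousAt.rpow_const (by fun_prop) (Or.inr hα.le))
      have h4 := h3.tendsto
      simp only [sub_self, norm_zero, Real.zero_rpow hα.ne', mul_zero, nhds_prod_eq] at h4
      exact h4.mono_left (Filter.prod_mono nhdsWithin_le_nhds nhdsWithin_le_nhds)
    have hcau : Cauchy (map f (𝓝[Metric.ball 0 1] x)) := by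
      rw [cauchy_map_iff]
      refine ⟨this, ?_⟩
      rw [Metric.uniformity_eq_comap_nhds_zero, tendsto_comap_iff]
      refine squeeze_zero' (.of_forall fun _ => dist_nonneg) ?_ h2
      filter_upwards [prod_mem_prod self_mem_nhdsWithin self_mem_nhdsWithin] with p hp
      simpa [dist_eq_norm] using h p.1 hp.1 p.2 hp.2
    exact CompleteSpace.complete hcau
  have heq : EqOn (extendFrom (Metric.ball 0 1) f) f (Metric.ball 0 1) := fun x hx =>
    extendFrom_eq (subset_closure hx)
      ((hf.continuousOn x hx).tendsto)
  have hcont : ContinuousOn (extendFrom (Metric.ball 0 1) f) (Metric.closedBall 0 1) :=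
    continuousOn_extendFrom hcl.symm.subset hlim
  refine ⟨extendFrom (Metric.ball 0 1) f, ⟨hf.congr heq, by rwa [hcl]⟩, heq, ?_⟩
  have hS : ∀ p ∈ Metric.closedBall (0 : ℂ) 1 ×ˢ Metric.closedBall (0 : ℂ) 1,
      ‖extendFrom (Metric.ball 0 1) f p.1 - extendFrom (Metric.ball 0 1) f p.2‖ ≤
        L * ‖p.1 - p.2‖ ^ α := by
    rw [← hcl, ← closure_prod_eq] at *
    intro p hp
    refine le_on_closure (s := Metric.ball (0 : ℂ) 1 ×ˢ Metric.ball (0 : ℂ) 1)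
      (f := fun p : ℂ × ℂ => ‖extendFrom (Metric.ball 0 1) f p.1 -
        extendFrom (Metric.ball 0 1) f p.2‖) (g := fun p => L * ‖p.1 - p.2‖ ^ α)
      (fun p hp => ?_) ?_ ?_ hp
    · rw [heq hp.1, heq hp.2]; exact h _ hp.1 _ hp.2
    · rw [closure_prod_eq]
      exact ((hcont.comp continuousOn_fst fun p hp => hp.1).sub
        (hcont.comp continuousOn_snd fun p hp => hp.2)).norm
    · exact (Continuous.mul continuous_const
        (Continuous.rpow_const (by fun_prop) fun _ => Or.inr hα.le)).continuousOn
  exact fun a ha b hb => hS (a, b) ⟨ha, hb⟩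

/-- The Hölder constant of the Cauchy transform. -/
noncomputable def privalovConst (α : ℝ) : ℝ := (2 / α + 4) * (4 * Real.pi / (1 - α))

lemma privalovConst_nonneg {α : ℝ} (hα : 0 < α) (hα1 : α < 1) : 0 ≤ privalovConst α := by
  have : 0 < 1 - α := by linarith
  have := Real.pi_pos
  unfold privalovConst
  positivity

/-- Privalov's theorem: the growth bound for the derivative is exactly the hypothesis of
Hardy–Littlewood. -/
lemma HolderCircle.exists_cauchy_extension {α D : ℝ} {v : ℝ → ℂ} (h : HolderCircle α v D)
    (hp : Function.Periodic v (2 * Real.pi)) (hD : 0 ≤ D) (hα : 0 < α) (hα1 : α < 1) :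
    ∃ f : ℂ → ℂ, DiffContOnCl ℂ f (Metric.ball 0 1) ∧
      EqOn f (cauchyTransform v) (Metric.ball 0 1) ∧
      ∀ a ∈ Metric.closedBall (0 : ℂ) 1, ∀ b ∈ Metric.closedBall (0 : ℂ) 1,
        ‖f a - f b‖ ≤ privalovConst α * D * ‖a - b‖ ^ α := by
  have hd : ∀ τ ∈ Metric.ball (0 : ℂ) 1, HasDerivAt (cauchyTransform v)
      (cauchyTransformDeriv v τ) τ := fun τ hτ =>
    hasDerivAt_cauchyTransform (h.continuous hα) hτ
  have hdo : DifferentiableOn ℂ (cauchyTransform v) (Metric.ball 0 1) := fun τ hτ =>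
    (hd τ hτ).differentiableAt.differentiableWithinAt
  have h1 : 0 < 1 - α := by linarith
  have hpi := Real.pi_pos
  refine exists_diffContOnCl_of_holder hα hdo fun a ha b hb => ?_
  refine (norm_sub_le_of_norm_deriv_le hα hα1 (K := 4 * Real.pi / (1 - α) * D) (by positivity)
    hdo (fun τ hτ => ?_) ha hb).trans (le_of_eq (by unfold privalovConst; ring))
  rw [(hd τ hτ).deriv]
  exact h.norm_cauchyTransformDeriv_le hp hD hα hα1 hτ

lemma cauchyTransform_zero (v : ℝ → ℂ) :
    cauchyTransform v 0 = (2 * Real.pi : ℂ)⁻¹ * ∫ θ in (-Real.pi)..Real.pi, v θ := by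
  simp [cauchyTransform, div_self (expI_ne_zero _)]

lemma norm_two_pi_inv : ‖(2 * Real.pi : ℂ)⁻¹‖ = (2 * Real.pi)⁻¹ := by
  rw [norm_inv, norm_mul]; simp [abs_of_pos Real.pi_pos]

lemma norm_mean_le {v : ℝ → ℂ} {C : ℝ} (h : ∀ θ ∈ Icc (-Real.pi) Real.pi, ‖v θ‖ ≤ C) :
    ‖(2 * Real.pi : ℂ)⁻¹ * ∫ θ in (-Real.pi)..Real.pi, v θ‖ ≤ C := by
  have hpi := Real.pi_pos
  have h1 : ‖∫ θ in (-Real.pi)..Real.pi, v θ‖ ≤ C * |Real.pi - -Real.pi| :=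
    intervalIntegral.norm_integral_le_of_norm_le_const fun θ hθ => by
      rw [uIoc_of_le (by linarith)] at hθ
      exact h θ ⟨hθ.1.le, hθ.2⟩
  rw [norm_mul, norm_two_pi_inv, inv_mul_le_iff₀ (by positivity)]
  rw [abs_of_pos (by linarith)] at h1
  linarith

lemma tendsto_radial {f : ℂ → ℂ} (hf : ContinuousOn f (Metric.closedBall 0 1)) (φ : ℝ) :
    Tendsto (fun r : ℝ => f (r * expI φ)) (𝓝[<] 1) (𝓝 (f (expI φ))) := by
  have h1 : Tendsto (fun r : ℝ => (r : ℂ) * expI φ) (𝓝[<] 1)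
      (𝓝[Metric.closedBall 0 1] (expI φ)) := by
    refine tendsto_nhdsWithin_iff.2 ⟨?_, ?_⟩
    · have : Continuous fun r : ℝ => (r : ℂ) * expI φ := by fun_prop
      have h2 := this.tendsto 1
      simp only [Complex.ofReal_one, one_mul] at h2
      exact h2.mono_left nhdsWithin_le_nhds
    · filter_upwards [Ioo_mem_nhdsLT (zero_lt_one' ℝ)] with r hr
      simp [norm_expI, abs_of_pos hr.1, hr.2.le]
  exact ((hf _ (expI_mem_closedBall φ)).tendsto).comp h1

/-- The boundary values of the Poisson integral. -/
lemma HolderCircle.two_re_cauchy_extension {α D : ℝ} {v : ℝ → ℝ} (h : HolderCircle α v D)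
    (hp : Function.Periodic v (2 * Real.pi)) (hD : 0 ≤ D) (hα : 0 < α) (hα1 : α < 1)
    {f : ℂ → ℂ} (hf : DiffContOnCl ℂ f (Metric.ball 0 1))
    (hfv : EqOn f (cauchyTransform fun θ => (v θ : ℂ)) (Metric.ball 0 1)) (φ : ℝ) :
    2 * (f (expI φ)).re - (f 0).re = v φ := by
  have hpi := Real.pi_pos
  have hcont : ContinuousOn f (Metric.closedBall 0 1) := hf.continuousOn_ball
  have hv := h.continuous hα
  have hlim : Tendsto (fun r : ℝ => 2 * (f (r * expI φ)).re - (f 0).re - v φ) (𝓝[<] 1)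
      (𝓝 (2 * (f (expI φ)).re - (f 0).re - v φ)) :=
    ((((Complex.continuous_re.tendsto _).comp (tendsto_radial hcont φ)).const_mul 2).sub_const
      _).sub_const _
  -- The real part of `2ζ/(ζ - τ) - 1` is the Poisson kernel `(1 - r²)/|ζ - τ|²`. After subtracting
  -- `v φ`, the factor `1 - r²` beats the singular integral `O((1 - r)^{α-1})`, leaving `O((1 -
  -- r)^α)`.
  have hzero : Tendsto (fun r : ℝ => 2 * (f (r * expI φ)).re - (f 0).re - v φ) (𝓝[<] 1)
      (𝓝 0) := by
    have hb : Tendsto (fun r : ℝ => 8 * Real.pi / (1 - α) * D * (1 - r) ^ α) (𝓝[<] 1) (𝓝 0) := by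
      have : ContinuousAt (fun r : ℝ => 8 * Real.pi / (1 - α) * D * (1 - r) ^ α) 1 :=
        continuousAt_const.mul (ContinuousAt.rpow_const (by fun_prop) (Or.inr hα.le))
      have h2 := this.tendsto
      simp only [sub_self, Real.zero_rpow hα.ne', mul_zero] at h2
      exact h2.mono_left nhdsWithin_le_nhds
    refine squeeze_zero_norm' ?_ hb
    filter_upwards [Ioo_mem_nhdsLT (zero_lt_one' ℝ)] with r hr
    set τ : ℂ := r * expI φ with hτ
    have hnτ : ‖τ‖ = r := by simp [hτ, norm_expI, abs_of_pos hr.1]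
    have hτb : τ ∈ Metric.ball (0 : ℂ) 1 := by rw [mem_ball_zero_iff, hnτ]; exact hr.2
    have hk := continuous_kernel hτb
    have hk2 := hk.const_mul 2
    have e1 : 2 * f τ - f 0 - v φ = (2 * Real.pi : ℂ)⁻¹ * ∫ θ in (φ - Real.pi)..(φ + Real.pi),
        ((v θ : ℂ) - v φ) * (2 * (expI θ / (expI θ - τ)) - 1) := by
      have hper : Function.Periodic (fun θ => ((v θ : ℂ) - v φ) *
          (2 * (expI θ / (expI θ - τ)) - 1)) (2 * Real.pi) := fun θ => by
        simp only [periodic_expI θ, hp θ]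
      have e2 : ∀ θ, ((v θ : ℂ) - v φ) * (2 * (expI θ / (expI θ - τ)) - 1) =
          2 * (v θ * (expI θ / (expI θ - τ))) - v θ - (2 * v φ * (expI θ / (expI θ - τ)) - v φ) :=
        fun θ => by ring
      rw [← integral_periodic_shift hper]
      simp only [e2]
      have i1 : IntervalIntegrable (fun θ => 2 * ((v θ : ℂ) * (expI θ / (expI θ - τ)))) volume
        (-Real.pi) Real.pi := Continuous.intervalIntegrable (by fun_prop) _ _
      have i2 : IntervalIntegrable (fun θ => (v θ : ℂ)) volume (-Real.pi) Real.pi :=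
        Continuous.intervalIntegrable (by fun_prop) _ _
      have i3 : IntervalIntegrable (fun θ => 2 * (v φ : ℂ) * (expI θ / (expI θ - τ))) volume
        (-Real.pi) Real.pi := Continuous.intervalIntegrable (by fun_prop) _ _
      rw [intervalIntegral.integral_sub (i1.sub i2) (i3.sub intervalIntegrable_const),
        intervalIntegral.integral_sub i1 i2,
        intervalIntegral.integral_sub i3 intervalIntegrable_const,
        intervalIntegral.integral_const_mul, intervalIntegral.integral_const_mul,
        cauchyTransform_one hτb, hfv hτb, hfv (Metric.mem_ball_self one_pos),
        cauchyTransform_zero, cauchyTransform, intervalIntegral.integral_const]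
      have hpi' : (Real.pi : ℂ) ≠ 0 := by exact_mod_cast hpi.ne'
      simp only [sub_neg_eq_add, Complex.real_smul]
      push_cast
      field_simp
      ring
    have e3 : 2 * (f τ).re - (f 0).re - v φ = (2 * Real.pi)⁻¹ *
        ∫ θ in (φ - Real.pi)..(φ + Real.pi),
          (v θ - v φ) * ((1 - r ^ 2) / ‖expI θ - τ‖ ^ 2) := by
      have e4 := congrArg Complex.re e1
      have e5 : (2 * Real.pi : ℂ)⁻¹ = ((2 * Real.pi)⁻¹ : ℝ) := by push_cast; rfl
      rw [e5, Complex.re_ofReal_mul] at e4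
      have e6 : (∫ θ in (φ - Real.pi)..(φ + Real.pi),
          ((v θ : ℂ) - v φ) * (2 * (expI θ / (expI θ - τ)) - 1)).re =
          ∫ θ in (φ - Real.pi)..(φ + Real.pi),
            (((v θ : ℂ) - v φ) * (2 * (expI θ / (expI θ - τ)) - 1)).re := by
        have := Complex.reCLM.intervalIntegral_comp_comm
          (μ := volume) (a := φ - Real.pi) (b := φ + Real.pi)
          (f := fun θ => ((v θ : ℂ) - v φ) * (2 * (expI θ / (expI θ - τ)) - 1))
          (Continuous.intervalIntegrable (by fun_prop) _ _)
        exact this.symm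
      rw [e6] at e4
      simp only [Complex.sub_re, Complex.mul_re, Complex.re_ofNat, Complex.im_ofNat, zero_mul,
        sub_zero, Complex.ofReal_re] at e4
      rw [e4]
      congr 1
      refine intervalIntegral.integral_congr fun θ _ => ?_
      have hne := expI_sub_ne_zero hτb θ
      have e7 : (2 * (expI θ / (expI θ - τ)) - 1 : ℂ).re = (1 - r ^ 2) / ‖expI θ - τ‖ ^ 2 := by
        have e8 : 2 * (expI θ / (expI θ - τ)) - 1 = (expI θ + τ) / (expI θ - τ) := by
          field_simp; ring
        have n1 : (expI θ).re * (expI θ).re + (expI θ).im * (expI θ).im = 1 := by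
          rw [← Complex.normSq_apply, Complex.normSq_eq_norm_sq, norm_expI, one_pow]
        have n2 : τ.re * τ.re + τ.im * τ.im = r ^ 2 := by
          rw [← Complex.normSq_apply, Complex.normSq_eq_norm_sq, hnτ]
        rw [e8, Complex.div_re, ← Complex.normSq_eq_norm_sq, ← add_div]
        congr 1
        simp only [Complex.add_re, Complex.sub_re, Complex.add_im, Complex.sub_im]
        linear_combination n1 - n2
      simp only [← e7]
      simp
    have e9 : ‖2 * (f τ).re - (f 0).re - v φ‖ ≤ (2 * Real.pi)⁻¹ * ((1 - r ^ 2) *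
        (8 * Real.pi ^ 2 / (1 - α) * D * (1 - r) ^ (α - 1))) := by
      rw [e3, norm_mul, Real.norm_eq_abs, abs_of_pos (by positivity)]
      gcongr
      refine (intervalIntegral.norm_integral_le_integral_norm (by linarith)).trans ?_
      have hr2 : 0 ≤ 1 - r ^ 2 := by nlinarith [hr.1, hr.2]
      refine le_trans (le_of_eq ?_) (mul_le_mul_of_nonneg_left
        (h.integral_norm_sub_div_le (φ := φ) hD hα hα1 hr.1.le hr.2) hr2)
      rw [← intervalIntegral.integral_const_mul]
      refine intervalIntegral.integral_congr fun θ _ => ?_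
      simp only [norm_mul, norm_div, norm_pow, norm_norm, Real.norm_eq_abs (1 - r ^ 2),
        abs_of_nonneg hr2]
      ring
    refine e9.trans ?_
    have h1r : 0 < 1 - r := by linarith [hr.2]
    have hα' : 0 < 1 - α := by linarith
    have e10 : (1 - r) ^ α = (1 - r) ^ (α - 1) * (1 - r) := by
      rw [← Real.rpow_add_one h1r.ne']; ring_nf
    calc _ ≤ (2 * Real.pi)⁻¹ * ((2 * (1 - r)) *
          (8 * Real.pi ^ 2 / (1 - α) * D * (1 - r) ^ (α - 1))) := by
          gcongr
          nlinarith [hr.1, hr.2]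
      _ = _ := by
          rw [e10]
          field_simp
  have := tendsto_nhds_unique hlim hzero
  linarith

end BoundaryValues

/-! ### Differentiability on the circle off the point `1`, and the weights there -/

section BoundaryRegularity
open Set Filter Topology MeasureTheory

/-- The tangential field `(e^{iθ} - 1) ∂_θ` intertwines with the Cauchy transform. -/
lemma cauchyTransform_field {v w : ℝ → ℂ} (hv : Continuous v) (hw : Continuous w)
    (hp : Function.Periodic v (2 * Real.pi))
    (hd : ∀ θ : ℝ, Complex.exp (θ * Complex.I) ≠ 1 → HasDerivAt v (deriv v θ) θ)
    (hwv : ∀ θ, w θ = (expI θ - 1) * deriv v θ) {τ : ℂ} (hτ : τ ∈ Metric.ball (0 : ℂ) 1) :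
    cauchyTransform w τ = cauchyTransform w 0 +
      (τ - 1) * (Complex.I * τ) * cauchyTransformDeriv v τ := by
  have hk := continuous_kernel hτ
  have hk2 := continuous_kernel_sq hτ
  have key : ∀ σ ∈ Metric.ball (0 : ℂ) 1, cauchyTransform w σ =
      -((2 * Real.pi : ℂ)⁻¹ * ∫ θ in (-Real.pi)..Real.pi, v θ * (Complex.I * expI θ)) +
      (σ - 1) * (Complex.I * σ) * cauchyTransformDeriv v σ := by
    intro σ hσ
    have hk := continuous_kernel hσ
    have hk2 := continuous_kernel_sq hσ
    -- Integration by parts: since `(ζ - 1)ζ/(ζ - σ) = ζ + (σ - 1)ζ/(ζ - σ)`, the function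
    -- differentiated here is `v` times `(ζ - 1)` times the Cauchy kernel. The boundary terms cancel
    -- by periodicity, and `θ = 0` is an exceptional point where only continuity is used.
    have hder : ∀ θ ∈ Ioo (-Real.pi) Real.pi \ {0}, HasDerivAt
        (fun θ => v θ * (expI θ + (σ - 1) * (expI θ / (expI θ - σ))))
        (w θ * (expI θ / (expI θ - σ)) + (v θ * (Complex.I * expI θ) -
          (σ - 1) * (Complex.I * σ) * (v θ * (expI θ / (expI θ - σ) ^ 2)))) θ := by
      intro θ hθ
      have h1 := hd θ (exp_ne_one_of_mem ⟨hθ.1.1.le, hθ.1.2.le⟩ hθ.2)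
      have h2 := h1.mul ((hasDerivAt_expI θ).add ((hasDerivAt_kernel hσ θ).const_mul (σ - 1)))
      refine h2.congr_deriv ?_
      have := expI_sub_ne_zero hσ θ
      simp only [hwv, Pi.add_apply]
      field_simp
      ring
    have i1 : IntervalIntegrable (fun θ => w θ * (expI θ / (expI θ - σ))) volume
        (-Real.pi) Real.pi := Continuous.intervalIntegrable (by fun_prop) _ _
    have i2 : IntervalIntegrable (fun θ => v θ * (Complex.I * expI θ)) volume
        (-Real.pi) Real.pi := Continuous.intervalIntegrable (by fun_prop) _ _
    have i3 : IntervalIntegrable (fun θ => (σ - 1) * (Complex.I * σ) *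
        (v θ * (expI θ / (expI θ - σ) ^ 2))) volume (-Real.pi) Real.pi :=
      Continuous.intervalIntegrable (by fun_prop) _ _
    have hint := integral_eq_of_hasDerivAt_off_countable_of_le _ _
      (by linarith [Real.pi_pos] : -Real.pi ≤ Real.pi) (countable_singleton (0 : ℝ))
      (Continuous.continuousOn (by fun_prop)) hder (i1.add (i2.sub i3))
    rw [intervalIntegral.integral_add i1 (i2.sub i3), intervalIntegral.integral_sub i2 i3,
      intervalIntegral.integral_const_mul, expI_pi, expI_neg_pi,
      show v Real.pi = v (-Real.pi) by rw [← hp (-Real.pi)]; congr 1; ring, sub_self] at hint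
    rw [cauchyTransform, cauchyTransformDeriv]
    linear_combination (2 * Real.pi : ℂ)⁻¹ * hint
  rw [key τ hτ, key 0 (Metric.mem_ball_self one_pos)]
  ring

/-- Inside the disc `f' = (g - c)/((τ - 1)iτ)`, which has a limit at every circle point other than
`1`. Hence `f` is real differentiable within the closed disc at such a point, and the derivative is
taken along the circle. -/
lemma hasDerivAt_boundary {f g : ℂ → ℂ} {c : ℂ} (hf : DiffContOnCl ℂ f (Metric.ball 0 1))
    (hg : ContinuousOn g (Metric.closedBall 0 1))
    (hfg : ∀ τ ∈ Metric.ball (0 : ℂ) 1, g τ = c + (τ - 1) * (Complex.I * τ) * deriv f τ)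
    {θ : ℝ} (hθ : Complex.exp (θ * Complex.I) ≠ 1) :
    HasDerivAt (fun θ => f (expI θ)) ((g (expI θ) - c) / (expI θ - 1)) θ := by
  have hζ1 : expI θ - 1 ≠ 0 := sub_ne_zero.2 hθ
  have hζ0 := expI_ne_zero θ
  have hcl : closure (Metric.ball (0 : ℂ) 1) = Metric.closedBall 0 1 := closure_ball 0 one_ne_zero
  have hsub : Metric.ball (0 : ℂ) 1 ⊆ Metric.closedBall 0 1 := Metric.ball_subset_closedBall
  set q : ℂ → ℂ := fun τ => (g τ - c) / ((τ - 1) * (Complex.I * τ)) with hq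
  have hne : (expI θ - 1) * (Complex.I * expI θ) ≠ 0 :=
    mul_ne_zero hζ1 (mul_ne_zero Complex.I_ne_zero hζ0)
  have hqc : Tendsto q (𝓝[Metric.ball 0 1] expI θ) (𝓝 (q (expI θ))) := by
    refine Tendsto.div ?_ ?_ hne
    · exact (((hg _ (expI_mem_closedBall θ)).mono hsub).tendsto).sub_const c
    · exact ((by fun_prop : Continuous fun τ : ℂ => (τ - 1) * (Complex.I * τ)).tendsto _).mono_left
        nhdsWithin_le_nhds
  have hderiv : ∀ᶠ τ in 𝓝[Metric.ball 0 1] expI θ, fderiv ℝ f τ =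
      ((ContinuousLinearMap.mul ℝ ℂ).flip (1 : ℂ)).comp (ContinuousLinearMap.mul ℝ ℂ (q τ)) := by
    have hopen : ∀ᶠ τ in 𝓝 (expI θ), (τ - 1) * (Complex.I * τ) ≠ 0 :=
      ((by fun_prop : Continuous fun τ : ℂ => (τ - 1) * (Complex.I * τ)).continuousAt).eventually_ne
        hne
    filter_upwards [self_mem_nhdsWithin, nhdsWithin_le_nhds hopen] with τ hτ hτ2
    have h1 := (hf.differentiableAt Metric.isOpen_ball hτ).hasDerivAt
    have h2 : deriv f τ = q τ := by
      rw [hq, eq_div_iff hτ2, hfg τ hτ]; ring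
    rw [h2] at h1
    rw [h1.hasFDerivAt.restrictScalars ℝ |>.fderiv]
    ext; simp [mul_comm]
  have hF := hasFDerivWithinAt_closure_of_tendsto_fderiv (x := expI θ)
    (f' := ((ContinuousLinearMap.mul ℝ ℂ).flip (1 : ℂ)).comp
      (ContinuousLinearMap.mul ℝ ℂ (q (expI θ))))
    (hf.differentiableOn.restrictScalars ℝ) (convex_ball 0 1) Metric.isOpen_ball
    (fun y hy => (hf.continuousOn y hy).mono subset_closure)
    (Tendsto.congr' (EventuallyEq.symm hderiv) (by
      have hc : Continuous fun z : ℂ => ((ContinuousLinearMap.mul ℝ ℂ).flip (1 : ℂ)).comp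
        (ContinuousLinearMap.mul ℝ ℂ z) := by fun_prop
      exact (hc.tendsto _).comp hqc))
  rw [hcl] at hF
  have := hF.comp_hasDerivWithinAt (s := univ) θ (hasDerivAt_expI θ).hasDerivWithinAt
    (fun φ _ => expI_mem_closedBall φ)
  rw [hasDerivWithinAt_univ] at this
  refine this.congr_deriv ?_
  simp only [hq, ContinuousLinearMap.comp_apply, ContinuousLinearMap.mul_apply',
    ContinuousLinearMap.flip_apply, mul_one]
  have := Complex.I_ne_zero
  field_simp

/-- Along the radius to `1` the term `(τ - 1) f'(τ)` is `O((1 - r)^α)` and disappears in the limit.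
-/
lemma eq_const_at_one {f g : ℂ → ℂ} {c : ℂ} {α K : ℝ} (hα : 0 < α)
    (hg : ContinuousOn g (Metric.closedBall 0 1))
    (hfg : ∀ τ ∈ Metric.ball (0 : ℂ) 1, g τ = c + (τ - 1) * (Complex.I * τ) * deriv f τ)
    (hK : ∀ τ ∈ Metric.ball (0 : ℂ) 1, ‖deriv f τ‖ ≤ K * (1 - ‖τ‖) ^ (α - 1)) :
    g 1 = c := by
  have h1 := (tendsto_radial hg 0).sub_const c
  have h2 : Tendsto (fun r : ℝ => g (r * expI 0) - c) (𝓝[<] 1) (𝓝 0) := by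
    have hb : Tendsto (fun r : ℝ => K * (1 - r) ^ α) (𝓝[<] 1) (𝓝 0) := by
      have : ContinuousAt (fun r : ℝ => K * (1 - r) ^ α) 1 :=
        continuousAt_const.mul (ContinuousAt.rpow_const (by fun_prop) (Or.inr hα.le))
      have h2 := this.tendsto
      simp only [sub_self, Real.zero_rpow hα.ne', mul_zero] at h2
      exact h2.mono_left nhdsWithin_le_nhds
    refine squeeze_zero_norm' ?_ hb
    filter_upwards [Ioo_mem_nhdsLT (zero_lt_one' ℝ)] with r hr
    have hn : ‖(r : ℂ)‖ = r := by simp [abs_of_pos hr.1]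
    have hb : (r : ℂ) ∈ Metric.ball (0 : ℂ) 1 := by rw [mem_ball_zero_iff, hn]; exact hr.2
    have hr1 : 0 < 1 - r := by linarith [hr.2]
    have h3 := hK r hb
    have h4 : ‖(r : ℂ) - 1‖ = 1 - r := by
      rw [← Complex.ofReal_one, ← Complex.ofReal_sub, Complex.norm_real, Real.norm_eq_abs,
        abs_of_neg (by linarith)]
      ring
    have e10 : (1 - r) ^ α = (1 - r) ^ (α - 1) * (1 - r) := by
      rw [← Real.rpow_add_one hr1.ne']; ring_nf
    rw [hn] at h3
    rw [expI_zero, mul_one, hfg _ hb, add_sub_cancel_left, norm_mul, norm_mul, norm_mul,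
      Complex.norm_I, one_mul, hn, h4, e10]
    calc (1 - r) * r * ‖deriv f r‖ ≤ (1 - r) * 1 * (K * (1 - r) ^ (α - 1)) := by
          gcongr; exact hr.2.le
      _ = _ := by ring
  have := tendsto_nhds_unique h1 h2
  rwa [expI_zero, sub_eq_zero] at this

lemma HB.mul {α C D : ℝ} {f g : ℝ → ℂ} (hf : HB α f C) (hg : HB α g D) :
    HB α (fun θ => f θ * g θ) (2 * C * D) := by
  have hC := hf.nonneg
  have hD := hg.nonneg
  refine (hf.bilin hg (ContinuousLinearMap.mul ℝ ℂ)).mono ?_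
  have := ContinuousLinearMap.opNorm_mul_le ℝ ℂ
  gcongr
  linarith

lemma abs_sub_le_const_mul_rpow {α : ℝ} (hα : 0 < α) (hα1 : α < 1) {θ φ : ℝ}
    (hθ : θ ∈ Icc (-Real.pi) Real.pi) (hφ : φ ∈ Icc (-Real.pi) Real.pi) :
    |θ - φ| ≤ 2 * Real.pi * |θ - φ| ^ α := by
  have hpi := Real.pi_gt_three
  rcases eq_or_lt_of_le (abs_nonneg (θ - φ)) with h | h
  · rw [← h]; simp [Real.zero_rpow hα.ne']
  have h1 : |θ - φ| ≤ 2 * Real.pi := abs_le.2 ⟨by linarith [hθ.1, hφ.2], by linarith [hθ.2, hφ.1]⟩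
  calc |θ - φ| = |θ - φ| ^ (1 - α) * |θ - φ| ^ α := by
        rw [← Real.rpow_add h]; simp
    _ ≤ (2 * Real.pi) ^ (1 - α) * |θ - φ| ^ α := by gcongr
    _ ≤ (2 * Real.pi) ^ (1 : ℝ) * |θ - φ| ^ α := by
        gcongr
        · linarith
        · linarith
    _ = _ := by rw [Real.rpow_one]

lemma ContDiff.exists_HB {E : Type*} [NormedAddCommGroup E] [NormedSpace ℝ E] {f : ℝ → E}
    (hf : ContDiff ℝ 1 f) {α : ℝ} (hα : 0 < α) (hα1 : α < 1) : ∃ C, HB α f C := by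
  obtain ⟨M, hM, h0, h1⟩ := exists_bound_lipschitz_closedBall hf Real.pi
  have hI : ∀ θ ∈ Icc (-Real.pi) Real.pi, ‖θ‖ ≤ Real.pi := fun θ hθ => abs_le.2 hθ
  have hpi := Real.pi_gt_three
  refine ⟨M * (2 * Real.pi), fun θ hθ => (h0 θ (hI θ hθ)).trans (by nlinarith),
    fun θ hθ φ hφ => (h1 θ φ (hI θ hθ) (hI φ hφ)).trans ?_⟩
  rw [mul_assoc]
  gcongr
  exact abs_sub_le_const_mul_rpow hα hα1 hθ hφ

lemma HB.inv {α C c : ℝ} {f : ℝ → ℂ} (hf : HB α f C) (hc : 0 < c)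
    (h : ∀ θ ∈ Icc (-Real.pi) Real.pi, c ≤ ‖f θ‖) :
    HB α (fun θ => (f θ)⁻¹) (c⁻¹ + C * (c⁻¹ * c⁻¹)) := by
  have hC := hf.nonneg
  have hne : ∀ θ ∈ Icc (-Real.pi) Real.pi, f θ ≠ 0 := fun θ hθ =>
    norm_pos_iff.1 (hc.trans_le (h θ hθ))
  have hle : ∀ θ ∈ Icc (-Real.pi) Real.pi, ‖(f θ)⁻¹‖ ≤ c⁻¹ := fun θ hθ => by
    rw [norm_inv]; exact inv_anti₀ hc (h θ hθ)
  have hCc : 0 ≤ C * (c⁻¹ * c⁻¹) := by positivity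
  refine ⟨fun θ hθ => (hle θ hθ).trans (by linarith), fun θ hθ φ hφ => ?_⟩
  rw [inv_sub_inv (hne θ hθ) (hne φ hφ), div_eq_mul_inv, mul_inv, norm_mul, norm_mul, norm_sub_rev]
  have hx : 0 ≤ c⁻¹ * |θ - φ| ^ α := by positivity
  calc _ ≤ C * |θ - φ| ^ α * (c⁻¹ * c⁻¹) := by
        gcongr
        exacts [hf.2 θ hθ φ hφ, hle θ hθ, hle φ hφ]
    _ ≤ _ := by linarith

/-- The quotient of the weights `e^{iθ} - 1` and `θ` is an invertible multiplier of `C^α`. -/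
lemma exists_weight_quotient {α : ℝ} (hα : 0 < α) (hα1 : α < 1) :
    ∃ (μ : ℝ → ℂ) (C : ℝ), (∀ θ, expI θ - 1 = θ * μ θ) ∧ HB α μ C ∧
      HB α (fun θ => (μ θ)⁻¹) C ∧ ∀ θ ∈ Icc (-Real.pi) Real.pi, μ θ ≠ 0 := by
  -- Hadamard's lemma makes `(e^{iθ} - 1)/θ` a `C¹` function with value `i` at `0`; Jordan's
  -- inequality bounds it below by `2/π` on `[-π, π]`, so its inverse is Hölder as well.
  obtain ⟨Λ, hΛ, h1, h2⟩ := ContDiff.exists_factor (n := 1) (Φ := expI) contDiff_expI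
  have hμ : ContDiff ℝ 1 fun θ : ℝ => Λ (θ, 0) 1 :=
    (hΛ.comp (by fun_prop : ContDiff ℝ 1 fun θ : ℝ => (θ, (0 : ℝ)))).clm_apply contDiff_const
  have hq : ∀ θ, expI θ - 1 = θ * Λ (θ, 0) 1 := by
    intro θ
    have := h1 θ 0
    rw [expI_zero, sub_zero] at this
    rw [this, ← Complex.real_smul, ← map_smul, smul_eq_mul, mul_one]
  have hlow : ∀ θ ∈ Icc (-Real.pi) Real.pi, 2 / Real.pi ≤ ‖Λ (θ, 0) 1‖ := by
    intro θ hθ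
    rcases eq_or_ne θ 0 with rfl | h0
    · rw [h2 0, fderiv_apply_one_eq_deriv, (hasDerivAt_expI 0).deriv, norm_mul, norm_expI,
        Complex.norm_I, mul_one, div_le_one Real.pi_pos]
      exact Real.two_le_pi
    · have h3 := le_norm_expI_sub_one (abs_le.2 hθ)
      rw [hq, norm_mul, Complex.norm_real, Real.norm_eq_abs, mul_comm |θ|] at h3
      exact le_of_mul_le_mul_right h3 (abs_pos.2 h0)
  have hpos : 0 < 2 / Real.pi := div_pos two_pos Real.pi_pos
  obtain ⟨C, hC⟩ := hμ.exists_HB hα hα1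
  have hinv := hC.inv hpos hlow
  exact ⟨fun θ => Λ (θ, 0) 1, _, hq, hC.mono (le_max_left _ _), hinv.mono (le_max_right _ _),
    fun θ hθ => norm_pos_iff.1 (hpos.trans_le (hlow θ hθ))⟩

lemma HB.comp_expI {α L C : ℝ} {f : ℂ → ℂ} (hL : 0 ≤ L) (hC : 0 ≤ C) (hα : 0 < α)
    (h0 : ‖f 0‖ ≤ C)
    (h : ∀ a ∈ Metric.closedBall (0 : ℂ) 1, ∀ b ∈ Metric.closedBall (0 : ℂ) 1,
      ‖f a - f b‖ ≤ L * ‖a - b‖ ^ α) : HB α (fun θ => f (expI θ)) (C + L) := by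
  refine ⟨fun θ _ => ?_, fun θ _ φ _ => ?_⟩
  · have := h _ (expI_mem_closedBall θ) 0 (by simp)
    rw [sub_zero, norm_expI, Real.one_rpow, mul_one] at this
    linarith [norm_sub_norm_le (f (expI θ)) (f 0)]
  · refine (h _ (expI_mem_closedBall θ) _ (expI_mem_closedBall φ)).trans ?_
    have := norm_expI_sub_expI_le θ φ
    have h2 : 0 ≤ C * |θ - φ| ^ α := by positivity
    have h3 : L * ‖expI θ - expI φ‖ ^ α ≤ L * |θ - φ| ^ α := by gcongr
    linarith

end BoundaryRegularity

/-! ### Boundedness of the Cauchy transform and of conjugation on the weighted class -/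

section Conjugation
open Set Filter Topology MeasureTheory

/-- With `e^{iθ} - 1 = θ μ(θ)` one has `w = μ·θv'` and `x = i e^{iθ} w + μ²·θ²v''`. Thus applying
the field once or twice stays in `C^α`, where Privalov's theorem applies. -/
lemma F2Bound.exists_field {α : ℝ} (hα : 0 < α) (hα1 : α < 1) : ∃ K, 1 ≤ K ∧
    ∀ (v : ℝ → ℂ) (C : ℝ), F2Bound α v C → ∃ w x : ℝ → ℂ,
      (∀ θ, w θ = (expI θ - 1) * deriv v θ) ∧ (∀ θ, x θ = (expI θ - 1) * deriv w θ) ∧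
      (∀ θ : ℝ, Complex.exp (θ * Complex.I) ≠ 1 → DifferentiableAt ℝ w θ) ∧
      Function.Periodic w (2 * Real.pi) ∧ Function.Periodic x (2 * Real.pi) ∧
      HB α w (K * C) ∧ HB α x (K * C) := by
  obtain ⟨μ, M, hμ, hM, -, -⟩ := exists_weight_quotient hα hα1
  obtain ⟨N, hN⟩ := (contDiff_expI (n := 1)).exists_HB hα hα1
  have hM0 := hM.nonneg
  have hN0 := hN.nonneg
  set K := 1 + 2 * M + 2 * N * (2 * M) + 2 * M * (2 * M)
  refine ⟨K, by simp only [K]; nlinarith [mul_nonneg hN0 hM0, mul_nonneg hM0 hM0],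
    fun v C hv => ?_⟩
  have hC := hv.nonneg
  set w : ℝ → ℂ := fun θ => (expI θ - 1) * deriv v θ with hw
  have hdw : ∀ θ : ℝ, Complex.exp (θ * Complex.I) ≠ 1 → HasDerivAt w
      (Complex.I * expI θ * deriv v θ + (expI θ - 1) * deriv (deriv v) θ) θ := fun θ hθ =>
    ((hasDerivAt_expI θ).sub_const 1).mul (hv.diff2 θ hθ).hasDerivAt
  have hwp : Function.Periodic w (2 * Real.pi) := fun θ => by
    simp only [hw, periodic_expI θ, hv.periodic.deriv_real θ]
  have hw1 : HB α w (2 * M * C) := (hM.mul hv.b1).congr fun θ _ => by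
    rw [hw]; simp only [hμ]; simp; ring
  refine ⟨w, fun θ => (expI θ - 1) * deriv w θ, fun _ => rfl, fun _ => rfl,
    fun θ hθ => (hdw θ hθ).differentiableAt, hwp, fun θ => by
      simp only [periodic_expI θ, hwp.deriv_real θ], hw1.mono ?_, ?_⟩
  · gcongr
    simp only [K]
    nlinarith [mul_nonneg hN0 hM0, mul_nonneg hM0 hM0]
  · have hI : HB α (fun θ => Complex.I * expI θ) N :=
      ⟨fun θ hθ => by simpa using hN.1 θ hθ, fun θ hθ φ hφ => by
        rw [← mul_sub, norm_mul, Complex.norm_I, one_mul]; exact hN.2 θ hθ φ hφ⟩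
    refine HB.mono (HB.congr ((hI.mul hw1).add (hM.mul (hM.mul hv.b2))) fun θ hθ => ?_)
      (D := K * C) ?_
    · rcases eq_or_ne θ 0 with rfl | h0
      · simp [hw, expI_zero]
      · rw [(hdw θ (exp_ne_one_of_mem hθ h0)).deriv, hw]
        simp only [hμ, Complex.real_smul]
        push_cast
        ring
    · simp only [K]
      nlinarith [mul_nonneg hN0 hM0, mul_nonneg hM0 hM0, mul_nonneg hM0 hC, mul_nonneg hN0 hC]

/-- The Cauchy transform is bounded on `F^{2,α}`. -/
lemma F2Bound.exists_cauchy_extension {α : ℝ} (hα : 0 < α) (hα1 : α < 1) : ∃ K, 0 ≤ K ∧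
    ∀ (v : ℝ → ℂ) (C : ℝ), F2Bound α v C → ∃ f : ℂ → ℂ, DiffContOnCl ℂ f (Metric.ball 0 1) ∧
      EqOn f (cauchyTransform v) (Metric.ball 0 1) ∧
      F2Bound α (fun θ => f (expI θ)) (K * C) := by
  obtain ⟨K, hK, hfield⟩ := F2Bound.exists_field hα hα1
  obtain ⟨μ, M, hμ, hM, hMi, hμ0⟩ := exists_weight_quotient hα hα1
  obtain ⟨N, hN⟩ := (contDiff_expI (n := 1)).exists_HB hα hα1
  have hM0 := hM.nonneg
  have hN0 := hN.nonneg
  set P := privalovConst α with hP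
  have hP0 : 0 ≤ P := privalovConst_nonneg hα hα1
  set Q := (2 + 2 * P) * K with hQ
  have hQ0 : 0 ≤ Q := by positivity
  set T := Q + 2 * M * Q + 2 * M * (2 * M * (Q + 2 * N * Q)) with hT
  have hT1 : 0 ≤ 2 * M * Q := by positivity
  have hT2 : 0 ≤ 2 * M * (2 * M * (Q + 2 * N * Q)) := by positivity
  refine ⟨T, by positivity, fun v C hv => ?_⟩
  have hC := hv.nonneg
  have hKC : C ≤ K * C := by nlinarith
  obtain ⟨w, x, hw, hx, hdw, hwp, hxp, bw, bx⟩ := hfield v C hv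
  have holder : ∀ u : ℝ → ℂ, HB α u (K * C) → Function.Periodic u (2 * Real.pi) →
      HolderCircle α u (2 * (K * C)) ∧ ∃ f : ℂ → ℂ, DiffContOnCl ℂ f (Metric.ball 0 1) ∧
      EqOn f (cauchyTransform u) (Metric.ball 0 1) ∧ ‖cauchyTransform u 0‖ ≤ K * C ∧
      (∀ a ∈ Metric.closedBall (0 : ℂ) 1, ∀ b ∈ Metric.closedBall (0 : ℂ) 1,
        ‖f a - f b‖ ≤ P * (2 * (K * C)) * ‖a - b‖ ^ α) := by
    intro u hu hup
    have hh := hu.holderCircle hα hup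
    obtain ⟨f, f1, f2, f3⟩ := hh.exists_cauchy_extension hup (by positivity) hα hα1
    refine ⟨hh, f, f1, f2, ?_, f3⟩
    rw [cauchyTransform_zero]
    exact norm_mean_le hu.1
  -- Stated for an abstract pair because it is used twice: for `(v, w)`, giving the first derivative
  -- of the boundary values, and for `(w, x)`, giving the second.
  have close : ∀ {u y : ℝ → ℂ} {f g : ℂ → ℂ}, HolderCircle α u (2 * (K * C)) →
      HolderCircle α y (2 * (K * C)) →
      Function.Periodic u (2 * Real.pi) → (∀ θ, y θ = (expI θ - 1) * deriv u θ) →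
      (∀ θ : ℝ, Complex.exp (θ * Complex.I) ≠ 1 → DifferentiableAt ℝ u θ) →
      DiffContOnCl ℂ f (Metric.ball 0 1) → EqOn f (cauchyTransform u) (Metric.ball 0 1) →
      DiffContOnCl ℂ g (Metric.ball 0 1) → EqOn g (cauchyTransform y) (Metric.ball 0 1) →
      (∀ θ : ℝ, Complex.exp (θ * Complex.I) ≠ 1 → HasDerivAt (fun θ => f (expI θ))
        ((g (expI θ) - cauchyTransform y 0) / (expI θ - 1)) θ) ∧ g 1 = cauchyTransform y 0 := by
    intro u y f g hu hy hup hyu hdu hf hfu hg hgy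
    have hder : ∀ τ ∈ Metric.ball (0 : ℂ) 1, deriv f τ = cauchyTransformDeriv u τ := by
      intro τ hτ
      rw [← (hasDerivAt_cauchyTransform (hu.continuous hα) hτ).deriv]
      exact (hfu.eventuallyEq_of_mem (Metric.isOpen_ball.mem_nhds hτ)).deriv_eq
    have hid : ∀ τ ∈ Metric.ball (0 : ℂ) 1,
        g τ = cauchyTransform y 0 + (τ - 1) * (Complex.I * τ) * deriv f τ := by
      intro τ hτ
      rw [hder τ hτ, hgy hτ]
      exact cauchyTransform_field (hu.continuous hα) (hy.continuous hα) hup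
        (fun θ hθ => (hdu θ hθ).hasDerivAt) hyu hτ
    have hgc := hg.continuousOn_ball
    refine ⟨fun θ hθ => hasDerivAt_boundary hf hgc hid hθ, eq_const_at_one hα hgc hid
      (K := 4 * Real.pi / (1 - α) * (2 * (K * C))) fun τ hτ => ?_⟩
    rw [hder τ hτ]
    exact hu.norm_cauchyTransformDeriv_le hup (by positivity) hα hα1 hτ
  obtain ⟨hv', f, f1, f2, f3, f4⟩ := holder v (hv.b0.mono hKC) hv.periodic
  obtain ⟨hw', g, g1, g2, g3, g4⟩ := holder w bw hwp
  obtain ⟨hx', k, k1, k2, k3, k4⟩ := holder x bx hxp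
  obtain ⟨df, hg1⟩ := close hv' hw' hv.periodic hw hv.diff f1 f2 g1 g2
  obtain ⟨dg, hk1⟩ := close hw' hx' hwp hx hdw g1 g2 k1 k2
  have h0 : (0 : ℂ) ∈ Metric.ball (0 : ℂ) 1 := Metric.mem_ball_self one_pos
  have hbd : ∀ {u : ℝ → ℂ} {f : ℂ → ℂ}, EqOn f (cauchyTransform u) (Metric.ball 0 1) →
      ‖cauchyTransform u 0‖ ≤ K * C → (∀ a ∈ Metric.closedBall (0 : ℂ) 1,
        ∀ b ∈ Metric.closedBall (0 : ℂ) 1, ‖f a - f b‖ ≤ P * (2 * (K * C)) * ‖a - b‖ ^ α) →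
      HB α (fun θ => f (expI θ)) (K * C + P * (2 * (K * C))) := fun e1 e2 e3 =>
    HB.comp_expI (by positivity) (by positivity) hα (by rw [e1 h0]; exact e2) e3
  have hsubc : ∀ {u : ℝ → ℂ} {f : ℂ → ℂ}, ‖cauchyTransform u 0‖ ≤ K * C →
      HB α (fun θ => f (expI θ)) (K * C + P * (2 * (K * C))) →
      HB α (fun θ => f (expI θ) - cauchyTransform u 0) (Q * C) := by
    intro u f e1 e2
    have := (e2.add (HB.const (-cauchyTransform u 0))).mono (D := Q * C) (by
      rw [norm_neg, hQ]
      linarith)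
    exact this.congr fun θ _ => sub_eq_add_neg _ _
  have bf := hbd f2 f3 f4
  have bg := hsubc g3 (hbd g2 g3 g4)
  have bk := hsubc k3 (hbd k2 k3 k4)
  set cw := cauchyTransform w 0
  set cx := cauchyTransform x 0
  have hI : HB α (fun θ => -(Complex.I * expI θ)) N :=
    ⟨fun θ hθ => by simpa using hN.1 θ hθ, fun θ hθ φ hφ => by
      rw [neg_sub_neg, ← mul_sub, norm_mul, Complex.norm_I, one_mul, norm_sub_rev]
      exact hN.2 θ hθ φ hφ⟩
  have n0 : ∀ θ : ℝ, Complex.exp (θ * Complex.I) ≠ 1 → expI θ - 1 ≠ 0 := fun θ hθ =>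
    sub_ne_zero.2 hθ
  -- With `ζ = e^{iθ}`, the first derivative is `(g - cw)/(ζ - 1)`. Differentiating again, with `g'
  -- = (k - cx)/(ζ - 1)`, gives the second. The weights `θ` and `θ²` turn the denominators into
  -- powers of `μ⁻¹`.
  refine ⟨f, f1, f2, F2Bound.of_hasDerivAt (fun θ => by simp only [periodic_expI θ]) df
    (σ₂ := fun θ => ((k (expI θ) - cx) + -(Complex.I * expI θ) * (g (expI θ) - cw)) /
      (expI θ - 1) ^ 2) (fun θ hθ => ?_) (bf.mono ?_)
    (HB.congr (f := fun θ => (μ θ)⁻¹ * (g (expI θ) - cw)) ((hMi.mul bg).mono ?_) fun θ hθ => ?_)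
    (HB.congr (f := fun θ => (μ θ)⁻¹ * ((μ θ)⁻¹ * ((k (expI θ) - cx) +
      -(Complex.I * expI θ) * (g (expI θ) - cw))))
      ((hMi.mul (hMi.mul (bk.add (hI.mul bg)))).mono ?_) fun θ hθ => ?_)⟩
  · have h1 := ((dg θ hθ).sub_const cw).div ((hasDerivAt_expI θ).sub_const 1) (n0 θ hθ)
    refine h1.congr_deriv ?_
    have := n0 θ hθ
    field_simp
    ring
  · have : K * C + P * (2 * (K * C)) ≤ Q * C := by rw [hQ]; nlinarith
    refine this.trans ?_
    gcongr
    linarith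
  · rw [show 2 * M * (Q * C) = 2 * M * Q * C by ring]
    gcongr
    linarith
  · rcases eq_or_ne θ 0 with rfl | hθ0
    -- At `θ = 0` the weighted derivative is `0`; the right side agrees because `g 1 = cw`.
    · simp [expI_zero, hg1]
    · have := hμ0 θ hθ
      have hθ' : (θ : ℂ) ≠ 0 := by exact_mod_cast hθ0
      simp only [hμ, Complex.real_smul]
      field_simp
  · rw [show 2 * M * (2 * M * (Q * C + 2 * N * (Q * C))) =
      2 * M * (2 * M * (Q + 2 * N * Q)) * C by ring]
    gcongr
    linarith
  · rcases eq_or_ne θ 0 with rfl | hθ0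
    · simp [expI_zero, hg1, hk1]
    · have := hμ0 θ hθ
      have hθ' : (θ : ℂ) ≠ 0 := by exact_mod_cast hθ0
      simp only [hμ, Complex.real_smul]
      push_cast
      field_simp

/-- The harmonic conjugation operator is bounded on `F^{2,α}`: a real function of class `F^{2,α}`
is the imaginary part of a holomorphic function. -/
lemma F2Bound.exists_holomorphic {α : ℝ} (hα : 0 < α) (hα1 : α < 1) : ∃ K, 0 ≤ K ∧
    ∀ (v : ℝ → ℝ) (C : ℝ), F2Bound α v C → ∃ f : ℂ → ℂ, DiffContOnCl ℂ f (Metric.ball 0 1) ∧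
      (f 1).re = 0 ∧ (∀ θ, (f (expI θ)).im = v θ) ∧ F2Bound α (fun θ => f (expI θ)) (K * C) ∧
      ∃ b : ℂ, EqOn f (fun τ => 2 * Complex.I * cauchyTransform (fun θ => (v θ : ℂ)) τ + b)
        (Metric.ball 0 1) := by
  obtain ⟨K, hK, h⟩ := F2Bound.exists_cauchy_extension hα hα1
  refine ⟨6 * K, by positivity, fun v C hv => ?_⟩
  have hC := hv.nonneg
  have hvc : F2Bound α (fun θ => (v θ : ℂ)) C := by
    simpa using hv.clm_comp Complex.ofRealCLM
  obtain ⟨f, f1, f2, f3⟩ := h _ _ hvc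
  have hre := (hv.b0.holderCircle hα hv.periodic).two_re_cauchy_extension hv.periodic
    (by positivity) hα hα1 f1 f2
  -- The imaginary part of `b` subtracts `Re f(0)` from `2 Re f`, so that `2i f + b` has imaginary
  -- part `v`; its real part cancels `Re(2i f(1)) = -2 Im f(1)`.
  set b : ℂ := -(((f 0).re : ℂ) * Complex.I) + ((2 * (f 1).im : ℝ) : ℂ) with hb
  have hf1 : ‖f 1‖ ≤ K * C := by
    have := f3.norm_le 0
    rwa [expI_zero] at this
  have hf0 : ‖f 0‖ ≤ K * C :=
    Complex.norm_le_of_forall_mem_frontier_norm_le Metric.isBounded_ball f1 (fun z hz => by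
      rw [frontier_ball (0 : ℂ) one_ne_zero, mem_sphere_zero_iff_norm] at hz
      obtain ⟨θ, -, rfl⟩ := exists_expI_eq hz
      exact f3.norm_le θ) (subset_closure (Metric.mem_ball_self one_pos))
  have hbn : ‖b‖ ≤ 3 * (K * C) := by
    have e1 := (Complex.abs_re_le_norm (f 0)).trans hf0
    have e2 := (Complex.abs_im_le_norm (f 1)).trans hf1
    refine (norm_add_le_of_le (a₁ := -(((f 0).re : ℂ) * Complex.I))
      (r₁ := K * C) (r₂ := 2 * (K * C)) ?_ ?_).trans (le_of_eq (by ring))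
    · simpa using e1
    · rw [Complex.norm_real, Real.norm_eq_abs, abs_mul, abs_two]; linarith
  have hmul : ‖ContinuousLinearMap.mul ℝ ℂ (2 * Complex.I)‖ ≤ 2 :=
    (ContinuousLinearMap.opNorm_mul_apply_le ℝ ℂ _).trans (by simp)
  refine ⟨fun τ => 2 * Complex.I * f τ + b, ?_, ?_, fun θ => ?_, ?_, b, fun τ hτ => ?_⟩
  · exact ((diffContOnCl_const (c := 2 * Complex.I)).smul f1).add diffContOnCl_const
  · simp [hb]
  · rw [← hre θ]
    simp [hb]; ring
  · refine ((f3.clm_comp_le _ hmul).add (F2Bound.const b)).mono ?_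
    nlinarith [mul_nonneg hK hC]
  · simp only [f2 hτ]

end Conjugation

/-! ### Comparison of the extended norm with the explicit bounds -/

section NormComparison
open Set Filter Topology MeasureTheory
open scoped NNReal ENNReal

variable {E : Type*} [NormedAddCommGroup E] [NormedSpace ℝ E] {α : ℝ≥0}

lemma enorm_le_ofReal_iff {x : E} {C : ℝ} (hC : 0 ≤ C) : ‖x‖ₑ ≤ ENNReal.ofReal C ↔ ‖x‖ ≤ C := by
  rw [← ofReal_norm, ENNReal.ofReal_le_ofReal_iff hC]

lemma ofReal_mul_edist_rpow {C θ φ : ℝ} (hC : 0 ≤ C) :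
    ENNReal.ofReal C * edist θ φ ^ (α : ℝ) = ENNReal.ofReal (C * |θ - φ| ^ (α : ℝ)) := by
  rw [edist_dist, Real.dist_eq, ENNReal.ofReal_rpow_of_nonneg (abs_nonneg _) (NNReal.coe_nonneg α),
    ENNReal.ofReal_mul hC]

lemma HB.of_holderENorm_le {f : ℝ → E} {C : ℝ} (hC : 0 ≤ C)
    (h : holderENorm α f ≤ ENNReal.ofReal C) : HB α f C := by
  rw [holderENorm] at h
  refine ⟨fun θ hθ => ?_, fun θ hθ φ hφ => ?_⟩
  · rw [← enorm_le_ofReal_iff hC]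
    exact (le_iSup (fun θ : Icc (-Real.pi) Real.pi => ‖f θ‖ₑ) ⟨θ, hθ⟩).trans
      (le_self_add.trans h)
  · have h1 : eHolderNorm α ((Icc (-Real.pi) Real.pi).domRestrict f) ≤ ENNReal.ofReal C :=
      le_add_self.trans h
    have hm : MemHolder α ((Icc (-Real.pi) Real.pi).domRestrict f) :=
      eHolderNorm_lt_top.1 (h1.trans_lt ENNReal.ofReal_lt_top)
    have h2 := hm.holderWith ⟨θ, hθ⟩ ⟨φ, hφ⟩
    rw [hm.coe_nnHolderNorm_eq_eHolderNorm] at h2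
    have h3 : edist (f θ) (f φ) ≤ ENNReal.ofReal C * edist θ φ ^ (α : ℝ) :=
      h2.trans (by gcongr; rfl)
    rw [ofReal_mul_edist_rpow hC, edist_eq_enorm_sub] at h3
    exact (enorm_le_ofReal_iff (by positivity)).1 h3

lemma HB.holderENorm_le {f : ℝ → E} {C : ℝ} (h : HB α f C) :
    holderENorm α f ≤ ENNReal.ofReal (2 * C) := by
  have hC := h.nonneg
  rw [two_mul, ENNReal.ofReal_add hC hC, holderENorm]
  refine add_le_add (iSup_le fun θ => (enorm_le_ofReal_iff hC).2 (h.1 _ θ.2)) ?_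
  have h1 : HolderWith C.toNNReal α ((Icc (-Real.pi) Real.pi).domRestrict f) := by
    intro θ φ
    have : (C.toNNReal : ℝ≥0∞) * edist θ φ ^ (α : ℝ) =
      ENNReal.ofReal C * edist (θ : ℝ) (φ : ℝ) ^ (α : ℝ) := rfl
    rw [this, ofReal_mul_edist_rpow hC, edist_eq_enorm_sub]
    exact (enorm_le_ofReal_iff (by positivity)).2 (h.2 _ θ.2 _ φ.2)
  exact h1.eHolderNorm_le

lemma holderENorm_congr {f g : ℝ → E} (h : ∀ θ ∈ Icc (-Real.pi) Real.pi, f θ = g θ) :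
    holderENorm α f = holderENorm α g := by
  have : (Icc (-Real.pi) Real.pi).domRestrict f = (Icc (-Real.pi) Real.pi).domRestrict g :=
    funext fun θ => h θ θ.2
  rw [holderENorm, holderENorm, this]
  congr 1
  exact iSup_congr fun θ => by rw [h θ θ.2]

lemma holderENorm_add_le (f g : ℝ → E) :
    holderENorm α (fun θ => f θ + g θ) ≤ holderENorm α f + holderENorm α g := by
  simp only [holderENorm]
  rw [add_add_add_comm]
  refine add_le_add (iSup_le fun θ => (enorm_add_le _ _).trans (add_le_add
    (le_iSup (fun θ : Icc (-Real.pi) Real.pi => ‖f θ‖ₑ) θ)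
    (le_iSup (fun θ : Icc (-Real.pi) Real.pi => ‖g θ‖ₑ) θ))) ?_
  exact eHolderNorm_add_le (f := (Icc (-Real.pi) Real.pi).domRestrict f)
    (g := (Icc (-Real.pi) Real.pi).domRestrict g)

lemma periodic_bdry {X : Type*} (f : ℂ → X) : Function.Periodic (bdry f) (2 * Real.pi) :=
  fun θ => congrArg f (periodic_expI θ)

lemma MemF2.differentiableAt {f : ℂ → E} (h : MemF2 α f) {θ : ℝ}
    (hθ : Complex.exp (θ * Complex.I) ≠ 1) : DifferentiableAt ℝ (bdry f) θ :=
  (h.contDiffOn.differentiableOn (by norm_num)).differentiableAt (isOpen_exp_ne_one.mem_nhds hθ)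

lemma MemF2.differentiableAt_deriv {f : ℂ → E} (h : MemF2 α f) {θ : ℝ}
    (hθ : Complex.exp (θ * Complex.I) ≠ 1) : DifferentiableAt ℝ (deriv (bdry f)) θ := by
  have h1 : ContDiffOn ℝ (1 + 1) (bdry f) {θ : ℝ | Complex.exp (θ * Complex.I) ≠ 1} := by
    rw [one_add_one_eq_two]; exact h.contDiffOn
  exact (((contDiffOn_succ_iff_deriv_of_isOpen isOpen_exp_ne_one).1 h1).2.2.differentiableOn
    one_ne_zero).differentiableAt (isOpen_exp_ne_one.mem_nhds hθ)

lemma iteratedDeriv_two_eq (f : ℝ → E) : iteratedDeriv 2 f = deriv (deriv f) := by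
  rw [iteratedDeriv_succ, iteratedDeriv_one]

lemma f2Norm_add_le {f g : ℂ → E} (hf : MemF2 α f) (hg : MemF2 α g) :
    f2Norm α (fun τ => f τ + g τ) ≤ f2Norm α f + f2Norm α g := by
  have hd : ∀ θ : ℝ, Complex.exp (θ * Complex.I) ≠ 1 →
      deriv (bdry fun τ => f τ + g τ) θ = deriv (bdry f) θ + deriv (bdry g) θ := fun θ hθ =>
    ((hf.differentiableAt hθ).hasDerivAt.add (hg.differentiableAt hθ).hasDerivAt).deriv
  have hd2 : ∀ θ : ℝ, Complex.exp (θ * Complex.I) ≠ 1 →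
      deriv (deriv (bdry fun τ => f τ + g τ)) θ =
        deriv (deriv (bdry f)) θ + deriv (deriv (bdry g)) θ := by
    intro θ hθ
    refine HasDerivAt.deriv (HasDerivAt.congr_of_eventuallyEq
      ((hf.differentiableAt_deriv hθ).hasDerivAt.add (hg.differentiableAt_deriv hθ).hasDerivAt) ?_)
    filter_upwards [isOpen_exp_ne_one.mem_nhds hθ] with φ hφ using hd φ hφ
  simp only [f2Norm, iteratedDeriv_two_eq]
  have e1 : (⨆ θ : ℝ, ‖bdry (fun τ => f τ + g τ) θ‖ₑ) ≤
      (⨆ θ : ℝ, ‖bdry f θ‖ₑ) + ⨆ θ : ℝ, ‖bdry g θ‖ₑ :=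
    iSup_le fun θ => (enorm_add_le _ _).trans (add_le_add
      (le_iSup (fun θ => ‖bdry f θ‖ₑ) θ) (le_iSup (fun θ => ‖bdry g θ‖ₑ) θ))
  have e2 : holderENorm α (fun θ => θ • deriv (bdry fun τ => f τ + g τ) θ) ≤
      holderENorm α (fun θ => θ • deriv (bdry f) θ) +
        holderENorm α (fun θ => θ • deriv (bdry g) θ) := by
    refine le_trans (le_of_eq (holderENorm_congr fun θ hθ => ?_)) (holderENorm_add_le _ _)
    rcases eq_or_ne θ 0 with rfl | h0
    · simp
    · rw [hd θ (exp_ne_one_of_mem hθ h0), smul_add]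
  have e3 : holderENorm α (fun θ => θ ^ 2 • deriv (deriv (bdry fun τ => f τ + g τ)) θ) ≤
      holderENorm α (fun θ => θ ^ 2 • deriv (deriv (bdry f)) θ) +
        holderENorm α (fun θ => θ ^ 2 • deriv (deriv (bdry g)) θ) := by
    refine le_trans (le_of_eq (holderENorm_congr fun θ hθ => ?_)) (holderENorm_add_le _ _)
    rcases eq_or_ne θ 0 with rfl | h0
    · simp
    · rw [hd2 θ (exp_ne_one_of_mem hθ h0), smul_add]
  calc _ ≤ _ := add_le_add (add_le_add e1 e2) e3
    _ = _ := by ring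

/-- A function whose derivative is `O(|θ|^{α-1})` on one side of `0` is `α`-Hölder there. -/
lemma norm_sub_le_of_norm_deriv_le_rpow {f f' : ℝ → E} {a C : ℝ} (ha : 0 < a) (ha1 : a < 1)
    (hC : 0 ≤ C) (hf : Continuous f)
    (hd : ∀ θ ∈ Ioc 0 Real.pi, HasDerivAt f (f' θ) θ)
    (hb : ∀ θ ∈ Ioc 0 Real.pi, θ * ‖f' θ‖ ≤ C * θ ^ a) {θ φ : ℝ} (hφ : 0 ≤ φ) (hφθ : φ ≤ θ)
    (hθ : θ ≤ Real.pi) : ‖f θ - f φ‖ ≤ C / a * (θ - φ) ^ a := by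
  have key : ∀ φ, 0 < φ → φ ≤ θ → ‖f θ - f φ‖ ≤ C / a * (θ - φ) ^ a := by
    intro φ hφ hφθ
    have h := image_norm_le_of_norm_deriv_right_le_deriv_boundary'
      (f := fun s => f s - f φ) (f' := f') (a := φ) (b := θ)
      (hf.sub continuous_const).continuousOn
      (fun s hs => ((hd s ⟨hφ.trans_le hs.1, hs.2.le.trans hθ⟩).sub_const _).hasDerivWithinAt)
      (B := fun s => C / a * (s ^ a - φ ^ a)) (B' := fun s => C * s ^ (a - 1))
      (by simp)
      (continuousOn_const.mul (ContinuousOn.sub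
        (ContinuousOn.rpow_const continuousOn_id fun _ _ => Or.inr ha.le) continuousOn_const))
      (fun s hs => by
        have e2 := (((hasDerivAt_id s).rpow_const (p := a)
          (Or.inl (hφ.trans_le hs.1).ne')).sub_const (φ ^ a)).const_mul (C / a)
        refine (e2.congr_deriv ?_).hasDerivWithinAt
        simp only [id]
        field_simp)
      (fun s hs => by
        have hs0 : 0 < s := hφ.trans_le hs.1
        have e1 := hb s ⟨hs0, hs.2.le.trans hθ⟩
        have e2 : s ^ a = s ^ (a - 1) * s := by rw [← Real.rpow_add_one hs0.ne']; ring_nf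
        rw [e2] at e1
        nlinarith)
      (show θ ∈ Icc φ θ from ⟨hφθ, le_rfl⟩)
    refine h.trans ?_
    have := Real.rpow_add_le_add_rpow (sub_nonneg.2 hφθ) hφ.le ha.le ha1.le
    rw [sub_add_cancel] at this
    gcongr
    linarith
  rcases eq_or_lt_of_le hφ with rfl | h0
  · rcases eq_or_lt_of_le hφθ with rfl | h1
    · simp [Real.zero_rpow ha.ne']
    have l1 : Tendsto (fun φ => ‖f θ - f φ‖) (𝓝[>] 0) (𝓝 ‖f θ - f 0‖) :=
      ((by fun_prop : Continuous fun φ => ‖f θ - f φ‖).tendsto 0).mono_left nhdsWithin_le_nhds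
    have l2 : Tendsto (fun φ => C / a * (θ - φ) ^ a) (𝓝[>] 0) (𝓝 (C / a * (θ - 0) ^ a)) :=
      ((continuous_const.mul (Continuous.rpow_const (by fun_prop)
        fun _ => Or.inr ha.le)).tendsto 0).mono_left nhdsWithin_le_nhds
    refine le_of_tendsto_of_tendsto l1 l2 ?_
    filter_upwards [Ioo_mem_nhdsGT h1] with φ hφ using key φ hφ.1 hφ.2.le
  · exact key φ h0 hφθ

/-- The `F^{2,α}` norm contains only the sup norm of `σ`. But `θσ'` is Hölder and vanishes at `0`,
so `|σ'| ≤ C|θ|^{α-1}`, and integration from `0` on either side makes `σ` itself `α`-Hölder. -/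
lemma HB.of_weighted_deriv {f : ℝ → E} {a C : ℝ} (ha : 0 < a) (ha1 : a < 1) (hf : Continuous f)
    (hd : ∀ θ ∈ Icc (-Real.pi) Real.pi, θ ≠ 0 → DifferentiableAt ℝ f θ)
    (h0 : ∀ θ, ‖f θ‖ ≤ C) (h1 : HB a (fun θ => θ • deriv f θ) C) : HB a f ((1 + 2 / a) * C) := by
  have hC := h1.nonneg
  have hpi := Real.pi_pos
  have hb : ∀ θ ∈ Icc (-Real.pi) Real.pi, |θ| * ‖deriv f θ‖ ≤ C * |θ| ^ a := by
    intro θ hθ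
    have := h1.2 θ hθ 0 HB.zero_mem
    simpa [norm_smul] using this
  have hpos : ∀ θ φ, 0 ≤ φ → φ ≤ θ → θ ≤ Real.pi → ‖f θ - f φ‖ ≤ C / a * (θ - φ) ^ a :=
    fun θ φ => norm_sub_le_of_norm_deriv_le_rpow ha ha1 hC hf
      (fun s hs => (hd s ⟨by linarith [hs.1], hs.2⟩ hs.1.ne').hasDerivAt)
      (fun s hs => by simpa [abs_of_pos hs.1] using hb s ⟨by linarith [hs.1], hs.2⟩)
  have hneg : ∀ θ φ, 0 ≤ φ → φ ≤ θ → θ ≤ Real.pi → ‖f (-θ) - f (-φ)‖ ≤ C / a * (θ - φ) ^ a :=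
    fun θ φ => norm_sub_le_of_norm_deriv_le_rpow (f := fun s => f (-s))
      (f' := fun s => -deriv f (-s)) ha ha1 hC (hf.comp continuous_neg)
      (fun s hs => by
        have := (hd (-s) ⟨by linarith [hs.2], by linarith [hs.1]⟩
          (neg_ne_zero.2 hs.1.ne')).hasDerivAt.scomp s (hasDerivAt_neg s)
        exact this.congr_deriv (by simp))
      (fun s hs => by
        simpa [abs_of_pos hs.1] using hb (-s) ⟨by linarith [hs.2], by linarith [hs.1]⟩)
  have hCa : 0 ≤ C / a := by positivity
  have hle : ∀ θ φ : ℝ, θ ∈ Icc (-Real.pi) Real.pi → φ ∈ Icc (-Real.pi) Real.pi → φ ≤ θ →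
      ‖f θ - f φ‖ ≤ 2 * (C / a) * |θ - φ| ^ a := by
    intro θ φ hθ hφ hφθ
    rw [abs_of_nonneg (by linarith)]
    have hp : 0 ≤ C / a * (θ - φ) ^ a := mul_nonneg hCa (Real.rpow_nonneg (by linarith) _)
    rcases le_or_gt 0 φ with h | h
    · exact (hpos θ φ h hφθ hθ.2).trans (by linarith)
    rcases le_or_gt θ 0 with h' | h'
    · have := hneg (-φ) (-θ) (by linarith) (by linarith) (by linarith [hφ.1])
      rw [neg_neg, neg_neg, norm_sub_rev, show -φ - -θ = θ - φ by ring] at this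
      exact this.trans (by linarith)
    · have e1 := hpos θ 0 le_rfl h'.le hθ.2
      have e2 := hneg (-φ) 0 le_rfl (by linarith) (by linarith [hφ.1])
      rw [neg_neg, neg_zero] at e2
      have m1 : C / a * (θ - 0) ^ a ≤ C / a * (θ - φ) ^ a :=
        mul_le_mul_of_nonneg_left (Real.rpow_le_rpow (by linarith) (by linarith) ha.le) hCa
      have m2 : C / a * (-φ - 0) ^ a ≤ C / a * (θ - φ) ^ a :=
        mul_le_mul_of_nonneg_left (Real.rpow_le_rpow (by linarith) (by linarith) ha.le) hCa
      have := norm_sub_le_norm_sub_add_norm_sub (f θ) (f 0) (f φ)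
      rw [norm_sub_rev (f 0) (f φ)] at this
      linarith
  have hK : (1 + 2 / a) * C = C + 2 * (C / a) := by ring
  refine ⟨fun θ _ => (h0 θ).trans (by rw [hK]; linarith), fun θ hθ φ hφ => ?_⟩
  have : 2 * (C / a) * |θ - φ| ^ a ≤ (1 + 2 / a) * C * |θ - φ| ^ a := by
    rw [hK]; gcongr; linarith
  rcases le_total φ θ with h | h
  · exact (hle θ φ hθ hφ h).trans this
  · rw [norm_sub_rev]
    refine (hle φ θ hφ hθ h).trans ?_
    rwa [abs_sub_comm]

lemma MemF2.f2Bound {f : ℂ → E} {δ : ℝ} (hα : 0 < α) (hα1 : α < 1) (h : MemF2 α f) (hδ : 0 ≤ δ)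
    (hf : f2Norm α f ≤ ENNReal.ofReal δ) : F2Bound α (bdry f) ((1 + 2 / α) * δ) := by
  have hα' : (0 : ℝ) < α := hα
  simp only [f2Norm, iteratedDeriv_two_eq] at hf
  have b1 := HB.of_holderENorm_le hδ ((le_add_self.trans le_self_add).trans hf)
  have b2 := HB.of_holderENorm_le hδ (le_add_self.trans hf)
  have hle : δ ≤ (1 + 2 / α) * δ := by
    have : 0 ≤ 2 / (α : ℝ) * δ := by positivity
    linarith
  refine ⟨periodic_bdry f, fun θ hθ => h.differentiableAt hθ,
    fun θ hθ => h.differentiableAt_deriv hθ, HB.of_weighted_deriv hα' hα1 h.cont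
      (fun θ hθ h0 => h.differentiableAt (exp_ne_one_of_mem hθ h0)) (fun θ => ?_) b1,
    b1.mono hle, b2.mono hle⟩
  rw [← enorm_le_ofReal_iff hδ]
  exact (le_iSup (fun θ => ‖bdry f θ‖ₑ) θ).trans ((le_self_add.trans le_self_add).trans hf)

lemma F2Bound.f2Norm_le {f : ℂ → E} {C : ℝ} (h : F2Bound α (bdry f) C) :
    f2Norm α f ≤ ENNReal.ofReal (5 * C) := by
  have hC := h.nonneg
  rw [show 5 * C = C + 2 * C + 2 * C by ring, ENNReal.ofReal_add (by positivity) (by positivity),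
    ENNReal.ofReal_add (by positivity) (by positivity), f2Norm, iteratedDeriv_two_eq]
  exact add_le_add (add_le_add (iSup_le fun θ => (enorm_le_ofReal_iff hC).2 (h.norm_le θ))
    h.b1.holderENorm_le) h.b2.holderENorm_le

lemma F2Bound.continuous {σ : ℝ → E} {C a : ℝ} (ha : 0 < a) (h : F2Bound a σ C) : Continuous σ :=
  (h.b0.holderCircle ha h.periodic).continuous ha

/-- The Hölder bounds see only `[-π, π]`; periodicity glues the one-sided continuity at the
endpoints and spreads it over the line. -/
lemma continuousAt_of_periodic_of_continuousOn {y : ℝ → E}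
    (hp : Function.Periodic y (2 * Real.pi))
    (hc : ContinuousOn y (Icc (-Real.pi) Real.pi \ {0})) {θ : ℝ}
    (hθ : Complex.exp (θ * Complex.I) ≠ 1) : ContinuousAt y θ := by
  have hpi := Real.pi_pos
  have hint : ∀ φ ∈ Ioo (-Real.pi) Real.pi, φ ≠ 0 → ContinuousAt y φ := fun φ hφ h0 =>
    hc.continuousAt (sdiff_mem (Icc_mem_nhds hφ.1 hφ.2) (compl_singleton_mem_nhds h0))
  have hend : ContinuousAt y Real.pi := by
    rw [continuousAt_iff_continuous_left_right]
    constructor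
    · refine (hc Real.pi ⟨⟨by linarith, le_rfl⟩, hpi.ne'⟩).mono_of_mem_nhdsWithin ?_
      filter_upwards [Ioc_mem_nhdsLE hpi] with φ hφ
      exact ⟨⟨by linarith [hφ.1], hφ.2⟩, hφ.1.ne'⟩
    · have h1 : ContinuousWithinAt y (Ici (-Real.pi)) (-Real.pi) := by
        refine (hc (-Real.pi) ⟨⟨le_rfl, by linarith⟩, by simp [hpi.ne']⟩).mono_of_mem_nhdsWithin ?_
        filter_upwards [Ico_mem_nhdsGE (by linarith : -Real.pi < 0)] with φ hφ
        exact ⟨⟨hφ.1, by linarith [hφ.2]⟩, hφ.2.ne⟩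
      have h2 : (fun φ => y (φ - 2 * Real.pi)) = y := funext fun φ => hp.sub_eq φ
      rw [← h2]
      have h3 : Real.pi - 2 * Real.pi = -Real.pi := by ring
      refine ContinuousWithinAt.comp (t := Ici (-Real.pi)) (by rwa [h3]) (by fun_prop) ?_
      intro φ hφ
      have : Real.pi ≤ φ := hφ
      show -Real.pi ≤ φ - 2 * Real.pi
      linarith
  have hmain : ∀ φ ∈ Icc (-Real.pi) Real.pi, φ ≠ 0 → ContinuousAt y φ := by
    intro φ hφ h0
    rcases eq_or_lt_of_le hφ.2 with rfl | h2
    · exact hend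
    rcases eq_or_lt_of_le hφ.1 with rfl | h1
    · have h2 : (fun φ => y (φ + 2 * Real.pi)) = y := funext hp
      rw [← h2]
      refine ContinuousAt.comp (g := y) (f := fun φ => φ + 2 * Real.pi) ?_ (by fun_prop)
      rwa [show -Real.pi + 2 * Real.pi = Real.pi by ring]
    · exact hint φ ⟨h1, h2⟩ h0
  obtain ⟨n, hn⟩ := exists_sub_int_mul_mem_Icc θ
  have h2 : (fun φ => y (φ - n * (2 * Real.pi))) = y := funext fun φ => hp.sub_int_mul_eq n
  rw [← h2]
  refine ContinuousAt.comp (g := y) (f := fun φ => φ - n * (2 * Real.pi))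
    (hmain _ hn fun h0 => hθ ?_) (by fun_prop)
  rw [← exp_sub_int_mul θ n, h0]
  simp

/-- Continuity of the second derivative off `1` is not part of `F2Bound`: it follows by dividing the
Hölder function `θ²σ''` by `θ²`. -/
lemma F2Bound.memF2 {f : ℂ → E} {C : ℝ} (hα : 0 < α) (h : F2Bound α (bdry f) C) :
    MemF2 α f := by
  refine ⟨h.continuous hα, ?_, h.f2Norm_le.trans_lt ENNReal.ofReal_lt_top⟩
  have h2 : ContinuousOn (deriv (deriv (bdry f))) {θ : ℝ | Complex.exp (θ * Complex.I) ≠ 1} := by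
    intro θ hθ
    refine (continuousAt_of_periodic_of_continuousOn h.periodic.deriv_real.deriv_real ?_
      hθ).continuousWithinAt
    have e1 := (h.b2.continuousOn hα).mono (sdiff_subset (t := {(0 : ℝ)}))
    have e2 : ContinuousOn (fun θ : ℝ => (θ ^ 2)⁻¹) (Icc (-Real.pi) Real.pi \ {0}) :=
      ContinuousOn.inv₀ (by fun_prop) fun θ hθ => pow_ne_zero _ hθ.2
    refine (e2.smul e1).congr fun θ hθ => ?_
    rw [Pi.smul_apply', smul_smul, inv_mul_cancel₀ (pow_ne_zero _ hθ.2), one_smul]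
  have e : (2 : WithTop ℕ∞) = 1 + 1 := by norm_num
  have e' : (1 : WithTop ℕ∞) = 0 + 1 := by norm_num
  rw [e, contDiffOn_succ_iff_deriv_of_isOpen isOpen_exp_ne_one]
  refine ⟨fun θ hθ => (h.diff θ hθ).differentiableWithinAt, by simp, ?_⟩
  rw [e', contDiffOn_succ_iff_deriv_of_isOpen isOpen_exp_ne_one, contDiffOn_zero]
  exact ⟨fun θ hθ => (h.diff2 θ hθ).differentiableWithinAt, by simp, h2⟩

end NormComparison

/-! ### The normalized conjugation operator and the linear Bishop equation -/

section ConjugateFunction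
open Set Filter Topology MeasureTheory

lemma expI_surj_sphere {z : ℂ} (hz : z ∈ Metric.sphere (0 : ℂ) 1) : ∃ θ : ℝ, expI θ = z := by
  obtain ⟨θ, -, h⟩ := exists_expI_eq (mem_sphere_zero_iff_norm.1 hz)
  exact ⟨θ, h⟩

/-- The maximum principle for `exp(±if)`, which has modulus `1` on the circle, bounds `Im f` from
both sides. -/
lemma DiffContOnCl.im_eq_zero_of_boundary {f : ℂ → ℂ} (hf : DiffContOnCl ℂ f (Metric.ball 0 1))
    (h : ∀ θ, (f (expI θ)).im = 0) {z : ℂ} (hz : z ∈ Metric.closedBall (0 : ℂ) 1) :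
    (f z).im = 0 := by
  have hcl : closure (Metric.ball (0 : ℂ) 1) = Metric.closedBall 0 1 := closure_ball 0 one_ne_zero
  have key : ∀ c : ℂ, c.re = 0 → ‖Complex.exp (c * f z)‖ ≤ 1 := by
    intro c hc
    refine Complex.norm_le_of_forall_mem_frontier_norm_le (f := fun z => Complex.exp (c * f z))
      Metric.isBounded_ball (Complex.differentiable_exp.comp_diffContOnCl
        ((diffContOnCl_const (c := c)).smul hf)) (fun y hy => ?_) (by rwa [hcl])
    rw [frontier_ball (0 : ℂ) one_ne_zero] at hy
    obtain ⟨θ, rfl⟩ := expI_surj_sphere hy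
    rw [Complex.norm_exp]
    simp [hc, h θ]
  have h1 := key Complex.I Complex.I_re
  have h2 := key (-Complex.I) (by simp)
  rw [Complex.norm_exp, Real.exp_le_one_iff] at h1 h2
  simp at h1 h2
  linarith

/-- `f` is real throughout the disc, so its Cayley transform is unimodular; the maximum modulus
principle makes it constant, and the value at `1` decides. -/
lemma DiffContOnCl.eqOn_zero_of_im_boundary {f : ℂ → ℂ}
    (hf : DiffContOnCl ℂ f (Metric.ball 0 1)) (h : ∀ θ, (f (expI θ)).im = 0) (h1 : f 1 = 0) {z : ℂ}
    (hz : z ∈ Metric.closedBall (0 : ℂ) 1) : f z = 0 := by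
  have hcl : closure (Metric.ball (0 : ℂ) 1) = Metric.closedBall 0 1 := closure_ball 0 one_ne_zero
  have him : ∀ y ∈ Metric.closedBall (0 : ℂ) 1, (f y).im = 0 := fun y hy =>
    hf.im_eq_zero_of_boundary h hy
  have hne : ∀ y ∈ Metric.closedBall (0 : ℂ) 1, f y + Complex.I ≠ 0 := by
    intro y hy h0
    have := congrArg Complex.im h0
    simp [him y hy] at this
  set u : ℂ → ℂ := fun y => (f y + Complex.I)⁻¹ * (f y - Complex.I) with hu
  have hud : DiffContOnCl ℂ u (Metric.ball 0 1) :=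
    ((hf.add diffContOnCl_const).inv fun y hy => hne y (by rwa [← hcl])).smul
      (hf.sub diffContOnCl_const)
  have hun : ∀ y ∈ Metric.closedBall (0 : ℂ) 1, ‖u y‖ = 1 := by
    intro y hy
    have e : ‖f y - Complex.I‖ = ‖f y + Complex.I‖ := by
      have e1 : (starRingEnd ℂ) (f y) = f y := Complex.conj_eq_iff_im.2 (him y hy)
      rw [← Complex.norm_conj (f y + Complex.I), map_add, e1, Complex.conj_I, sub_eq_add_neg]
    simp only [hu]
    rw [norm_mul, norm_inv, e, inv_mul_cancel₀ (norm_ne_zero_iff.2 (hne y hy))]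
  have hconst := Complex.eqOn_closure_of_isPreconnected_of_isMaxOn_norm
    (convex_ball (0 : ℂ) 1).isPreconnected Metric.isOpen_ball hud (Metric.mem_ball_self one_pos)
    (fun y hy => by
      simp only [mem_ofPred_eq, Function.comp_apply]
      rw [hun y (Metric.ball_subset_closedBall hy), hun 0 (by simp)])
  rw [hcl] at hconst
  have e1 : u z = u 1 := (hconst hz).trans (hconst (show (1 : ℂ) ∈ Metric.closedBall 0 1 by simp)).symm
  simp only [hu, h1] at e1
  have hz0 := hne z hz
  have hI := Complex.I_ne_zero
  field_simp at e1
  rw [zero_add, zero_sub] at e1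
  have e2 : Complex.I * (2 * f z) = 0 := by linear_combination e1
  simpa using e2

/-- `f` is holomorphic in the disc with imaginary part `v` on the circle, normalized by
`Re f (1) = 0`. -/
structure IsConjExt (v : ℝ → ℝ) (f : ℂ → ℂ) : Prop where
  holo : DiffContOnCl ℂ f (Metric.ball 0 1)
  re_one : (f 1).re = 0
  im_bdry : ∀ θ, (f (expI θ)).im = v θ

lemma IsConjExt.eq {v : ℝ → ℝ} {f g : ℂ → ℂ} (hf : IsConjExt v f) (hg : IsConjExt v g) {z : ℂ}
    (hz : z ∈ Metric.closedBall (0 : ℂ) 1) : f z = g z := by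
  have := (hf.holo.sub hg.holo).eqOn_zero_of_im_boundary
    (fun θ => by simp [hf.im_bdry, hg.im_bdry]) (by
      have h1 := hf.im_bdry 0
      have h2 := hg.im_bdry 0
      rw [expI_zero] at h1 h2
      apply Complex.ext <;> simp [hf.re_one, hg.re_one, h1, h2]) hz
  simpa [sub_eq_zero] using this

lemma IsConjExt.sub {v w : ℝ → ℝ} {f g : ℂ → ℂ} (hf : IsConjExt v f) (hg : IsConjExt w g) :
    IsConjExt (fun θ => v θ - w θ) (fun τ => f τ - g τ) :=
  ⟨hf.holo.sub hg.holo, by simp [hf.re_one, hg.re_one], fun θ => by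
    simp [hf.im_bdry, hg.im_bdry]⟩

lemma IsConjExt.const_mul {v : ℝ → ℝ} {f : ℂ → ℂ} (hf : IsConjExt v f) (c : ℝ) :
    IsConjExt (fun θ => c * v θ) (fun τ => c * f τ) :=
  ⟨(diffContOnCl_const (c := (c : ℂ))).smul hf.holo, by simp [hf.re_one], fun θ => by
    simp [hf.im_bdry]⟩

/-- The normalized holomorphic function with imaginary part `v` on the circle. -/
noncomputable def conjExt (v : ℝ → ℝ) : ℂ → ℂ := Classical.epsilon (IsConjExt v)

lemma IsConjExt.isConjExt_conjExt {v : ℝ → ℝ} {f : ℂ → ℂ} (h : IsConjExt v f) :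
    IsConjExt v (conjExt v) := Classical.epsilon_spec ⟨f, h⟩

/-- The normalized holomorphic map with imaginary part `v` on the circle. -/
noncomputable def conjExtPi {ι : Type*} (v : ℝ → ι → ℝ) (τ : ℂ) : ι → ℂ :=
  fun i => conjExt (fun θ => v θ i) τ

/-- The conjugation operator, which takes the imaginary part of a holomorphic map on the circle
to its real part, normalized to vanish at `1`. -/
noncomputable def conjOp {ι : Type*} (v : ℝ → ι → ℝ) (θ : ℝ) : ι → ℝ :=
  fun i => (conjExtPi v (expI θ) i).re

/-- `K` bounds the conjugation operator on scalar functions of class `F^{2,α}`. -/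
def IsConjBound (α K : ℝ) : Prop := 0 ≤ K ∧ ∀ (v : ℝ → ℝ) (C : ℝ), F2Bound α v C →
  IsConjExt v (conjExt v) ∧ F2Bound α (fun θ => conjExt v (expI θ)) (K * C) ∧
    ∃ b : ℂ, EqOn (conjExt v)
      (fun τ => 2 * Complex.I * cauchyTransform (fun θ => (v θ : ℂ)) τ + b) (Metric.ball 0 1)

lemma exists_isConjBound {α : ℝ} (hα : 0 < α) (hα1 : α < 1) : ∃ K, IsConjBound α K := by
  obtain ⟨K, hK, h⟩ := F2Bound.exists_holomorphic hα hα1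
  refine ⟨K, hK, fun v C hv => ?_⟩
  obtain ⟨f, f1, f2, f3, f4, b, f5⟩ := h v C hv
  have hf : IsConjExt v f := ⟨f1, f2, f3⟩
  have he := hf.isConjExt_conjExt
  refine ⟨he, ?_, b, fun τ hτ => ?_⟩
  · have : (fun θ => conjExt v (expI θ)) = fun θ => f (expI θ) :=
      funext fun θ => he.eq hf (expI_mem_closedBall θ)
    rwa [this]
  · rw [he.eq hf (Metric.ball_subset_closedBall hτ)]
    exact f5 hτ

variable {ι : Type*} [Fintype ι] {α K : ℝ}

namespace IsConjBound

lemma isConjExt (hK : IsConjBound α K) {v : ℝ → ι → ℝ} {C : ℝ} (hv : F2Bound α v C) (i : ι) :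
    IsConjExt (fun θ => v θ i) (fun τ => conjExtPi v τ i) := (hK.2 _ _ (hv.apply i)).1

lemma f2Bound_ext (hK : IsConjBound α K) {v : ℝ → ι → ℝ} {C : ℝ} (hv : F2Bound α v C) :
    F2Bound α (fun θ => conjExtPi v (expI θ)) (K * C) :=
  F2Bound.pi (mul_nonneg hK.1 hv.nonneg) fun i => (hK.2 _ _ (hv.apply i)).2.1

lemma f2Bound_conjOp (hK : IsConjBound α K) {v : ℝ → ι → ℝ} {C : ℝ} (hv : F2Bound α v C) :
    F2Bound α (conjOp v) (K * C) :=
  F2Bound.pi (mul_nonneg hK.1 hv.nonneg) fun i =>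
    (((hK.f2Bound_ext hv).apply i).clm_comp_le Complex.reCLM (M := 1) (by simp)).mono (by simp)

lemma conjOp_zero (hK : IsConjBound α K) {v : ℝ → ι → ℝ} {C : ℝ} (hv : F2Bound α v C) :
    conjOp v 0 = 0 := by
  funext i
  rw [conjOp, expI_zero]
  exact (hK.isConjExt hv i).re_one

lemma conjExtPi_sub (hK : IsConjBound α K) {v w : ℝ → ι → ℝ} {C D : ℝ} (hv : F2Bound α v C)
    (hw : F2Bound α w D) {τ : ℂ} (hτ : τ ∈ Metric.closedBall (0 : ℂ) 1) :
    conjExtPi (fun θ => v θ - w θ) τ = conjExtPi v τ - conjExtPi w τ := funext fun i =>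
  (hK.isConjExt (hv.sub hw) i).eq ((hK.isConjExt hv i).sub (hK.isConjExt hw i)) hτ

lemma conjExtPi_smul (hK : IsConjBound α K) {v : ℝ → ι → ℝ} {C : ℝ} (hv : F2Bound α v C) (c : ℝ)
    {τ : ℂ} (hτ : τ ∈ Metric.closedBall (0 : ℂ) 1) :
    conjExtPi (fun θ => c • v θ) τ = c • conjExtPi v τ := funext fun i => by
  have := (hK.isConjExt (hv.const_smul c) i).eq ((hK.isConjExt hv i).const_mul c) hτ
  simpa using this

lemma conjOp_sub (hK : IsConjBound α K) {v w : ℝ → ι → ℝ} {C D : ℝ} (hv : F2Bound α v C)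
    (hw : F2Bound α w D) (θ : ℝ) :
    conjOp (fun θ => v θ - w θ) θ = conjOp v θ - conjOp w θ := funext fun i => by
  have := congrFun (hK.conjExtPi_sub hv hw (expI_mem_closedBall θ)) i
  simp [conjOp, this]

lemma diffContOnCl (hK : IsConjBound α K) {v : ℝ → ι → ℝ} {C : ℝ} (hv : F2Bound α v C) :
    DiffContOnCl ℂ (conjExtPi v) (Metric.ball 0 1) :=
  ⟨differentiableOn_pi.2 fun i => (hK.isConjExt hv i).holo.differentiableOn,
    continuousOn_pi.2 fun i => (hK.isConjExt hv i).holo.continuousOn⟩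

lemma conjExtPi_one (hK : IsConjBound α K) {v : ℝ → ι → ℝ} {C : ℝ} (hv : F2Bound α v C)
    (h0 : v 0 = 0) : conjExtPi v 1 = 0 := by
  funext i
  have h1 := (hK.isConjExt hv i).im_bdry 0
  rw [expI_zero, h0] at h1
  exact Complex.ext (hK.isConjExt hv i).re_one h1

/-- A function on the disc with imaginary part `v` on the circle and value `0` at `1`. -/
lemma eq_conjExtPi (hK : IsConjBound α K) {v : ℝ → ι → ℝ} {C : ℝ} (hv : F2Bound α v C)
    {f : ℂ → ι → ℂ} (hf : DiffContOnCl ℂ f (Metric.ball 0 1)) (h1 : f 1 = 0)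
    (him : ∀ θ i, (f (expI θ) i).im = v θ i) {τ : ℂ} (hτ : τ ∈ Metric.closedBall (0 : ℂ) 1) :
    f τ = conjExtPi v τ := funext fun i => by
  refine IsConjExt.eq (v := fun θ => v θ i) (f := fun τ => f τ i) ⟨⟨?_, ?_⟩, ?_, fun θ => him θ i⟩
    (hK.isConjExt hv i) hτ
  · exact differentiableOn_pi.1 hf.differentiableOn i
  · exact continuousOn_pi.1 hf.continuousOn i
  · simp [h1]

end IsConjBound

lemma F2Bound.sum {κ E : Type*} [NormedAddCommGroup E] [NormedSpace ℝ E] (s : Finset κ)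
    {f : κ → ℝ → E} {C : ℝ} (h : ∀ k ∈ s, F2Bound α (f k) C) :
    F2Bound α (fun θ => ∑ k ∈ s, f k θ) (s.card * C) := by
  classical
  induction s using Finset.induction_on with
  | empty => simpa using F2Bound.const (α := α) (0 : E)
  | insert k s hk ih =>
    simp only [Finset.sum_insert hk, Finset.card_insert_of_notMem hk]
    refine ((h k (Finset.mem_insert_self k s)).add
      (ih fun j hj => h j (Finset.mem_insert_of_mem hj))).mono (le_of_eq ?_)
    push_cast; ring

lemma F2Bound.mulVec {a : ℝ → ι → ι → ℝ} {x : ℝ → ι → ℝ} {ε C : ℝ} (ha : F2Bound α a ε)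
    (hx : F2Bound α x C) :
    F2Bound α (fun θ i => ∑ j, a θ i j * x θ j) (Fintype.card ι * (8 * ε * C)) := by
  have := ha.nonneg
  have := hx.nonneg
  exact F2Bound.pi (by positivity) fun i =>
    F2Bound.sum _ fun j _ => ((ha.apply i).apply j).smul (hx.apply j)

/-- The linear Bishop equation. -/
lemma IsConjBound.exists_linear_solution (hK : IsConjBound α K) {a : ℝ → ι → ι → ℝ} {b : ℝ → ι → ℝ}
    {ε B : ℝ} (ha : F2Bound α a ε) (hb : F2Bound α b B)
    (hε : K * (Fintype.card ι * (8 * ε)) ≤ 1 / 2) :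
    ∃ x : ℝ → ι → ℝ, (∀ θ, x θ = b θ + conjOp (fun θ i => ∑ j, a θ i j * x θ j) θ) ∧
      F2Bound α (fun θ => x θ - b θ) B := by
  have hsub : ∀ x y : ℝ → ι → ℝ, ∀ θ, (fun i => ∑ j, a θ i j * x θ j) -
      (fun i => ∑ j, a θ i j * y θ j) = fun i => ∑ j, a θ i j * (x θ - y θ) j := by
    intro x y θ
    funext i
    simp only [Pi.sub_apply, mul_sub, Finset.sum_sub_distrib]
  have hle : ∀ {x : ℝ → ι → ℝ} {C}, F2Bound α x C →
      F2Bound α (conjOp (fun θ i => ∑ j, a θ i j * x θ j)) (C / 2) := by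
    intro x C hx
    refine (hK.f2Bound_conjOp (ha.mulVec hx)).mono ?_
    have := mul_le_mul_of_nonneg_right hε hx.nonneg
    linarith
  obtain ⟨x, hx, hxr⟩ := F2Bound.exists_fixedPoint (α := α) (r := B)
    (Ψ := fun (x : ℝ → ι → ℝ) θ => b θ + conjOp (fun θ i => ∑ j, a θ i j * x θ j) θ) hb
    (fun x y hx hy C hxy => by
      have hx' := (hx.add hb)
      have hy' := (hy.add hb)
      simp only [sub_add_cancel] at hx' hy'
      simp only [add_sub_add_left_eq_sub]
      have := hle hxy
      simp only [← hK.conjOp_sub (ha.mulVec hx') (ha.mulVec hy'), hsub]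
      exact this)
    (by simpa only [add_sub_cancel_left] using hle hb)
  exact ⟨x, fun θ => (congrFun hx θ).symm, hxr⟩

end ConjugateFunction

/-! ### Real-by-holomorphic factorization and the transport matrix -/

section Transport
open Set Filter Topology MeasureTheory
open scoped NNReal

variable {ι : Type*} [Fintype ι] [DecidableEq ι]

lemma DiffContOnCl.finset_sum {κ : Type*} (s : Finset κ) {f : κ → ℂ → ℂ} {U : Set ℂ}
    (h : ∀ k ∈ s, DiffContOnCl ℂ (f k) U) : DiffContOnCl ℂ (fun τ => ∑ k ∈ s, f k τ) U := by
  classical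
  induction s using Finset.induction_on with
  | empty => simpa using diffContOnCl_const
  | insert k s hk ih =>
    simp only [Finset.sum_insert hk]
    exact (h k (Finset.mem_insert_self k s)).add
      (ih fun j hj => h j (Finset.mem_insert_of_mem hj))

lemma DiffContOnCl.finset_prod {κ : Type*} (s : Finset κ) {f : κ → ℂ → ℂ} {U : Set ℂ}
    (h : ∀ k ∈ s, DiffContOnCl ℂ (f k) U) : DiffContOnCl ℂ (fun τ => ∏ k ∈ s, f k τ) U := by
  classical
  induction s using Finset.induction_on with
  | empty => simpa using diffContOnCl_const
  | insert k s hk ih =>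
    simp only [Finset.prod_insert hk]
    exact (h k (Finset.mem_insert_self k s)).smul
      (ih fun j hj => h j (Finset.mem_insert_of_mem hj))

lemma DiffContOnCl.matrix_det {F : ℂ → Matrix ι ι ℂ} {U : Set ℂ}
    (h : ∀ i j, DiffContOnCl ℂ (fun τ => F τ i j) U) : DiffContOnCl ℂ (fun τ => (F τ).det) U := by
  simp only [Matrix.det_apply']
  exact DiffContOnCl.finset_sum _ fun σ _ => (DiffContOnCl.finset_prod Finset.univ
    fun i _ => h (σ i) i).const_smul ((Equiv.Perm.sign σ : ℤ) : ℂ)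

lemma DiffContOnCl.matrix_inv {F : ℂ → Matrix ι ι ℂ} {U : Set ℂ}
    (h : ∀ i j, DiffContOnCl ℂ (fun τ => F τ i j) U) (hd : ∀ τ ∈ closure U, (F τ).det ≠ 0)
    (i j : ι) : DiffContOnCl ℂ (fun τ => (F τ)⁻¹ i j) U := by
  simp only [Matrix.inv_def, Ring.inverse_eq_inv', Matrix.smul_apply, Matrix.adjugate_apply]
  refine ((DiffContOnCl.matrix_det h).inv hd).smul (DiffContOnCl.matrix_det fun k l => ?_)
  by_cases hk : k = j
  · subst hk; simpa using diffContOnCl_const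
  · simpa [Matrix.updateRow_ne hk] using h k l

/-- A null vector satisfies `v = -(M - 1)v`, whose sup norm is at most `‖v‖/2`. -/
lemma Matrix.det_ne_zero_of_norm_sub_one_le {M : Matrix ι ι ℂ}
    (h : ∀ i j, ‖M i j - (1 : Matrix ι ι ℂ) i j‖ ≤ 1 / (2 * (Fintype.card ι + 1))) :
    M.det ≠ 0 := by
  intro h0
  obtain ⟨v, hv, hMv⟩ := Matrix.exists_mulVec_eq_zero_iff.2 h0
  have hle : ‖v‖ ≤ 1 / 2 * ‖v‖ := by
    refine (pi_norm_le_iff_of_nonneg (by positivity)).2 fun i => ?_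
    have e : v i = -∑ j, (M i j - (1 : Matrix ι ι ℂ) i j) * v j := by
      have h1 : ∑ j, M i j * v j = 0 := congrFun hMv i
      have h2 : ∑ j, (1 : Matrix ι ι ℂ) i j * v j = v i := congrFun (Matrix.one_mulVec v) i
      simp only [sub_mul, Finset.sum_sub_distrib, h1, h2]
      ring
    rw [e, norm_neg]
    calc _ ≤ ∑ j : ι, 1 / (2 * ((Fintype.card ι : ℝ) + 1)) * ‖v‖ := by
          refine norm_sum_le_of_le _ fun j _ => ?_
          rw [norm_mul]
          gcongr
          exacts [h i j, norm_le_pi_norm v j]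
      _ = Fintype.card ι / (Fintype.card ι + 1) * (1 / 2 * ‖v‖) := by
          rw [Finset.sum_const, Finset.card_univ, nsmul_eq_mul]
          field_simp
      _ ≤ 1 * (1 / 2 * ‖v‖) := by
          gcongr
          rw [div_le_one (by positivity)]
          linarith
      _ = _ := one_mul _
  have : 0 < ‖v‖ := norm_pos_iff.2 hv
  linarith

/-- Factorization: `F = g (1 - i a)` on the circle with `F` holomorphic and `g` real. -/
lemma IsConjBound.exists_transport {α K ε : ℝ} (hK : IsConjBound α K) {a : ℝ → ι → ι → ℝ}
    (ha : F2Bound α a ε) (h0 : a 0 = 0)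
    (hε : K * (Fintype.card ι * (8 * ε)) ≤ 1 / (4 * (Fintype.card ι + 1))) :
    ∃ (g : ℝ → ι → ι → ℝ) (F : ℂ → Matrix ι ι ℂ), F2Bound α g 2 ∧
      (∀ i j, DiffContOnCl ℂ (fun τ => F τ i j) (Metric.ball 0 1)) ∧ F 1 = 1 ∧
      (∀ θ, F (expI θ) = (Matrix.of (g θ)).map Complex.ofReal *
        (1 - Complex.I • (Matrix.of (a θ)).map Complex.ofReal)) ∧
      ∀ τ ∈ Metric.closedBall (0 : ℂ) 1, (F τ).det ≠ 0 := by
  have hε2 : K * (Fintype.card ι * (8 * ε)) ≤ 1 / 2 := by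
    refine hε.trans ?_
    rw [div_le_div_iff₀ (by positivity) (by norm_num)]
    have : (0 : ℝ) ≤ Fintype.card ι := by positivity
    linarith
  -- Rows of `g` act on `a` from the left, so each row solves a linear equation with the transpose
  -- of `-a`: `g_i = e_i + T(-g_i a)`. Then `g_i - i g_i a` has the boundary values of a holomorphic
  -- row.
  have ha' : F2Bound α (fun θ l j => -a θ j l) ε :=
    F2Bound.pi ha.nonneg fun l => F2Bound.pi ha.nonneg fun j => ((ha.apply j).apply l).neg
  have hb : ∀ i : ι, F2Bound α (fun _ : ℝ => (Pi.single i 1 : ι → ℝ)) 1 := fun i => by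
    refine (F2Bound.const (α := α) (Pi.single i 1 : ι → ℝ)).mono
      ((pi_norm_le_iff_of_nonneg zero_le_one).2 fun j => ?_)
    rw [Pi.single_apply]
    split_ifs <;> simp
  choose g hg hgb using fun i => hK.exists_linear_solution ha' (hb i) hε2
  have hg2 : ∀ i, F2Bound α (g i) 2 := fun i => by
    have := (hgb i).add (hb i)
    simp only [sub_add_cancel] at this
    exact this.mono (by norm_num)
  set V : ι → ℝ → ι → ℝ := fun i θ l => ∑ j, -a θ j l * g i θ j with hV
  have hVb : ∀ i, F2Bound α (V i) (Fintype.card ι * (8 * ε * 2)) := fun i => ha'.mulVec (hg2 i)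
  have hV0 : ∀ i, V i 0 = 0 := fun i => by funext l; simp [hV, h0]
  refine ⟨fun θ i => g i θ, fun τ => Matrix.of fun i l => (1 : Matrix ι ι ℂ) i l +
    conjExtPi (V i) τ l, F2Bound.pi (by norm_num) hg2, fun i l =>
    diffContOnCl_const.add (hK.isConjExt (hVb i) l).holo, ?_, fun θ => ?_, fun τ hτ => ?_⟩
  · ext i l
    simp [hK.conjExtPi_one (hVb i) (hV0 i)]
  · ext i l
    have hre : (conjExtPi (V i) (expI θ) l).re = g i θ l - (Pi.single i 1 : ι → ℝ) l := by
      rw [hg i θ]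
      simp [conjOp, hV]
    have him := (hK.isConjExt (hVb i) l).im_bdry θ
    rw [mul_sub, mul_one, Matrix.mul_smul]
    have hs : ∑ j, (g i θ j : ℂ) * (a θ j l : ℂ) = ((-V i θ l : ℝ) : ℂ) := by
      rw [hV]
      push_cast
      rw [← Finset.sum_neg_distrib]
      exact Finset.sum_congr rfl fun j _ => by ring
    simp only [Matrix.of_apply, Matrix.sub_apply, Matrix.map_apply, Matrix.smul_apply,
      Matrix.mul_apply, hs, smul_eq_mul]
    have h1 : ((1 : Matrix ι ι ℂ) i l) = (((Pi.single i 1 : ι → ℝ) l : ℝ) : ℂ) := by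
      rw [Matrix.one_apply, Pi.single_apply]
      by_cases h : i = l
      · simp [h]
      · simp [h, Ne.symm h]
    rw [h1]
    apply Complex.ext
    · simp [hre]
    · simp [him]
  -- The maximum principle reduces the bound on `F - 1` to the circle. There it is `2 K n (8ε) ≤
  -- 1/(2(n + 1))`, with `n` the size of the matrix, which is why the hypothesis has `4(n + 1)`.
  · refine Matrix.det_ne_zero_of_norm_sub_one_le fun i l => ?_
    simp only [Matrix.of_apply, add_sub_cancel_left]
    have hcl : closure (Metric.ball (0 : ℂ) 1) = Metric.closedBall 0 1 := closure_ball 0 one_ne_zero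
    refine Complex.norm_le_of_forall_mem_frontier_norm_le Metric.isBounded_ball
      (hK.isConjExt (hVb i) l).holo (fun z hz => ?_) (by rwa [hcl])
    rw [frontier_ball (0 : ℂ) one_ne_zero] at hz
    obtain ⟨θ, rfl⟩ := expI_surj_sphere hz
    refine (((hK.f2Bound_ext (hVb i)).apply l).norm_le θ).trans ?_
    have h3 : 1 / (2 * ((Fintype.card ι : ℝ) + 1)) = 2 * (1 / (4 * (Fintype.card ι + 1))) := by
      field_simp
      norm_num
    rw [h3]
    linarith

/-- Two factors with the same holomorphy property agree. -/
lemma eq_of_real_mul_holomorphic {P : ℝ → Matrix ι ι ℂ} {G G₁ : ℝ → Matrix ι ι ℝ}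
    {F F₁ : ℂ → Matrix ι ι ℂ} (hF : ∀ i j, DiffContOnCl ℂ (fun τ => F τ i j) (Metric.ball 0 1))
    (hF₁ : ∀ i j, DiffContOnCl ℂ (fun τ => F₁ τ i j) (Metric.ball 0 1))
    (hd : ∀ τ ∈ Metric.closedBall (0 : ℂ) 1, (F τ).det ≠ 0)
    (h : ∀ θ, F (expI θ) = (G θ).map Complex.ofReal * P θ)
    (h₁ : ∀ θ, F₁ (expI θ) = (G₁ θ).map Complex.ofReal * P θ) (h0 : G₁ 0 = G 0) (θ : ℝ) :
    G₁ θ = G θ := by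
  have hcl : closure (Metric.ball (0 : ℂ) 1) = Metric.closedBall 0 1 := closure_ball 0 one_ne_zero
  have hdet : ∀ θ, IsUnit (F (expI θ)).det := fun θ => (hd _ (expI_mem_closedBall θ)).isUnit
  have hdG : ∀ θ, IsUnit (G θ).det := by
    intro θ
    have h2 := hdet θ
    rw [h θ, Matrix.det_mul] at h2
    have h3 := isUnit_of_mul_isUnit_left h2
    have h4 : ((G θ).map Complex.ofReal).det = ((G θ).det : ℂ) :=
      (RingHom.map_det Complex.ofRealHom (G θ)).symm
    rw [h4, isUnit_iff_ne_zero] at h3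
    exact isUnit_iff_ne_zero.2 (by exact_mod_cast h3)
  -- `F₁F⁻¹` is holomorphic; on the circle the common factor `P` drops out and leaves the real
  -- matrix `G₁G⁻¹`, equal to `1` at `ζ = 1`. Its entries are therefore constant.
  set R : ℂ → Matrix ι ι ℂ := fun τ => F₁ τ * (F τ)⁻¹ with hR
  have hRd : ∀ i j, DiffContOnCl ℂ (fun τ => R τ i j) (Metric.ball 0 1) := by
    intro i j
    simp only [hR, Matrix.mul_apply]
    exact DiffContOnCl.finset_sum _ fun k _ => (hF₁ i k).smul
      (DiffContOnCl.matrix_inv hF (by rwa [hcl]) k j)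
  have hRb : ∀ θ, R (expI θ) = (G₁ θ * (G θ)⁻¹).map Complex.ofReal := by
    intro θ
    have e1 : (G₁ θ * (G θ)⁻¹).map Complex.ofReal * F (expI θ) = F₁ (expI θ) := by
      rw [h, h₁, ← Matrix.mul_assoc]
      congr 1
      have e2 := Matrix.map_mul (L := G₁ θ * (G θ)⁻¹) (M := G θ) (f := Complex.ofRealHom)
      rw [Matrix.mul_assoc, Matrix.nonsing_inv_mul _ (hdG θ), mul_one] at e2
      exact e2.symm
    rw [hR]
    simp only
    rw [← e1, Matrix.mul_assoc, Matrix.mul_nonsing_inv _ (hdet θ), mul_one]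
  have hR1 : ∀ θ i j, R (expI θ) i j - (1 : Matrix ι ι ℂ) i j = 0 := by
    intro θ i j
    refine DiffContOnCl.eqOn_zero_of_im_boundary (f := fun τ => R τ i j - (1 : Matrix ι ι ℂ) i j)
      ((hRd i j).sub diffContOnCl_const) (fun φ => ?_) ?_ (expI_mem_closedBall θ)
    · rw [hRb, Matrix.map_apply, Complex.sub_im, Complex.ofReal_im, Matrix.one_apply]
      split_ifs <;> simp
    · rw [← expI_zero, hRb 0, h0, Matrix.mul_nonsing_inv _ (hdG 0), Matrix.map_apply,
        Matrix.one_apply, Matrix.one_apply]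
      split_ifs <;> simp
  have e3 : G₁ θ * (G θ)⁻¹ = 1 := by
    ext i j
    have := hR1 θ i j
    rw [hRb, Matrix.map_apply, sub_eq_zero, Matrix.one_apply] at this
    rw [Matrix.one_apply]
    split_ifs at this ⊢ <;> exact_mod_cast this
  calc G₁ θ = G₁ θ * ((G θ)⁻¹ * G θ) := by rw [Matrix.nonsing_inv_mul _ (hdG θ), mul_one]
    _ = G θ := by rw [← Matrix.mul_assoc, e3, one_mul]

variable {d m : ℕ}

/-- `baseOf` as a continuous linear map. -/
noncomputable def baseCLM (d m : ℕ) : Ambient d m →L[ℝ] RealCoord d m :=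
  (ContinuousLinearMap.pi fun j => Complex.reCLM.comp ((ContinuousLinearMap.proj j).comp
    (ContinuousLinearMap.fst ℝ (Fin d → ℂ) (Fin m → ℂ)))).prod
    (ContinuousLinearMap.snd ℝ (Fin d → ℂ) (Fin m → ℂ))

lemma baseCLM_apply (p : Ambient d m) : baseCLM d m p = baseOf p := rfl

/-- The partial Jacobian matrix of `h` in the variable `x`. -/
noncomputable def xJacobian (h : RealCoord d m → Fin d → ℝ) (u : RealCoord d m) :
    Fin d → Fin d → ℝ := fun i j => fderiv ℝ h u (Pi.single j 1, 0) i

/-- `∂y/∂z = -i/2` and `∂h/∂z = h_x/2`, so `∂'r = -i/2 - h_x/2`. The constant factor `-i/2` does not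
affect holomorphic extendability. -/
lemma dzDefFun_eq {h : RealCoord d m → Fin d → ℝ} (hh : Differentiable ℝ h) (p : Ambient d m) :
    dzDefFun h p = (-(Complex.I / 2)) •
      (1 - Complex.I • (Matrix.of (xJacobian h (baseOf p))).map Complex.ofReal) := by
  have hd : HasFDerivAt (defFun h) ((ContinuousLinearMap.pi fun j => Complex.imCLM.comp
      ((ContinuousLinearMap.proj j).comp (ContinuousLinearMap.fst ℝ (Fin d → ℂ) (Fin m → ℂ)))) -
      (fderiv ℝ h (baseOf p)).comp (baseCLM d m)) p :=
    (ContinuousLinearMap.pi fun j => Complex.imCLM.comp ((ContinuousLinearMap.proj j).comp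
      (ContinuousLinearMap.fst ℝ (Fin d → ℂ) (Fin m → ℂ)))).hasFDerivAt.sub
      ((hh (baseCLM d m p)).hasFDerivAt.comp p (baseCLM d m).hasFDerivAt)
  ext l j
  have b1 : baseCLM d m (Pi.single j 1, 0) = (Pi.single j 1, 0) := by
    rw [baseCLM_apply, baseOf]
    refine Prod.ext (funext fun i => ?_) rfl
    by_cases h : i = j
    · subst h; simp
    · simp [h]
  have b2 : baseCLM d m (Pi.single j Complex.I, 0) = 0 := by
    rw [baseCLM_apply, baseOf]
    refine Prod.ext (funext fun i => ?_) rfl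
    by_cases h : i = j
    · subst h; simp
    · simp [h]
  simp only [dzDefFun, hd.fderiv, Matrix.of_apply, sub_apply, ContinuousLinearMap.comp_apply, b1,
    b2, map_zero, Matrix.smul_apply, Matrix.sub_apply, Matrix.map_apply, xJacobian, Pi.sub_apply,
    ContinuousLinearMap.pi_apply, ContinuousLinearMap.proj_apply, ContinuousLinearMap.coe_fst',
    Pi.zero_apply, smul_eq_mul, Complex.imCLM_apply, Matrix.one_apply]
  by_cases hlj : l = j
  · subst hlj
    have := Complex.I_sq
    simp
    linear_combination (-(1 / 2 : ℂ) * (fderiv ℝ h (baseOf p) (Pi.single l 1, 0) l : ℂ)) * this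
  · have := Complex.I_sq
    simp [hlj]
    linear_combination (-(1 / 2 : ℂ) * (fderiv ℝ h (baseOf p) (Pi.single j 1, 0) l : ℂ)) * this

lemma isTransport_of_factorization {h : RealCoord d m → Fin d → ℝ} (hh : Differentiable ℝ h)
    {A : ℂ → Ambient d m} {g : ℝ → Fin d → Fin d → ℝ} {F : ℂ → Matrix (Fin d) (Fin d) ℂ}
    (hF : ∀ i j, DiffContOnCl ℂ (fun τ => F τ i j) (Metric.ball 0 1)) (h1 : F 1 = 1)
    (hb : ∀ θ, F (expI θ) = (Matrix.of (g θ)).map Complex.ofReal *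
      (1 - Complex.I • (Matrix.of (xJacobian h (baseOf (bdry A θ)))).map Complex.ofReal))
    (hd : ∀ τ ∈ Metric.closedBall (0 : ℂ) 1, (F τ).det ≠ 0) :
    ∃ G : ℂ → Matrix (Fin d) (Fin d) ℝ, IsTransport h A G ∧ (∀ θ, G (expI θ) = Matrix.of (g θ)) ∧
      ∀ G₁, IsTransport h A G₁ → Set.EqOn G₁ G (Metric.sphere 0 1) := by
  -- On the circle `F = g - i ga` with `g` and `a` real, so the real part of `F` recovers `g`.
  set G : ℂ → Matrix (Fin d) (Fin d) ℝ := fun τ => Matrix.of fun i j => (F τ i j).re with hG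
  have hGg : ∀ θ, G (expI θ) = Matrix.of (g θ) := by
    intro θ
    ext i j
    simp only [hG, Matrix.of_apply, hb θ]
    rw [mul_sub, mul_one, Matrix.mul_smul]
    simp [Matrix.mul_apply]
  have hdz : ∀ θ, dzDefFun h (A (expI θ)) = (-(Complex.I / 2)) • (1 - Complex.I •
      (Matrix.of (xJacobian h (baseOf (bdry A θ)))).map Complex.ofReal) := fun θ =>
    dzDefFun_eq hh _
  refine ⟨G, ⟨?_, ?_, fun i j => ⟨fun τ => -(Complex.I / 2) * F τ i j,
    (hF i j).const_smul (-(Complex.I / 2)), fun τ hτ => ?_⟩⟩, hGg, fun G₁ hG₁ τ hτ => ?_⟩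
  · refine continuousOn_pi.2 fun i => continuousOn_pi.2 fun j => ?_
    exact Complex.continuous_re.comp_continuousOn
      ((hF i j).continuousOn_ball.mono Metric.sphere_subset_closedBall)
  · ext i j
    simp only [hG, h1, Matrix.of_apply, Matrix.one_apply]
    split_ifs <;> simp
  · obtain ⟨θ, rfl⟩ := expI_surj_sphere hτ
    rw [hdz, Matrix.mul_smul, hGg, ← hb, Matrix.smul_apply, smul_eq_mul]
  · obtain ⟨θ, rfl⟩ := expI_surj_sphere hτ
    choose f hf hfb using hG₁.extends_holo
    -- The factor `2i` undoes the `-i/2` in `∂'r`, so that both products have the same right factor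
    -- `1 - ia`.
    refine eq_of_real_mul_holomorphic (G := fun θ => G (expI θ)) (G₁ := fun θ => G₁ (expI θ))
      (F := F) (F₁ := fun τ => Matrix.of fun i j => 2 * Complex.I * f i j τ)
      hF (fun i j => (hf i j).const_smul (2 * Complex.I)) hd (fun θ => by rw [hGg]; exact hb θ)
      (fun φ => ?_) ?_ θ
    · ext i j
      rw [Matrix.of_apply, hfb i j _ (expI_mem_sphere φ), hdz, Matrix.mul_smul, Matrix.smul_apply,
        smul_eq_mul]
      have := Complex.I_sq
      linear_combination (-((G₁ (expI φ)).map Complex.ofReal * (1 - Complex.I •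
        (Matrix.of (xJacobian h (baseOf (bdry A φ)))).map Complex.ofReal)) i j) * this
    · simp only [expI_zero, hG₁.one, hG, h1]
      ext i j
      simp only [Matrix.of_apply, Matrix.one_apply]
      split_ifs <;> simp

end Transport

/-! ### Derivative at `1` of the conjugate extension of data vanishing near `1` -/

section BoundaryDerivative
open Set Filter Topology MeasureTheory

/-- The Cauchy transform is holomorphic near a point off the support of the density. -/
lemma hasDerivAt_cauchyTransform_of_eq_zero {v : ℝ → ℂ} (hv : Continuous v) {τ : ℂ} {s : ℝ}
    (hs : 0 < s) (h0 : ∀ θ, ‖expI θ - τ‖ < 2 * s → v θ = 0) :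
    HasDerivAt (cauchyTransform v) (cauchyTransformDeriv v τ) τ := by
  have hfar : ∀ σ ∈ Metric.ball τ s, ∀ θ, v θ ≠ 0 → s ≤ ‖expI θ - σ‖ := by
    intro σ hσ θ hθ
    by_contra! hlt
    refine hθ (h0 θ ?_)
    rw [mem_ball_iff_norm] at hσ
    calc ‖expI θ - τ‖ = ‖(expI θ - σ) + (σ - τ)‖ := by ring_nf
      _ ≤ ‖expI θ - σ‖ + ‖σ - τ‖ := norm_add_le _ _
      _ < 2 * s := by linarith
  have hm : ∀ (σ : ℂ) (n : ℕ), Measurable fun θ => v θ * (expI θ / (expI θ - σ) ^ n) := fun σ n =>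
    hv.measurable.mul (continuous_expI.measurable.div
      ((continuous_expI.sub continuous_const).pow n).measurable)
  have hb : ∀ n : ℕ, ∀ σ ∈ Metric.ball τ s, ∀ θ,
      ‖v θ * (expI θ / (expI θ - σ) ^ n)‖ ≤ ‖v θ‖ / s ^ n := by
    intro n σ hσ θ
    by_cases hz : v θ = 0
    · simp [hz]
    have := hfar σ hσ θ hz
    rw [norm_mul, norm_div, norm_expI, norm_pow, div_eq_mul_one_div ‖v θ‖]
    gcongr
  refine HasDerivAt.const_mul _ ?_
  refine (intervalIntegral.hasDerivAt_integral_of_dominated_loc_of_deriv_le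
    (F := fun τ θ => v θ * (expI θ / (expI θ - τ)))
    (F' := fun τ θ => v θ * (expI θ / (expI θ - τ) ^ 2))
    (bound := fun θ => ‖v θ‖ / s ^ 2)
    (Metric.ball_mem_nhds τ hs) ?_ ?_ ?_ ?_ ?_ ?_).2
  · refine .of_forall fun σ => ?_
    simpa using (hm σ 1).aestronglyMeasurable
  · have hi : IntervalIntegrable (fun θ => ‖v θ‖ / s ^ 1) volume (-Real.pi) Real.pi :=
      (hv.norm.div_const _).intervalIntegrable _ _
    have := hi.mono_fun' (hm τ 1).aestronglyMeasurable
      (.of_forall (hb 1 τ (Metric.mem_ball_self hs)))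
    simpa only [pow_one] using this
  · exact (hm τ 2).aestronglyMeasurable
  · exact .of_forall fun θ _ σ hσ => hb 2 σ hσ θ
  · exact (hv.norm.div_const _).intervalIntegrable _ _
  · refine .of_forall fun θ _ σ hσ => ?_
    by_cases hz : v θ = 0
    · simpa [hz] using hasDerivAt_const σ (0 : ℂ)
    have hne : expI θ - σ ≠ 0 := norm_pos_iff.1 (hs.trans_le (hfar σ hσ θ hz))
    have h1 : HasDerivAt (fun σ : ℂ => expI θ - σ) (-1) σ := (hasDerivAt_id σ).const_sub _
    have h2 := ((hasDerivAt_const σ (expI θ)).div h1 hne).const_mul (v θ)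
    simpa using h2

/-- On the circle the conjugate of `ζ` is `1/ζ`, whence `|ζ - 1|² ζ = -(ζ - 1)²`. This makes the
derivative kernel at `1` real and negative; at `ζ = 1` both sides are `0` by the convention for
division. -/
lemma expI_div_sub_one_sq (θ : ℝ) :
    expI θ / (expI θ - 1) ^ 2 = -((‖expI θ - 1‖ ^ 2 : ℝ) : ℂ)⁻¹ := by
  have h : ((‖expI θ - 1‖ ^ 2 : ℝ) : ℂ) * expI θ = -(expI θ - 1) ^ 2 := by
    have h1 : expI θ * (starRingEnd ℂ) (expI θ) = 1 := by
      rw [Complex.mul_conj, Complex.normSq_eq_norm_sq, norm_expI]; simp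
    have h2 : ((‖expI θ - 1‖ ^ 2 : ℝ) : ℂ) = (expI θ - 1) * (starRingEnd ℂ) (expI θ - 1) := by
      rw [Complex.mul_conj, Complex.normSq_eq_norm_sq]
    rw [h2, map_sub, map_one]
    linear_combination (expI θ - 1) * h1
  by_cases h0 : expI θ - 1 = 0
  · simp [h0]
  have hn : ((‖expI θ - 1‖ ^ 2 : ℝ) : ℂ) ≠ 0 := by
    exact_mod_cast pow_ne_zero 2 (norm_ne_zero_iff.2 h0)
  field_simp
  linear_combination h

variable {α K : ℝ}

/-- The derivative at `1` of the holomorphic function with a given imaginary part that vanishes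
near `1`. -/
lemma IsConjBound.hasDerivWithinAt_conjExt (hK : IsConjBound α K) {v : ℝ → ℝ} {C s : ℝ}
    (hv : F2Bound α v C) (hvc : Continuous v) (hs : 0 < s)
    (h0 : ∀ θ, ‖expI θ - 1‖ < 4 * s → v θ = 0) :
    HasDerivWithinAt (conjExt v)
      (-(Complex.I * ((Real.pi⁻¹ * ∫ θ in (-Real.pi)..Real.pi, v θ / ‖expI θ - 1‖ ^ 2 : ℝ) : ℂ)))
      (Metric.closedBall 0 1) 1 := by
  obtain ⟨hf, -, b, hb⟩ := hK.2 v C hv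
  set g : ℂ → ℂ := fun τ => 2 * Complex.I * cauchyTransform (fun θ => (v θ : ℂ)) τ + b with hg
  have hvc' : Continuous fun θ => (v θ : ℂ) := Complex.continuous_ofReal.comp hvc
  have hd : ∀ σ ∈ Metric.ball (1 : ℂ) (2 * s), HasDerivAt g
      (2 * Complex.I * cauchyTransformDeriv (fun θ => (v θ : ℂ)) σ) σ := by
    intro σ hσ
    refine HasDerivAt.add_const _ (HasDerivAt.const_mul _
      (hasDerivAt_cauchyTransform_of_eq_zero hvc' hs fun θ hθ => ?_))
    rw [h0 θ, Complex.ofReal_zero]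
    rw [mem_ball_iff_norm] at hσ
    calc ‖expI θ - 1‖ = ‖(expI θ - σ) + (σ - 1)‖ := by ring_nf
      _ ≤ ‖expI θ - σ‖ + ‖σ - 1‖ := norm_add_le _ _
      _ < 4 * s := by linarith
  -- The Cauchy formula is known only in the open disc. Near `1` its right side is holomorphic
  -- across the circle, so radial limits extend the equality to the closed disc there.
  have heq : ∀ z ∈ Metric.closedBall (0 : ℂ) 1, z ∈ Metric.ball (1 : ℂ) (2 * s) →
      conjExt v z = g z := by
    intro z hz hz1
    have hrad : Tendsto (fun t : ℝ => (t : ℂ) * z) (𝓝[<] 1) (𝓝 z) := by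
      have : Continuous fun t : ℝ => (t : ℂ) * z := by fun_prop
      simpa using (this.tendsto 1).mono_left nhdsWithin_le_nhds
    have hin : ∀ᶠ t : ℝ in 𝓝[<] 1, (t : ℂ) * z ∈ Metric.ball (0 : ℂ) 1 := by
      filter_upwards [Ioo_mem_nhdsLT (show (0 : ℝ) < 1 by norm_num)] with t ht
      rw [mem_ball_zero_iff, norm_mul, Complex.norm_real, Real.norm_of_nonneg ht.1.le]
      have : ‖z‖ ≤ 1 := by simpa using hz
      nlinarith [ht.1, ht.2, norm_nonneg z]
    have t1 : Tendsto (fun t : ℝ => conjExt v ((t : ℂ) * z)) (𝓝[<] 1) (𝓝 (conjExt v z)) := by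
      refine (hf.holo.continuousOn_ball z hz).tendsto.comp
        (tendsto_nhdsWithin_iff.2 ⟨hrad, ?_⟩)
      filter_upwards [hin] with t ht using Metric.ball_subset_closedBall ht
    have t2 : Tendsto (fun t : ℝ => g ((t : ℂ) * z)) (𝓝[<] 1) (𝓝 (g z)) :=
      (hd z hz1).continuousAt.tendsto.comp hrad
    refine tendsto_nhds_unique t1 (t2.congr' ?_)
    filter_upwards [hin] with t ht using (hb ht).symm
  have h1 : (1 : ℂ) ∈ Metric.ball (1 : ℂ) (2 * s) := Metric.mem_ball_self (by linarith)
  -- The constant is `2i · (2π)⁻¹ · (-1) = -i/π`.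
  have hval : 2 * Complex.I * cauchyTransformDeriv (fun θ => (v θ : ℂ)) 1 = -(Complex.I *
      ((Real.pi⁻¹ * ∫ θ in (-Real.pi)..Real.pi, v θ / ‖expI θ - 1‖ ^ 2 : ℝ) : ℂ)) := by
    have e : (∫ θ in (-Real.pi)..Real.pi, (v θ : ℂ) * (expI θ / (expI θ - 1) ^ 2)) =
        ((-∫ θ in (-Real.pi)..Real.pi, v θ / ‖expI θ - 1‖ ^ 2 : ℝ) : ℂ) := by
      rw [← intervalIntegral.integral_neg, ← intervalIntegral.integral_ofReal]
      refine intervalIntegral.integral_congr fun θ _ => ?_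
      simp only [expI_div_sub_one_sq]
      push_cast
      ring
    rw [cauchyTransformDeriv, e]
    push_cast
    ring
  rw [← hval]
  refine ((hd 1 h1).hasDerivWithinAt (s := Metric.closedBall 0 1)).congr_of_eventuallyEq ?_
    (heq 1 (by simp) h1)
  filter_upwards [self_mem_nhdsWithin, mem_nhdsWithin_of_mem_nhds
    (Metric.ball_mem_nhds (1 : ℂ) (show 0 < 2 * s by linarith))] with z hz hz1 using heq z hz hz1

end BoundaryDerivative

/-! ### The nonlinear Bishop equation as a contraction -/

section Bishop
open Set Filter Topology MeasureTheory

universe u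

/-- Hadamard's factor of a `C⁴` map is `C³`, so composition with it is bounded; the remaining
product is linear in `x - y`. -/
lemma F2Bound.exists_comp_sub {V W : Type u} [NormedAddCommGroup V] [NormedSpace ℝ V]
    [FiniteDimensional ℝ V] [NormedAddCommGroup W] [NormedSpace ℝ W] [CompleteSpace W]
    {Φ : V → W} (hΦ : ContDiff ℝ 4 Φ) (α R : ℝ) :
    ∃ C, 0 ≤ C ∧ ∀ (x y : ℝ → V) (D : ℝ), F2Bound α x R → F2Bound α y R →
      F2Bound α (fun θ => x θ - y θ) D → F2Bound α (fun θ => Φ (x θ) - Φ (y θ)) (C * D) := by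
  obtain ⟨Λ, hΛ, hf, -⟩ := ContDiff.exists_factor (n := 3) (Φ := Φ) (by exact_mod_cast hΦ)
  obtain ⟨C, hC, h⟩ := F2Bound.exists_comp (Φ := Λ) (by exact_mod_cast hΛ) α (R + R)
  refine ⟨8 * C, by positivity, fun x y D hx hy hxy => ?_⟩
  simp only [hf]
  exact (h _ (hx.prodMk hy)).clm_apply hxy

lemma F2Bound.exists_comp_of_map_zero {V W : Type u} [NormedAddCommGroup V] [NormedSpace ℝ V]
    [FiniteDimensional ℝ V] [NormedAddCommGroup W] [NormedSpace ℝ W] [CompleteSpace W]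
    {Φ : V → W} (hΦ : ContDiff ℝ 4 Φ) (h0 : Φ 0 = 0) (α : ℝ) :
    ∃ C, 0 ≤ C ∧ ∀ (x : ℝ → V) (D : ℝ), D ≤ 1 → F2Bound α x D →
      F2Bound α (fun θ => Φ (x θ)) (C * D) := by
  obtain ⟨C, hC, h⟩ := F2Bound.exists_comp_sub hΦ α 1
  refine ⟨C, hC, fun x D hD hx => ?_⟩
  have := h x (fun _ => 0) D (hx.mono hD) ((F2Bound.const 0).mono (by simp)) (by simpa using hx)
  simpa [h0] using this

lemma F2Bound.exists_of_contDiff {E : Type*} [NormedAddCommGroup E] [NormedSpace ℝ E] {f : ℝ → E}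
    (hf : ContDiff ℝ 3 f) (hp : Function.Periodic f (2 * Real.pi)) {α : ℝ} (hα : 0 < α)
    (hα1 : α < 1) : ∃ C, F2Bound α f C := by
  have h1 : ContDiff ℝ 2 (deriv f) := ((contDiff_succ_iff_deriv (n := 2)).1 hf).2.2
  have h2 : ContDiff ℝ 1 (deriv (deriv f)) := ((contDiff_succ_iff_deriv (n := 1)).1 h1).2.2
  obtain ⟨C₀, c0⟩ := (hf.of_le (m := 1) (by norm_num)).exists_HB hα hα1
  obtain ⟨C₁, c1⟩ := (contDiff_id.smul (h1.of_le (m := 1) (by norm_num))).exists_HB hα hα1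
  obtain ⟨C₂, c2⟩ := ((contDiff_id.pow 2).smul h2).exists_HB hα hα1
  exact ⟨max C₀ (max C₁ C₂), hp, fun θ _ => hf.differentiable (by norm_num) θ,
    fun θ _ => h1.differentiable (by norm_num) θ, c0.mono (le_max_left _ _),
    c1.mono ((le_max_left _ _).trans (le_max_right _ _)),
    c2.mono ((le_max_right _ _).trans (le_max_right _ _))⟩

variable {d m : ℕ}

/-- `Λ` factors the differences of `h` and is small along pairs of maps of `F^{2,α}` norm `2 N`,
compared with the conjugation constant `K`. -/
structure IsSmallFactor (α K N ε : ℝ) (h : RealCoord d m → Fin d → ℝ)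
    (Λ : RealCoord d m × RealCoord d m → RealCoord d m →L[ℝ] (Fin d → ℝ)) : Prop where
  conj : IsConjBound α K
  pos : 0 < N
  smooth : ContDiff ℝ 4 Λ
  factor : ∀ u v, h u - h v = Λ (u, v) (u - v)
  diag : ∀ u, Λ (u, u) = fderiv ℝ h u
  small : ∀ U V : ℝ → RealCoord d m, F2Bound α U (2 * N) → F2Bound α V (2 * N) →
    F2Bound α (fun θ => Λ (U θ, V θ)) ε
  le_quarter : K * (8 * ε) ≤ 1 / 4
  le_card : K * (d * (8 * ε)) ≤ 1 / (4 * (d + 1))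

/-- `Λ(0, 0) = dh(0) = 0`, so `Λ` along a pair of maps of norm `2N` is `O(N)`; `N` is then chosen
against the conjugation constant. -/
lemma exists_isSmallFactor {α K : ℝ} (hK : IsConjBound α K) {h : RealCoord d m → Fin d → ℝ}
    (hh : ContDiff ℝ 5 h) (h0 : fderiv ℝ h 0 = 0) : ∃ N ε Λ, IsSmallFactor α K N ε h Λ := by
  obtain ⟨Λ, hΛ, hf, hd⟩ := ContDiff.exists_factor (n := 4) (Φ := h) (by exact_mod_cast hh)
  have hΛ' : ContDiff ℝ 4 Λ := by exact_mod_cast hΛ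
  obtain ⟨C, hC, hb⟩ := F2Bound.exists_comp_of_map_zero hΛ'
    (by rw [← Prod.mk_zero_zero, hd, h0]) α
  have hK0 := hK.1
  -- With `N = 1/T` a single choice serves both smallness conditions, through `s = 1` and `s = d` in
  -- `key`. The summand `4` ensures `4N ≤ 1`, the range of the composition bound.
  set T : ℝ := 32 * K * C * (d + 1) * (4 * (d + 1)) + 4 with hT
  have hT4 : 4 ≤ T := le_add_of_nonneg_left (by positivity)
  have hTpos : 0 < T := by linarith
  have key : ∀ s : ℝ, 0 ≤ s → s ≤ d + 1 → K * (s * (8 * (C * (4 * (1 / T))))) ≤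
      1 / (4 * (d + 1)) := by
    intro s hs0 hs
    rw [show K * (s * (8 * (C * (4 * (1 / T))))) = (32 * K * C * s) / T by ring,
      div_le_div_iff₀ hTpos (by positivity), one_mul]
    calc 32 * K * C * s * (4 * (d + 1)) ≤ 32 * K * C * (d + 1) * (4 * (d + 1)) := by gcongr
      _ ≤ T := by linarith
  refine ⟨1 / T, C * (4 * (1 / T)), Λ, hK, by positivity, hΛ', hf, hd, fun U V hU hV => ?_, ?_,
    key d (by positivity) (by linarith)⟩
  · refine hb (fun θ => (U θ, V θ)) _ ?_ ((hU.prodMk hV).mono (le_of_eq (by ring)))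
    rw [mul_one_div, div_le_one hTpos]
    exact hT4
  · have := key 1 zero_le_one (by linarith [show (0 : ℝ) ≤ d by positivity])
    rw [one_mul] at this
    refine this.trans ?_
    rw [div_le_div_iff₀ (by positivity) (by norm_num)]
    linarith [show (0 : ℝ) ≤ d by positivity]

/-- The imaginary part prescribed by the graph `y = h (x, w) + t k (x, w, t)` along `t = η χ`. -/
def graphSide (h : RealCoord d m → Fin d → ℝ) (k : RealCoord d m × ℝ → Fin d → ℝ)
    (w : ℝ → Fin m → ℂ) (χ : ℝ → ℝ) (η : ℝ) (x : ℝ → Fin d → ℝ) (θ : ℝ) : Fin d → ℝ :=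
  h (x θ, w θ) + (η * χ θ) • k ((x θ, w θ), η * χ θ)

variable {α K N ε : ℝ} {h : RealCoord d m → Fin d → ℝ}
  {Λ : RealCoord d m × RealCoord d m → RealCoord d m →L[ℝ] (Fin d → ℝ)}
  {k : RealCoord d m × ℝ → Fin d → ℝ} {w : ℝ → Fin m → ℂ} {χ : ℝ → ℝ}

lemma F2Bound.prodMk_sub_prodMk_right {E F : Type*} [NormedAddCommGroup E] [NormedSpace ℝ E]
    [NormedAddCommGroup F] [NormedSpace ℝ F] {x y : ℝ → E} {D : ℝ} (z : ℝ → F)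
    (hxy : F2Bound α (fun θ => x θ - y θ) D) : F2Bound α (fun θ => (x θ, z θ) - (y θ, z θ)) D := by
  have := hxy.prodMk (F2Bound.const (α := α) (0 : F))
  simpa using this

/-- A bound for the `t`-part of the graph along maps of bounded norm. -/
lemma exists_transverse_bounds (hk : ContDiff ℝ 4 k) {Cχ : ℝ} (hχ : F2Bound α χ Cχ) (R : ℝ) : ∃ C, 0 ≤ C ∧
      (∀ (U : ℝ → RealCoord d m) (η : ℝ), |η| ≤ 1 → F2Bound α U (R) →
        F2Bound α (fun θ => k (U θ, η * χ θ)) C) ∧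
      (∀ (U V : ℝ → RealCoord d m) (η ζ D : ℝ), |η| ≤ 1 → |ζ| ≤ 1 → F2Bound α U (R) →
        F2Bound α V (R) → F2Bound α (fun θ => U θ - V θ) D →
        F2Bound α (fun θ => k (U θ, η * χ θ) - k (V θ, ζ * χ θ)) (C * (D + |η - ζ| * Cχ))) := by
  obtain ⟨C₁, -, h1⟩ := F2Bound.exists_comp (hk.of_le (by norm_num)) α (R + Cχ)
  obtain ⟨C₂, hC₂, h2⟩ := F2Bound.exists_comp_sub hk α (R + Cχ)
  have hηχ : ∀ η : ℝ, |η| ≤ 1 → F2Bound α (fun θ => η * χ θ) Cχ := fun η hη =>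
    (hχ.const_smul η).mono (by nlinarith [hχ.nonneg])
  refine ⟨max C₁ C₂, hC₂.trans (le_max_right _ _), fun U η hη hU =>
    (h1 _ (hU.prodMk (hηχ η hη))).mono (le_max_left _ _),
    fun U V η ζ D hη hζ hU hV hUV => ?_⟩
  have hnn : 0 ≤ D + |η - ζ| * Cχ := by have := hUV.nonneg; have := hχ.nonneg; positivity
  refine (h2 (fun θ => (U θ, η * χ θ)) (fun θ => (V θ, ζ * χ θ)) (D + |η - ζ| * Cχ)
    (hU.prodMk (hηχ η hη)) (hV.prodMk (hηχ ζ hζ)) ?_).mono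
    (mul_le_mul_of_nonneg_right (le_max_right _ _) hnn)
  have := hUV.prodMk (hχ.const_smul (η - ζ))
  simpa [sub_mul] using this

namespace IsSmallFactor

lemma f2Bound_sub (hs : IsSmallFactor α K N ε h Λ) {U V : ℝ → RealCoord d m} {D : ℝ}
    (hU : F2Bound α U (2 * N)) (hV : F2Bound α V (2 * N))
    (hUV : F2Bound α (fun θ => U θ - V θ) D) :
    F2Bound α (fun θ => h (U θ) - h (V θ)) (8 * ε * D) := by
  simp only [hs.factor]
  exact (hs.small U V hU hV).clm_apply hUV

lemma exists_f2Bound_graphSide (hs : IsSmallFactor α K N ε h Λ) (hk : ContDiff ℝ 4 k) {Cχ η : ℝ}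
    (hχ : F2Bound α χ Cχ) (hη : |η| ≤ 1) {x : ℝ → Fin d → ℝ}
    (hx : F2Bound α (fun θ => (x θ, w θ)) (2 * N)) : ∃ B, F2Bound α (graphSide h k w χ η x) B := by
  obtain ⟨C, hC, hb, -⟩ := exists_transverse_bounds hk hχ (2 * N)
  have h0 : F2Bound α (fun _ : ℝ => (0 : RealCoord d m)) (2 * N) :=
    (F2Bound.const _).mono (by simpa using hs.pos.le)
  have h1 := (hs.f2Bound_sub hx h0 (hx.sub h0)).add (F2Bound.const (h 0))
  simp only [sub_add_cancel] at h1
  exact ⟨_, h1.add ((hχ.const_smul η).smul (hb _ η hη hx))⟩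

/-- The Bishop equation is a contraction for small `η`. -/
lemma exists_contraction (hs : IsSmallFactor α K N ε h Λ) (hk : ContDiff ℝ 4 k) {Cχ : ℝ}
    (hχ : F2Bound α χ Cχ) : ∃ η₁, 0 < η₁ ∧ η₁ ≤ 1 ∧ ∀ η ∈ Icc 0 η₁,
      ∀ (w : ℝ → Fin m → ℂ) (x y : ℝ → Fin d → ℝ) (D : ℝ), F2Bound α (fun θ => (x θ, w θ)) (2 * N) →
        F2Bound α (fun θ => (y θ, w θ)) (2 * N) → F2Bound α (fun θ => x θ - y θ) D →
        F2Bound α (fun θ => conjOp (graphSide h k w χ η x) θ - conjOp (graphSide h k w χ η y) θ)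
          (D / 2) := by
  obtain ⟨C, hC, -, hl⟩ := exists_transverse_bounds hk hχ (2 * N)
  have hK0 := hs.conj.1
  have hχ0 := hχ.nonneg
  -- For `η ≤ 1/T` the transverse term has Lipschitz constant at most `1/4` after conjugation.
  -- Together with `1/4` from `h` this yields the contraction factor `1/2`.
  set T : ℝ := K * (8 * Cχ * C) * 4 + 1 with hT
  have hT1 : 1 ≤ T := le_add_of_nonneg_left (by positivity)
  refine ⟨1 / T, by positivity, by rw [div_le_one (by linarith)]; exact hT1,
    fun η hη w x y D hx hy hxy => ?_⟩
  have hη1 : |η| ≤ 1 := by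
    rw [abs_of_nonneg hη.1]
    exact hη.2.trans (by rw [div_le_one (by linarith)]; exact hT1)
  have hD := hxy.nonneg
  have hηχ := hχ.const_smul η
  have hUV := F2Bound.prodMk_sub_prodMk_right w hxy
  obtain ⟨B₁, hB₁⟩ := hs.exists_f2Bound_graphSide hk hχ hη1 hx
  obtain ⟨B₂, hB₂⟩ := hs.exists_f2Bound_graphSide hk hχ hη1 hy
  have h1 := hs.f2Bound_sub hx hy hUV
  have h2 := hl _ _ η η D hη1 hη1 hx hy hUV
  rw [sub_self, abs_zero, zero_mul, add_zero] at h2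
  have h3 := h1.add (hηχ.smul h2)
  have h4 : F2Bound α (fun θ => graphSide h k w χ η x θ - graphSide h k w χ η y θ)
      (8 * ε * D + 8 * (|η| * Cχ) * (C * D)) := by
    refine (congrArg (fun f => F2Bound α f _) (funext fun θ => ?_)).mpr h3
    simp only [graphSide, smul_eq_mul, smul_sub]
    abel
  simp only [← hs.conj.conjOp_sub hB₁ hB₂]
  refine (hs.conj.f2Bound_conjOp h4).mono ?_
  have e1 : η * T ≤ 1 := by
    have := mul_le_mul_of_nonneg_right hη.2 (show 0 ≤ T by linarith)
    rwa [one_div, inv_mul_cancel₀ (by linarith)] at this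
  have e2 : K * (8 * (η * Cχ) * C) ≤ 1 / 4 := by
    have : K * (8 * (η * Cχ) * C) * 4 ≤ η * T := by
      rw [hT]; nlinarith [hη.1]
    linarith
  rw [abs_of_nonneg hη.1]
  nlinarith [mul_le_mul_of_nonneg_right e2 hD, mul_le_mul_of_nonneg_right hs.le_quarter hD]

end IsSmallFactor

end Bishop

/-! ### The family of solutions, its uniqueness and its linearization -/

section BishopFamily
open Set Filter Topology MeasureTheory

variable {d m : ℕ} {α K N ε : ℝ} {h : RealCoord d m → Fin d → ℝ}
  {Λ : RealCoord d m × RealCoord d m → RealCoord d m →L[ℝ] (Fin d → ℝ)}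
  {k : RealCoord d m × ℝ → Fin d → ℝ} {w : ℝ → Fin m → ℂ} {χ : ℝ → ℝ}

lemma fderiv_prodMk_zero (h : RealCoord d m → Fin d → ℝ) (u : RealCoord d m) (y : Fin d → ℝ) :
    fderiv ℝ h u (y, 0) = fun i => ∑ j, xJacobian h u i j * y j := by
  have e : (y, (0 : Fin m → ℂ)) = ∑ j, y j • (Pi.single j (1 : ℝ), (0 : Fin m → ℂ)) := by
    refine Prod.ext ?_ ?_
    · rw [Prod.fst_sum]
      funext i
      simp [Finset.sum_apply, Pi.single_apply]
    · rw [Prod.snd_sum]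
      simp
  funext i
  rw [e, map_sum, Finset.sum_apply]
  simp only [map_smul, Pi.smul_apply, smul_eq_mul, xJacobian]
  exact Finset.sum_congr rfl fun j _ => mul_comm _ _

namespace IsSmallFactor

lemma f2Bound_xJacobian (hs : IsSmallFactor α K N ε h Λ) {U : ℝ → RealCoord d m}
    (hU : F2Bound α U (2 * N)) : F2Bound α (fun θ => xJacobian h (U θ)) ε := by
  have h1 := hs.small U U hU hU
  simp only [hs.diag] at h1
  refine F2Bound.pi h1.nonneg fun i => F2Bound.pi h1.nonneg fun j => ?_
  have hn : ‖((Pi.single j 1, 0) : RealCoord d m)‖ ≤ 1 := by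
    rw [Prod.norm_def]
    refine max_le ((pi_norm_le_iff_of_nonneg zero_le_one).2 fun l => ?_) (by simp)
    change ‖(Pi.single j 1 : Fin d → ℝ) l‖ ≤ 1
    rw [Pi.single_apply]
    split_ifs <;> simp
  have h2 := h1.clm_comp_le (ContinuousLinearMap.apply ℝ (Fin d → ℝ)
    ((Pi.single j 1, 0) : RealCoord d m)) (M := 1)
    (ContinuousLinearMap.opNorm_le_bound _ zero_le_one fun L => by
      refine (L.le_opNorm _).trans ?_
      rw [one_mul]
      exact mul_le_of_le_one_right (norm_nonneg _) hn)
  rw [one_mul] at h2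
  exact h2.apply i

/-- The family of solutions of the Bishop equation, and its uniqueness. -/
lemma exists_family (hs : IsSmallFactor α K N ε h Λ) (hk : ContDiff ℝ 4 k) {Cχ : ℝ}
    (hχ : F2Bound α χ Cχ) {x₀ : ℝ → Fin d → ℝ} (hx₀ : F2Bound α (fun θ => (x₀ θ, w θ)) N)
    (heq : ∀ θ, x₀ θ = conjOp (fun θ => h (x₀ θ, w θ)) θ) :
    ∃ (η₀ M : ℝ) (X : ℝ → ℝ → Fin d → ℝ), 0 < η₀ ∧ η₀ ≤ 1 ∧ 0 ≤ M ∧ ∀ η ∈ Icc 0 η₀,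
      (∀ θ, X η θ = conjOp (graphSide h k w χ η (X η)) θ) ∧
      F2Bound α (fun θ => X η θ - x₀ θ) (M * η) ∧ F2Bound α (fun θ => (X η θ, w θ)) (2 * N) ∧
      ∀ y : ℝ → Fin d → ℝ, F2Bound α (fun θ => (y θ, w θ)) (2 * N) →
        (∀ θ, y θ = conjOp (graphSide h k w χ η y) θ) → y = X η := by
  obtain ⟨η₁, hη₁, hη₁', hc⟩ := hs.exists_contraction hk hχ
  obtain ⟨C, hC, hb, -⟩ := exists_transverse_bounds hk hχ (2 * N)
  have hK0 := hs.conj.1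
  have hχ0 := hχ.nonneg
  have hN := hs.pos
  -- At `x₀` only the transverse term changes the equation, so one step of the iteration moves `x₀`
  -- by at most `K · 8ηCχ · C = Mη/2`, half the radius `Mη`.
  set M : ℝ := 2 * (K * (8 * Cχ * C)) with hM
  have hM0 : 0 ≤ M := by positivity
  have hx₀' : F2Bound α (fun θ => (x₀ θ, w θ)) (2 * N) := hx₀.mono (by linarith)
  obtain ⟨B, hB⟩ := hs.exists_f2Bound_graphSide (η := 0) hk hχ (by simp) hx₀'
  have hB' : F2Bound α (fun θ => h (x₀ θ, w θ)) B := by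
    simpa [graphSide] using (show F2Bound α (fun θ => _) B from hB)
  have hex : ∀ η : ℝ, ∃ x : ℝ → Fin d → ℝ, η ∈ Icc 0 (min η₁ (N / (M + 1))) →
      (∀ θ, x θ = conjOp (graphSide h k w χ η x) θ) ∧
      F2Bound α (fun θ => x θ - x₀ θ) (M * η) ∧ F2Bound α (fun θ => (x θ, w θ)) (2 * N) := by
    intro η
    by_cases hη : η ∈ Icc 0 (min η₁ (N / (M + 1)))
    swap
    · exact ⟨0, fun h => absurd h hη⟩
    have hη1 : |η| ≤ 1 := by
      rw [abs_of_nonneg hη.1]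
      exact (hη.2.trans (min_le_left _ _)).trans hη₁'
    have hMη : M * η ≤ N := by
      have := hη.2.trans (min_le_right _ _)
      rw [le_div_iff₀ (by positivity)] at this
      linarith [hη.1]
    have hclose : ∀ x : ℝ → Fin d → ℝ, F2Bound α (fun θ => x θ - x₀ θ) (M * η) →
        F2Bound α (fun θ => (x θ, w θ)) (2 * N) := by
      intro x hx
      have := (F2Bound.prodMk_sub_prodMk_right w hx).add hx₀
      simp only [sub_add_cancel] at this
      exact this.mono (by linarith)
    obtain ⟨B', hB₁⟩ := hs.exists_f2Bound_graphSide hk hχ hη1 hx₀'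
    obtain ⟨x, hx, hxr⟩ := F2Bound.exists_fixedPoint (α := α) (r := M * η) (x₀ := x₀)
      (Ψ := fun x => conjOp (graphSide h k w χ η x)) hx₀.fst
      (fun x y hx hy D hxy => hc η ⟨hη.1, hη.2.trans (min_le_left _ _)⟩ w x y D (hclose x hx)
        (hclose y hy) hxy) (by
        have h1 : F2Bound α (fun θ => graphSide h k w χ η x₀ θ - h (x₀ θ, w θ))
            (8 * (|η| * Cχ) * C) := by
          simpa only [graphSide, add_sub_cancel_left, smul_eq_mul] using
            (hχ.const_smul η).smul (hb _ η hη1 hx₀')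
        have h2 : (fun θ => conjOp (graphSide h k w χ η x₀) θ - x₀ θ) =
            conjOp (fun θ => graphSide h k w χ η x₀ θ - h (x₀ θ, w θ)) := funext fun θ => by
          rw [hs.conj.conjOp_sub hB₁ hB', ← heq]
        rw [h2]
        refine (hs.conj.f2Bound_conjOp h1).mono (le_of_eq ?_)
        rw [abs_of_nonneg hη.1, hM]
        ring)
    exact ⟨x, fun _ => ⟨fun θ => (congrFun hx θ).symm, hxr, hclose x hxr⟩⟩
  choose X hX using hex
  refine ⟨min η₁ (N / (M + 1)), M, X, lt_min hη₁ (by positivity), (min_le_left _ _).trans hη₁', hM0,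
    fun η hη => ⟨(hX η hη).1, (hX η hη).2.1, (hX η hη).2.2, fun y hy hye => ?_⟩⟩
  obtain ⟨hXe, -, hXb⟩ := hX η hη
  -- Two solutions have a difference whose bound may be halved indefinitely, so the difference is
  -- zero.
  have hz := F2Bound.of_half (D := 0) (hy.fst.sub hXb.fst) fun D hD => by
    have := hc η ⟨hη.1, hη.2.trans (min_le_left _ _)⟩ w y (X η) D hy hXb hD
    simp only [← hXe, ← hye] at this
    simpa using this
  rw [mul_zero] at hz
  exact funext fun θ => sub_eq_zero.1 (hz.eq_zero θ)

/-- The solution of the linearized Bishop equation. -/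
lemma exists_linearization (hs : IsSmallFactor α K N ε h Λ) {x₀ : ℝ → Fin d → ℝ}
    (hx₀ : F2Bound α (fun θ => (x₀ θ, w θ)) (2 * N)) {b : ℝ → Fin d → ℝ} {B : ℝ}
    (hb : F2Bound α b B) :
    ∃ (y v : ℝ → Fin d → ℝ) (C : ℝ), F2Bound α v C ∧ (∀ θ, y θ = conjOp v θ) ∧
      ∀ θ, v θ = fderiv ℝ h (x₀ θ, w θ) (y θ, 0) + b θ := by
  have ha := hs.f2Bound_xJacobian hx₀
  have hKb := hs.conj.f2Bound_conjOp hb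
  -- Solving `y = T b + T(ay)` and setting `v = ay + b` gives `y = T v`.
  obtain ⟨y, hy, hyb⟩ := hs.conj.exists_linear_solution ha hKb (by
    rw [Fintype.card_fin]
    refine hs.le_card.trans ?_
    have : (0 : ℝ) ≤ d := by positivity
    rw [div_le_div_iff₀ (by positivity) (by norm_num)]
    linarith)
  have hyb' := hyb.add hKb
  simp only [sub_add_cancel] at hyb'
  have hv := (ha.mulVec hyb').add hb
  refine ⟨y, fun θ => fderiv ℝ h (x₀ θ, w θ) (y θ, 0) + b θ, _,
    by simpa only [fderiv_prodMk_zero] using hv, fun θ => ?_, fun θ => rfl⟩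
  have h1 := hs.conj.conjOp_sub hv hb θ
  simp only [add_sub_cancel_right] at h1
  rw [hy θ, h1]
  simp only [fderiv_prodMk_zero]
  abel

/-- The family of solutions is differentiable at `η = 0`. -/
lemma exists_f2Bound_difference_quotient (hs : IsSmallFactor α K N ε h Λ) (hk : ContDiff ℝ 4 k)
    {Cχ η₀ M : ℝ} (hχ : F2Bound α χ Cχ) {x₀ : ℝ → Fin d → ℝ} {X : ℝ → ℝ → Fin d → ℝ}
    (hη₀ : η₀ ≤ 1) (hM : 0 ≤ M) (hx₀ : F2Bound α (fun θ => (x₀ θ, w θ)) (2 * N))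
    (heq : ∀ θ, x₀ θ = conjOp (fun θ => h (x₀ θ, w θ)) θ)
    (hX : ∀ η ∈ Icc 0 η₀, (∀ θ, X η θ = conjOp (graphSide h k w χ η (X η)) θ) ∧
      F2Bound α (fun θ => X η θ - x₀ θ) (M * η) ∧ F2Bound α (fun θ => (X η θ, w θ)) (2 * N))
    {y v : ℝ → Fin d → ℝ} {C : ℝ} (hv : F2Bound α v C) (hy : ∀ θ, y θ = conjOp v θ)
    (hvy : ∀ θ, v θ = fderiv ℝ h (x₀ θ, w θ) (y θ, 0) + χ θ • k ((x₀ θ, w θ), 0)) :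
    ∃ B, 0 ≤ B ∧ ∀ η ∈ Ioc 0 η₀, F2Bound α (fun θ =>
      η⁻¹ • (graphSide h k w χ η (X η) θ - h (x₀ θ, w θ)) - v θ) (B * η) := by
  obtain ⟨C₁, hC₁, hb, hl⟩ := exists_transverse_bounds hk hχ (2 * N)
  obtain ⟨C₂, hC₂, hΛ⟩ := F2Bound.exists_comp_sub hs.smooth α (2 * N + 2 * N)
  have hχ0 := hχ.nonneg
  have hK0 := hs.conj.1
  obtain ⟨B₀, hB₀⟩ := hs.exists_f2Bound_graphSide (η := 0) hk hχ (by simp) hx₀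
  have hB₀' : F2Bound α (fun θ => h (x₀ θ, w θ)) B₀ := by
    simpa [graphSide] using (show F2Bound α (fun θ => _) B₀ from hB₀)
  refine ⟨2 * (8 * (C₂ * M) * M + 8 * Cχ * (C₁ * (M + Cχ))), by positivity, fun η hη => ?_⟩
  have hη' : η ∈ Icc 0 η₀ := ⟨hη.1.le, hη.2⟩
  have hη1 : |η| ≤ 1 := by rw [abs_of_pos hη.1]; exact hη.2.trans hη₀
  obtain ⟨hXe, hXd, hXb⟩ := hX η hη'
  obtain ⟨B₁, hB₁⟩ := hs.exists_f2Bound_graphSide hk hχ hη1 hXb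
  have hq := (hB₁.sub hB₀').const_smul η⁻¹
  -- The error is measured on the imaginary parts; `conjOp` turns it into the error of the real
  -- parts, and `conjExtPi` later gives that of the whole disc.
  set e : ℝ → Fin d → ℝ := fun θ =>
    η⁻¹ • (graphSide h k w χ η (X η) θ - h (x₀ θ, w θ)) - v θ with he
  have he0 : F2Bound α e _ := hq.sub hv
  have hconj : ∀ θ, conjOp e θ = η⁻¹ • (X η θ - x₀ θ) - y θ := by
    intro θ
    rw [he, hs.conj.conjOp_sub hq hv, ← hy]
    congr 1
    have h1 : conjOp (fun θ => η⁻¹ • (graphSide h k w χ η (X η) θ - h (x₀ θ, w θ))) θ =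
        η⁻¹ • conjOp (fun θ => graphSide h k w χ η (X η) θ - h (x₀ θ, w θ)) θ := by
      have := hs.conj.conjExtPi_smul (hB₁.sub hB₀') η⁻¹ (expI_mem_closedBall θ)
      funext i
      simp [conjOp, this]
    rw [h1, hs.conj.conjOp_sub hB₁ hB₀', ← hXe, ← heq]
  have hdiff : F2Bound α (fun θ => (X η θ, w θ) - (x₀ θ, w θ)) (M * η) :=
    F2Bound.prodMk_sub_prodMk_right w hXd
  have hquot : F2Bound α (fun θ => η⁻¹ • ((X η θ, w θ) - (x₀ θ, w θ))) M := by
    refine (hdiff.const_smul η⁻¹).mono (le_of_eq ?_)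
    rw [abs_of_pos (inv_pos.2 hη.1)]
    field_simp [hη.1.ne']
  have hΛd : F2Bound α (fun θ => Λ ((X η θ, w θ), (x₀ θ, w θ)) - Λ ((x₀ θ, w θ), (x₀ θ, w θ)))
      (C₂ * (M * η)) := by
    refine hΛ (fun θ => ((X η θ, w θ), (x₀ θ, w θ))) (fun θ => ((x₀ θ, w θ), (x₀ θ, w θ))) _
      (hXb.prodMk hx₀) (hx₀.prodMk hx₀) ?_
    exact F2Bound.prodMk_sub_prodMk_right (fun θ => (x₀ θ, w θ)) hdiff
  have hkd := hl _ _ η 0 _ hη1 (by simp) hXb hx₀ hdiff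
  have hrest := (hΛd.clm_apply hquot).add (hχ.smul hkd)
  -- The error solves the linearized equation up to a remainder: `e = h_x · T e + O(η)`. The first
  -- term is at most half of any bound for `e`, so `F2Bound.of_half` leaves only the remainder.
  have hsplit : ∀ θ, e θ = Λ ((x₀ θ, w θ), (x₀ θ, w θ)) (conjOp e θ, 0) +
      ((Λ ((X η θ, w θ), (x₀ θ, w θ)) - Λ ((x₀ θ, w θ), (x₀ θ, w θ)))
        (η⁻¹ • ((X η θ, w θ) - (x₀ θ, w θ))) +
      χ θ • (k ((X η θ, w θ), η * χ θ) - k ((x₀ θ, w θ), 0 * χ θ))) := by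
    intro θ
    have h1 : ((conjOp e θ, 0) : RealCoord d m) =
        η⁻¹ • ((X η θ, w θ) - (x₀ θ, w θ)) - (y θ, 0) := by
      rw [hconj]
      simp
    have h2 := hs.factor (X η θ, w θ) (x₀ θ, w θ)
    have h3 : η⁻¹ • (graphSide h k w χ η (X η) θ - h (x₀ θ, w θ)) =
        Λ ((X η θ, w θ), (x₀ θ, w θ)) (η⁻¹ • ((X η θ, w θ) - (x₀ θ, w θ))) +
          χ θ • k ((X η θ, w θ), η * χ θ) := by
      rw [graphSide, add_sub_right_comm, h2, smul_add, map_smul, smul_smul, ← mul_assoc,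
        inv_mul_cancel₀ hη.1.ne', one_mul]
    simp only [he]
    rw [h3, hvy θ, h1, map_sub, hs.diag, sub_apply, zero_mul, smul_sub (χ θ)]
    abel
  have hfin := F2Bound.of_half he0 (D := 8 * (C₂ * (M * η)) * M +
      8 * Cχ * (C₁ * (M * η + |η - 0| * Cχ))) fun D hD => by
    have h1 := (hs.conj.f2Bound_conjOp hD).prodMk (F2Bound.const (α := α) (0 : Fin m → ℂ))
    rw [norm_zero, add_zero] at h1
    have h2 := ((hs.small _ _ hx₀ hx₀).clm_apply h1).add hrest
    have h3 := (congrArg (fun f => F2Bound α f _) (funext hsplit)).mpr h2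
    refine h3.mono (add_le_add_left ?_ _)
    have := mul_le_mul_of_nonneg_right hs.le_quarter hD.nonneg
    have := hD.nonneg
    linarith
  refine hfin.mono (le_of_eq ?_)
  rw [sub_zero, abs_of_pos hη.1]
  ring

end IsSmallFactor

end BishopFamily

/-! ### The deformed discs -/

section Deformation
open Set Filter Topology MeasureTheory
open scoped NNReal ENNReal

variable {d m : ℕ}

/-- Factoring out `t` leaves `κ`, defined and `C⁴` for all `t`, whose value at `t = 0` is the
one-sided derivative. -/
lemma IsExtension.exists_transverse {k : ℕ} (hk : 2 < k) {h : RealCoord d m → Fin d → ℝ}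
    {H : RealCoord d m × ℝ → Fin d → ℝ} (hH : IsExtension k h H) :
    ∃ κ : RealCoord d m × ℝ → Fin d → ℝ, ContDiff ℝ 4 κ ∧
      (∀ p t, 0 ≤ t → H (p, t) = h p + t • κ (p, t)) ∧ ∀ q, tDeriv H q = κ (baseOf q, 0) := by
  have hH5 : ContDiffOn ℝ ((4 + 1 : ℕ) : WithTop ℕ∞) H (univ ×ˢ Ici 0) :=
    hH.smooth.of_le (by exact_mod_cast (by omega : 4 + 1 ≤ k + 2))
  obtain ⟨κ, hκ, hHκ⟩ := hH5.exists_eq_add_smul_halfSpace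
  have hκ4 : ContDiff ℝ 4 κ := by exact_mod_cast hκ
  simp only [hH.zero] at hHκ
  refine ⟨κ, hκ4, hHκ, fun q => ?_⟩
  have hd : DifferentiableAt ℝ (fun t : ℝ => κ (baseOf q, t)) 0 :=
    (hκ4.differentiable (by norm_num) _).comp (0 : ℝ) (by fun_prop)
  have h1 := ((hasDerivAt_id (0 : ℝ)).smul hd.hasDerivAt).const_add (h (baseOf q))
  have h2 : HasDerivWithinAt (fun t : ℝ => H (baseOf q, t)) (κ (baseOf q, 0)) (Ici 0) 0 := by
    refine HasDerivWithinAt.congr (f := fun t => h (baseOf q) + t • κ (baseOf q, t)) ?_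
      (fun t ht => hHκ _ t ht) (hHκ _ 0 le_rfl)
    simpa using h1.hasDerivWithinAt
  exact h2.derivWithin (uniqueDiffWithinAt_Ici 0)

lemma F2Bound.baseOf {α : ℝ} {f : ℝ → Ambient d m} {C : ℝ} (hf : F2Bound α f C) :
    F2Bound α (fun θ => baseOf (f θ)) C := by
  have h := hf.clm_comp_le (baseCLM d m) (M := 1)
    (ContinuousLinearMap.opNorm_le_bound _ zero_le_one fun p => by
      rw [one_mul, baseCLM_apply, Prod.norm_def, Prod.norm_def]
      refine max_le_max ((pi_norm_le_iff_of_nonneg (norm_nonneg _)).2 fun j => ?_) le_rfl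
      exact (Complex.abs_re_le_norm _).trans (norm_le_pi_norm p.1 j))
  rw [one_mul] at h
  exact h

lemma DiffContOnCl.pair {E F : Type*} [NormedAddCommGroup E] [NormedSpace ℂ E]
    [NormedAddCommGroup F] [NormedSpace ℂ F] {f : ℂ → E} {g : ℂ → F} {s : Set ℂ}
    (hf : DiffContOnCl ℂ f s) (hg : DiffContOnCl ℂ g s) : DiffContOnCl ℂ (fun τ => (f τ, g τ)) s :=
  ⟨hf.differentiableOn.prodMk hg.differentiableOn, hf.continuousOn.prodMk hg.continuousOn⟩

/-- A disc through `0` is recovered from the imaginary part of its boundary values. -/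
lemma IsConjBound.disc_eq {α K : ℝ} (hK : IsConjBound α K) {B : ℂ → Ambient d m} {C : ℝ}
    (hB : DiffContOnCl ℂ B (Metric.ball 0 1)) (hBC : F2Bound α (bdry B) C) (h1 : B 1 = 0)
    {v : ℝ → Fin d → ℝ} (hv : ∀ θ j, ((B (expI θ)).1 j).im = v θ j) :
    F2Bound α v C ∧ (∀ τ ∈ Metric.closedBall (0 : ℂ) 1, (B τ).1 = conjExtPi v τ) ∧
      ∀ θ, (baseOf (bdry B θ)).1 = conjOp v θ := by
  have hvC : F2Bound α v C := by
    refine F2Bound.pi hBC.nonneg fun j => ?_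
    have h2 := (hBC.fst.apply j).clm_comp_le Complex.imCLM (M := 1) (by simp)
    rw [one_mul] at h2
    exact (congrArg (fun f => F2Bound α f C) (funext fun θ => hv θ j)).mp h2
  have he : ∀ τ ∈ Metric.closedBall (0 : ℂ) 1, (B τ).1 = conjExtPi v τ := fun τ hτ =>
    hK.eq_conjExtPi (f := fun τ => (B τ).1) hvC
      ⟨hB.differentiableOn.fst, hB.continuousOn.fst⟩ (by simp [h1]) hv hτ
  refine ⟨hvC, he, fun θ => funext fun j => ?_⟩
  rw [conjOp, ← he _ (expI_mem_closedBall θ)]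
  rfl

/-- Existence, uniqueness and differentiability of the deformed discs. -/
lemma IsSmallFactor.exists_deformation {α : ℝ≥0} (hα : 0 < α) (hα1 : α < 1) {K N ε δ : ℝ}
    {h : RealCoord d m → Fin d → ℝ}
    {Λ : RealCoord d m × RealCoord d m → RealCoord d m →L[ℝ] (Fin d → ℝ)}
    (hs : IsSmallFactor α K N ε h Λ) (h0 : h 0 = 0) (hδ : 0 < δ) (hδN : (1 + 2 / α) * δ ≤ N)
    {A : ℂ → Ambient d m} (hA : IsF2Disc α A) (hAδ : f2Norm α A < ENNReal.ofReal δ)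
    (hAh : AttachedTo h A) (hA1 : A 1 = 0)
    {H : RealCoord d m × ℝ → Fin d → ℝ} {κ : RealCoord d m × ℝ → Fin d → ℝ}
    (hκ : ContDiff ℝ 4 κ) (hH : ∀ p t, 0 ≤ t → H (p, t) = h p + t • κ (p, t))
    {χ : ℂ → ℝ} {Cχ : ℝ} (hχ : F2Bound α (bdry χ) Cχ)
    (hχ0 : ∀ τ ∈ Metric.sphere (0 : ℂ) 1, 0 ≤ χ τ) (hχ1 : χ 1 = 0) :
    ∃ (η₀ : ℝ) (D : ℝ → ℂ → Ambient d m) (y v : ℝ → Fin d → ℝ) (C : ℝ),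
      0 < η₀ ∧ Set.EqOn (D 0) A (Metric.closedBall 0 1) ∧
      (∀ η ∈ Set.Icc 0 η₀, IsDeformed α H A χ η (D η) ∧ f2Norm α (D η) < ENNReal.ofReal δ ∧
        ∀ B : ℂ → Ambient d m, IsDeformed α H A χ η B → f2Norm α B < ENNReal.ofReal δ →
          Set.EqOn B (D η) (Metric.closedBall 0 1)) ∧
      IsF2Disc α (fun τ => ((conjExtPi v τ, 0) : Ambient d m)) ∧
      Filter.Tendsto (fun η : ℝ => f2Norm α
        (fun τ => η⁻¹ • (D η τ - A τ) - ((conjExtPi v τ, 0) : Ambient d m))) (𝓝[>] 0) (𝓝 0) ∧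
      F2Bound α v C ∧ (∀ θ, y θ = conjOp v θ) ∧
      ∀ θ, v θ = fderiv ℝ h (baseOf (bdry A θ)) (y θ, 0) +
        bdry χ θ • κ (baseOf (bdry A θ), 0) := by
  have hK := hs.conj
  have hbd : ∀ B : ℂ → Ambient d m, MemF2 α B → f2Norm α B < ENNReal.ofReal δ →
      F2Bound α (bdry B) N := fun B hB hBδ =>
    (hB.f2Bound hα hα1 hδ.le hBδ.le).mono hδN
  have hAN := hbd A hA.mem hAδ
  set x₀ : ℝ → Fin d → ℝ := fun θ => (baseOf (bdry A θ)).1 with hx₀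
  set w : ℝ → Fin m → ℂ := fun θ => (bdry A θ).2 with hw
  have hχp : ∀ θ, 0 ≤ bdry χ θ := fun θ => hχ0 _ (expI_mem_sphere θ)
  have hχz : bdry χ 0 = 0 := by
    have : bdry χ 0 = χ (expI 0) := rfl
    rw [this, expI_zero, hχ1]
  have hHg : ∀ η, 0 ≤ η → ∀ (x : ℝ → Fin d → ℝ) θ,
      H ((x θ, w θ), η * bdry χ θ) = graphSide h κ w (bdry χ) η x θ := fun η hη x θ =>
    hH _ _ (mul_nonneg hη (hχp θ))
  obtain ⟨hv₀, hA', hx₀'⟩ := hK.disc_eq (v := fun θ => h (x₀ θ, w θ)) hA.holo hAN hA1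
    fun θ j => hAh _ (expI_mem_sphere θ) j
  have hx₀b : F2Bound α (fun θ => (x₀ θ, w θ)) N := hAN.baseOf
  have hx₀b2 : F2Bound α (fun θ => (x₀ θ, w θ)) (2 * N) := hx₀b.mono (by linarith [hs.pos])
  obtain ⟨η₁, M, X, hη₁, hη₁1, hM, hX⟩ := hs.exists_family hκ hχ hx₀b hx₀'
  obtain ⟨Cκ, -, hκb, -⟩ := exists_transverse_bounds hκ hχ (2 * N)
  have hb : F2Bound α (fun θ => bdry χ θ • κ ((x₀ θ, w θ), 0)) (8 * Cχ * Cκ) := by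
    have := hκb _ 0 (by simp) hx₀b2
    simp only [zero_mul] at this
    exact hχ.smul this
  obtain ⟨y, v, C, hv, hy, hvy⟩ := hs.exists_linearization hx₀b2 hb
  obtain ⟨M', hM', hq⟩ := hs.exists_f2Bound_difference_quotient hκ hχ hη₁1 hM hx₀b2 hx₀'
    (fun η hη => ⟨(hX η hη).1, (hX η hη).2.1, (hX η hη).2.2.1⟩) hv hy hvy
  set W : ℝ → ℝ → Fin d → ℝ := fun η => graphSide h κ w (bdry χ) η (X η) with hW
  set D : ℝ → ℂ → Ambient d m := fun η τ => (conjExtPi (W η) τ, (A τ).2) with hD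
  have hη1 : ∀ η ∈ Icc 0 η₁, |η| ≤ 1 := fun η hη => by
    rw [abs_of_nonneg hη.1]; exact hη.2.trans hη₁1
  have hWb : ∀ η ∈ Icc 0 η₁, ∃ B, F2Bound α (W η) B := fun η hη =>
    hs.exists_f2Bound_graphSide hκ hχ (hη1 η hη) (hX η hη).2.2.1
  -- At `1` the quantities `X η`, `w`, `χ` and `h(0)` all vanish, so the deformed disc still passes
  -- through `0`.
  have hW0 : ∀ η ∈ Icc 0 η₁, W η 0 = 0 := by
    intro η hη
    obtain ⟨B, hB⟩ := hWb η hη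
    have e1 : X η 0 = 0 := by rw [(hX η hη).1, hK.conjOp_zero hB]
    have e2 : w 0 = 0 := by
      have : w 0 = (A (expI 0)).2 := rfl
      rw [this, expI_zero, hA1]; rfl
    have e3 : h (0, 0) = 0 := h0
    simp [hW, graphSide, e1, e2, hχz, e3]
  have hX0 : X 0 = x₀ := by
    have h1 := (hX 0 ⟨le_rfl, hη₁.le⟩).2.1
    rw [mul_zero] at h1
    exact funext fun θ => sub_eq_zero.1 (h1.eq_zero θ)
  have hW00 : W 0 = fun θ => h (x₀ θ, w θ) := by
    funext θ
    simp [hW, graphSide, hX0]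
  have hD0 : EqOn (D 0) A (Metric.closedBall 0 1) := fun τ hτ =>
    Prod.ext (by rw [hA' τ hτ, ← hW00]) rfl
  have hDbase : ∀ η ∈ Icc 0 η₁, ∀ θ, baseOf (D η (expI θ)) = (X η θ, w θ) := by
    intro η hη θ
    refine Prod.ext ?_ rfl
    rw [(hX η hη).1 θ]
    rfl
  have hdisc : ∀ η ∈ Icc 0 η₁, IsDeformed α H A χ η (D η) := by
    intro η hη
    obtain ⟨B, hB⟩ := hWb η hη
    refine ⟨⟨(hK.diffContOnCl hB).pair ⟨hA.holo.differentiableOn.snd,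
      hA.holo.continuousOn.snd⟩, F2Bound.memF2 hα ((hK.f2Bound_ext hB).prodMk hAN.snd)⟩,
      fun τ _ => rfl, Prod.ext (hK.conjExtPi_one hB (hW0 η hη)) (by simp [hD, hA1]),
      fun τ hτ j => ?_⟩
    obtain ⟨θ, rfl⟩ := expI_surj_sphere hτ
    rw [hDbase η hη, show χ (expI θ) = bdry χ θ from rfl, hHg η hη.1]
    exact (hK.isConjExt hB j).im_bdry θ
  have hdiff : ∀ η ∈ Ioc 0 η₁, F2Bound α (bdry fun τ => η⁻¹ • (D η τ - A τ) -
      ((conjExtPi v τ, 0) : Ambient d m)) (K * (M' * η)) := by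
    intro η hη
    obtain ⟨B, hB⟩ := hWb η ⟨hη.1.le, hη.2⟩
    have h1 := (hK.f2Bound_ext (hq η hη)).prodMk (F2Bound.const (α := α) (0 : Fin m → ℂ))
    rw [norm_zero, add_zero] at h1
    refine (congrArg (fun f => F2Bound α f _) (funext fun θ => ?_)).mp h1
    have hθ := expI_mem_closedBall θ
    rw [hK.conjExtPi_sub ((hB.sub hv₀).const_smul η⁻¹) hv hθ,
      hK.conjExtPi_smul (hB.sub hv₀) _ hθ, hK.conjExtPi_sub hB hv₀ hθ, ← hA' _ hθ]
    refine Prod.ext rfl ?_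
    change (0 : Fin m → ℂ) = η⁻¹ • ((A (expI θ)).2 - (A (expI θ)).2) - 0
    simp
  have hdot : F2Bound α (bdry fun τ => ((conjExtPi v τ, 0) : Ambient d m)) (K * C + 0) := by
    have := (hK.f2Bound_ext hv).prodMk (F2Bound.const (α := α) (0 : Fin m → ℂ))
    rwa [norm_zero] at this
  have hK0 := hK.1
  have hC0 := hv.nonneg
  have hclose : ∀ η ∈ Icc 0 η₁, F2Bound α (bdry fun τ => D η τ - A τ)
      (η * (K * (M' * η) + (K * C + 0))) := by
    intro η hη
    rcases hη.1.eq_or_lt with rfl | hpos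
    · rw [zero_mul]
      have h1 := F2Bound.const (α := α) (0 : Ambient d m)
      rw [norm_zero] at h1
      refine (congrArg (fun f => F2Bound α f _) (funext fun θ => ?_)).mp h1
      exact (sub_eq_zero.2 (hD0 (expI_mem_closedBall θ))).symm
    · have h1 := ((hdiff η ⟨hpos, hη.2⟩).add hdot).const_smul η
      rw [abs_of_pos hpos] at h1
      refine (congrArg (fun f => F2Bound α f _) (funext fun θ => ?_)).mp h1
      simp only [bdry, sub_add_cancel, smul_smul, mul_inv_cancel₀ hpos.ne', one_smul]
  -- The contraction controls the discs only up to `2N`. To keep the norm below `δ`, the room left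
  -- by the strict inequality for `A` is used, since `D η - A` is `O(η)`.
  set gap : ℝ := δ - (f2Norm α A).toReal with hgap
  have hAtop : f2Norm α A ≠ ⊤ := hA.mem.finite.ne
  have hgap0 : 0 < gap := by
    have := (ENNReal.lt_ofReal_iff_toReal_lt hAtop).1 hAδ
    linarith
  set T : ℝ := 5 * (K * M' + K * C) + 1 with hT
  have hT0 : 1 ≤ T := le_add_of_nonneg_left (by positivity)
  refine ⟨min η₁ (gap / T), D, y, v, C, lt_min hη₁ (by positivity), hD0,
    fun η hη => ⟨hdisc η ⟨hη.1, hη.2.trans (min_le_left _ _)⟩, ?_, fun B hB hBδ => ?_⟩,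
    ⟨(hK.diffContOnCl hv).pair diffContOnCl_const, F2Bound.memF2 hα hdot⟩, ?_, hv, hy, hvy⟩
  · have hη' : η ∈ Icc 0 η₁ := ⟨hη.1, hη.2.trans (min_le_left _ _)⟩
    have h1 := hclose η hη'
    have h2 := f2Norm_add_le hA.mem (F2Bound.memF2 hα h1)
    simp only [add_sub_cancel] at h2
    have hlt : 5 * (η * (K * (M' * η) + (K * C + 0))) < gap := by
      have e1 : η ≤ 1 := hη'.2.trans hη₁1
      have e2 : η * T ≤ gap := by
        have := hη.2.trans (min_le_right _ _)
        rwa [le_div_iff₀ (by linarith)] at this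
      rcases hη.1.eq_or_lt with rfl | hpos
      · simpa using hgap0
      have e3 : K * (M' * η) ≤ K * M' := by
        rw [← mul_assoc]; exact mul_le_of_le_one_right (by positivity) e1
      rw [hT] at e2
      nlinarith [mul_le_mul_of_nonneg_left e3 hpos.le]
    calc f2Norm α (D η) ≤ _ := h2
      _ ≤ ENNReal.ofReal (f2Norm α A).toReal +
          ENNReal.ofReal (5 * (η * (K * (M' * η) + (K * C + 0)))) := by
        rw [ENNReal.ofReal_toReal hAtop]
        exact add_le_add_right h1.f2Norm_le _
      _ = ENNReal.ofReal ((f2Norm α A).toReal + 5 * (η * (K * (M' * η) + (K * C + 0)))) := by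
        rw [ENNReal.ofReal_add ENNReal.toReal_nonneg]
        have := h1.nonneg
        positivity
      _ < ENNReal.ofReal δ := by
        rw [ENNReal.ofReal_lt_ofReal_iff hδ]
        linarith
  · have hη' : η ∈ Icc 0 η₁ := ⟨hη.1, hη.2.trans (min_le_left _ _)⟩
    have hBN := hbd B hB.disc.mem hBδ
    set x : ℝ → Fin d → ℝ := fun θ => (baseOf (bdry B θ)).1 with hx
    have hBw : ∀ θ, baseOf (bdry B θ) = (x θ, w θ) := fun θ =>
      Prod.ext rfl (hB.cr _ (expI_mem_closedBall θ))
    -- Norm below `δ` puts a competitor in the ball of the contraction, and its real part solves the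
    -- same Bishop equation; the disc is then recovered from `X η`.
    obtain ⟨-, e1, e2⟩ := hK.disc_eq (v := graphSide h κ w (bdry χ) η x) hB.disc.holo hBN hB.one
      fun θ j => by
        rw [hB.attached _ (expI_mem_sphere θ) j, ← hHg η hη.1, ← hBw]
        rfl
    have hxb : F2Bound α (fun θ => (x θ, w θ)) (2 * N) := by
      have := hBN.baseOf
      simp only [hBw] at this
      exact this.mono (by linarith [hs.pos])
    have hxX : x = X η := (hX η hη').2.2.2 x hxb e2
    intro τ hτ
    refine Prod.ext ?_ (hB.cr τ hτ)
    rw [e1 τ hτ, hxX]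
  · have hlim : Tendsto (fun η : ℝ => ENNReal.ofReal (5 * (K * (M' * η)))) (𝓝[>] 0) (𝓝 0) := by
      have : Continuous fun η : ℝ => ENNReal.ofReal (5 * (K * (M' * η))) :=
        ENNReal.continuous_ofReal.comp (by fun_prop)
      have h1 := this.tendsto 0
      simp only [mul_zero, ENNReal.ofReal_zero] at h1
      exact h1.mono_left nhdsWithin_le_nhds
    refine tendsto_of_tendsto_of_tendsto_of_le_of_le' tendsto_const_nhds hlim
      (.of_forall fun _ => zero_le) ?_
    filter_upwards [Ioc_mem_nhdsGT hη₁] with η hη using (hdiff η hη).f2Norm_le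

end Deformation

/-! ### The derivative of the deformation at the point `1` -/

section Conclusion
open Set Filter Topology MeasureTheory
open scoped NNReal ENNReal

/-- Since `f` vanishes at `x`, the coefficient need only be continuous. This matters because `F⁻¹`
is known only to be continuous at `1`. -/
lemma HasDerivWithinAt.mul_of_eq_zero {c f : ℂ → ℂ} {f' x : ℂ} {s : Set ℂ}
    (hc : ContinuousWithinAt c s x) (hf : HasDerivWithinAt f f' s x) (h0 : f x = 0) :
    HasDerivWithinAt (fun τ => c τ * f τ) (c x * f') s x := by
  rw [hasDerivWithinAt_iff_tendsto_slope] at hf ⊢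
  refine ((hc.mono sdiff_subset).tendsto.mul hf).congr fun τ => ?_
  simp only [slope_def_field, h0, mul_zero, sub_zero]
  ring

variable {d m : ℕ}

/-- The factor `F` turns the linearized equation into an explicit conjugation problem. -/
lemma IsConjBound.hasDerivWithinAt_linearization {α K s : ℝ} (hα : 0 < α) (hK : IsConjBound α K)
    {a g : ℝ → Fin d → Fin d → ℝ} {F : ℂ → Matrix (Fin d) (Fin d) ℂ} {Cg Cb Cv : ℝ}
    (hg : F2Bound α g Cg) (hF : ∀ i j, DiffContOnCl ℂ (fun τ => F τ i j) (Metric.ball 0 1))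
    (hF1 : F 1 = 1)
    (hFb : ∀ θ, F (expI θ) = (Matrix.of (g θ)).map Complex.ofReal *
      (1 - Complex.I • (Matrix.of (a θ)).map Complex.ofReal))
    (hFd : ∀ τ ∈ Metric.closedBall (0 : ℂ) 1, (F τ).det ≠ 0)
    {b y v : ℝ → Fin d → ℝ} (hb : F2Bound α b Cb) (hv : F2Bound α v Cv)
    (hy : ∀ θ, y θ = conjOp v θ) (hvy : ∀ θ i, v θ i = ∑ j, a θ i j * y θ j + b θ i)
    (hs : 0 < s) (hb0 : ∀ θ, ‖expI θ - 1‖ < 4 * s → b θ = 0) :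
    HasDerivWithinAt (conjExtPi v) (fun i => -(Complex.I *
      ((Real.pi⁻¹ * ∫ θ in (-Real.pi)..Real.pi,
        (∑ j, g θ i j * b θ j) / ‖expI θ - 1‖ ^ 2 : ℝ) : ℂ))) (Metric.closedBall 0 1) 1 := by
  have hcl : closure (Metric.ball (0 : ℂ) 1) = Metric.closedBall 0 1 := closure_ball 0 one_ne_zero
  have hbz : b 0 = 0 := hb0 0 (by rw [expI_zero]; simpa using hs)
  set β : ℝ → Fin d → ℝ := fun θ i => ∑ j, g θ i j * b θ j with hβ
  have hβb : F2Bound α β _ := hg.mulVec hb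
  have hβ0 : ∀ θ, ‖expI θ - 1‖ < 4 * s → β θ = 0 := by
    intro θ hθ
    funext i
    simp [hβ, hb0 θ hθ]
  have hy0 : y 0 = 0 := by rw [hy, hK.conjOp_zero hv]
  have hv0 : v 0 = 0 := by
    funext i
    rw [hvy, hy0, hbz]
    simp
  have hz1 := hK.conjExtPi_one hv hv0
  have hzb : ∀ θ i, conjExtPi v (expI θ) i = (y θ i : ℂ) + Complex.I * (v θ i : ℂ) := by
    intro θ i
    have h1 := (hK.isConjExt hv i).im_bdry θ
    have h2 : (conjExtPi v (expI θ) i).re = y θ i := by rw [hy]; rfl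
    apply Complex.ext
    · simp [h2]
    · simp [h1]
  -- On the circle `(1 - ia)(y + iv) = y + av + i(v - ay) = y + av + ib`, and the real matrix `g`
  -- preserves the splitting. So `F(y + iv)` has imaginary part `gb` and vanishes at `1`, which
  -- identifies it.
  have hcomp : ∀ τ ∈ Metric.closedBall (0 : ℂ) 1,
      (F τ).mulVec (conjExtPi v τ) = conjExtPi β τ := by
    intro τ hτ
    refine hK.eq_conjExtPi (f := fun τ => (F τ).mulVec (conjExtPi v τ)) hβb ?_ (by
      rw [hz1, Matrix.mulVec_zero]) (fun θ i => ?_) hτ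
    · have h1 : ∀ i, DiffContOnCl ℂ (fun τ => (F τ).mulVec (conjExtPi v τ) i)
          (Metric.ball 0 1) := fun i => by
        simp only [Matrix.mulVec, dotProduct]
        exact DiffContOnCl.finset_sum _ fun j _ => (hF i j).smul (hK.isConjExt hv j).holo
      exact ⟨differentiableOn_pi.2 fun i => (h1 i).differentiableOn,
        continuousOn_pi.2 fun i => (h1 i).continuousOn⟩
    · have h1 : (1 - Complex.I • (Matrix.of (a θ)).map Complex.ofReal).mulVec
          (conjExtPi v (expI θ)) = fun i =>
            ((y θ i + ∑ j, a θ i j * v θ j : ℝ) : ℂ) + Complex.I * (b θ i : ℂ) := by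
        funext i
        have e1 : ((Matrix.of (a θ)).map Complex.ofReal).mulVec (conjExtPi v (expI θ)) i =
            ((∑ j, a θ i j * y θ j : ℝ) : ℂ) + Complex.I * ((∑ j, a θ i j * v θ j : ℝ) : ℂ) := by
          push_cast
          rw [Finset.mul_sum, ← Finset.sum_add_distrib]
          simp only [Matrix.mulVec, dotProduct]
          refine Finset.sum_congr rfl fun j _ => ?_
          rw [hzb]
          simp only [Matrix.map_apply, Matrix.of_apply]
          ring
        have e2 : (v θ i : ℂ) = ((∑ j, a θ i j * y θ j : ℝ) : ℂ) + (b θ i : ℂ) := by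
          rw [← Complex.ofReal_add, ← hvy]
        rw [Matrix.sub_mulVec, Matrix.one_mulVec, Matrix.smul_mulVec, Pi.sub_apply, Pi.smul_apply,
          e1, hzb, e2, smul_eq_mul]
        push_cast
        linear_combination (-∑ j, (a θ i j : ℂ) * (v θ j : ℂ)) * Complex.I_sq
      rw [hFb, ← Matrix.mulVec_mulVec, h1]
      simp only [Matrix.mulVec, dotProduct, Matrix.map_apply, Matrix.of_apply, Complex.im_sum]
      refine Finset.sum_congr rfl fun j _ => ?_
      simp
  have hzF : ∀ τ ∈ Metric.closedBall (0 : ℂ) 1,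
      conjExtPi v τ = (F τ)⁻¹.mulVec (conjExtPi β τ) := by
    intro τ hτ
    rw [← hcomp τ hτ, Matrix.mulVec_mulVec, Matrix.nonsing_inv_mul _ (hFd τ hτ).isUnit,
      Matrix.one_mulVec]
  have h1mem : (1 : ℂ) ∈ Metric.closedBall (0 : ℂ) 1 := by simp
  have hβ1 : conjExtPi β 1 = 0 := hK.conjExtPi_one hβb (hβ0 0 (by
    rw [expI_zero]; simpa using hs))
  set f' : Fin d → ℂ := fun i => -(Complex.I * ((Real.pi⁻¹ * ∫ θ in (-Real.pi)..Real.pi,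
    (∑ j, g θ i j * b θ j) / ‖expI θ - 1‖ ^ 2 : ℝ) : ℂ)) with hf'
  have hd : ∀ i, HasDerivWithinAt (fun τ => conjExtPi β τ i) (f' i) (Metric.closedBall 0 1) 1 :=
    fun i => hK.hasDerivWithinAt_conjExt (hβb.apply i)
      ((continuous_apply i).comp (hβb.continuous hα)) hs fun θ hθ => by rw [hβ0 θ hθ]; rfl
  have hfin : HasDerivWithinAt (fun τ => (F τ)⁻¹.mulVec (conjExtPi β τ)) f'
      (Metric.closedBall 0 1) 1 := by
    refine hasDerivWithinAt_pi.2 fun i => ?_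
    have h1 := HasDerivWithinAt.fun_sum (u := Finset.univ) fun (j : Fin d) _ =>
      HasDerivWithinAt.mul_of_eq_zero
        ((DiffContOnCl.matrix_inv hF (by rwa [hcl]) i j).continuousOn_ball 1 h1mem) (hd j)
        (congrFun hβ1 j)
    simp only [hF1, inv_one, Matrix.one_apply, ite_mul, one_mul, zero_mul, Finset.sum_ite_eq,
      Finset.mem_univ, if_true] at h1
    exact h1
  exact hfin.congr hzF (hzF 1 h1mem)

lemma abs_integral_mul_sub_le {χ q : ℝ → ℝ} {a b e q₀ : ℝ} (hab : a ≤ b) (hχ : Continuous χ)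
    (h0 : ∀ θ, 0 ≤ χ θ) (hi : IntervalIntegrable (fun θ => χ θ * q θ) volume a b)
    (hq : ∀ θ, χ θ ≠ 0 → |q θ - q₀| ≤ e) :
    |(∫ θ in a..b, χ θ * q θ) - (∫ θ in a..b, χ θ) * q₀| ≤ (∫ θ in a..b, χ θ) * e := by
  have hint : ∀ c : ℝ, IntervalIntegrable (fun θ => χ θ * c) volume a b := fun c =>
    (hχ.mul_const c).intervalIntegrable a b
  rw [← intervalIntegral.integral_mul_const, ← intervalIntegral.integral_sub hi (hint q₀),
    ← intervalIntegral.integral_mul_const, ← Real.norm_eq_abs]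
  refine intervalIntegral.norm_integral_le_of_norm_le hab (.of_forall fun θ _ => ?_)
    (hint e)
  rw [← mul_sub, norm_mul, Real.norm_of_nonneg (h0 θ), Real.norm_eq_abs]
  by_cases hz : χ θ = 0
  · simp [hz]
  · exact mul_le_mul_of_nonneg_left (hq θ hz) (h0 θ)

end Conclusion

/-! ### Choice of the constants and proof of the theorem -/

open MeasureTheory

theorem theorem3p2 (d m k : ℕ) (hk : 2 < k) (α : ℝ≥0) (hα : α < 1) (hkα : 1 < (k : ℝ≥0) * α)
    (h : RealCoord d m → Fin d → ℝ)
    (hsmooth : ContDiff ℝ ((k + 2 : ℕ) : WithTop ℕ∞) h)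
    (hzero : h 0 = 0) (hdzero : fderiv ℝ h 0 = 0) (horder : WeightedOrderGE k h) :
    ∃ δ : ℝ, 0 < δ ∧
      ∀ A : ℂ → Ambient d m, IsF2Disc α A → f2Norm α A < ENNReal.ofReal δ →
        AttachedTo h A → A 1 = 0 → TangentAtOne A →
      ∃ G : ℂ → Matrix (Fin d) (Fin d) ℝ, IsTransport h A G ∧
        (∀ G₁, IsTransport h A G₁ → Set.EqOn G₁ G (Metric.sphere 0 1)) ∧
      ∀ H : RealCoord d m × ℝ → Fin d → ℝ, IsExtension k h H → tDeriv H (A (-1)) ≠ 0 →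
      ∀ ε : ℝ, 0 < ε → ∃ r : ℝ, 0 < r ∧ ∀ χ : ℂ → ℝ, IsCutoff χ r →
      ∃ (η₀ : ℝ) (D : ℝ → ℂ → Ambient d m) (Adot : ℂ → Ambient d m) (V : Ambient d m) (c : ℝ),
        0 < η₀ ∧ Set.EqOn (D 0) A (Metric.closedBall 0 1) ∧
        (∀ η ∈ Set.Icc 0 η₀, IsDeformed α H A χ η (D η) ∧ f2Norm α (D η) < ENNReal.ofReal δ ∧
          ∀ B : ℂ → Ambient d m, IsDeformed α H A χ η B → f2Norm α B < ENNReal.ofReal δ →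
            Set.EqOn B (D η) (Metric.closedBall 0 1)) ∧
        IsF2Disc α Adot ∧
        Filter.Tendsto (fun η : ℝ => f2Norm α (fun τ => η⁻¹ • (D η τ - A τ) - Adot τ))
          (𝓝[>] 0) (𝓝 0) ∧
        HasDerivWithinAt Adot V (Metric.closedBall 0 1) 1 ∧
        0 < c ∧ c = (4 * Real.pi)⁻¹ * ∫ θ in (-Real.pi)..Real.pi, bdry χ θ ∧
        ‖-V - ((c : ℂ) • transported G H A, (0 : Fin m → ℂ))‖ < ε * c := by
  have hpi := Real.pi_pos
  have hα0 : 0 < α := by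
    rcases eq_zero_or_pos α with h0 | h0
    · simp [h0] at hkα
    · exact h0
  have hα0' : (0 : ℝ) < α := hα0
  obtain ⟨K, hK⟩ := exists_isConjBound hα0' (show (α : ℝ) < 1 from hα)
  have hh5 : ContDiff ℝ 5 h := hsmooth.of_le (by exact_mod_cast (by omega : 5 ≤ k + 2))
  obtain ⟨N, ε₁, Λ, hs⟩ := exists_isSmallFactor hK hh5 hdzero
  have hN := hs.pos
  -- The factor `1 + 2/α` is the price of passing from the `F^{2,α}` norm to a bound that also
  -- controls the Hölder norm of the disc itself.
  have hδ : 0 < N / (1 + 2 / (α : ℝ)) := by positivity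
  refine ⟨N / (1 + 2 / (α : ℝ)), hδ, fun A hA hAδ hAh hA1 _ => ?_⟩
  have hδN : (1 + 2 / (α : ℝ)) * (N / (1 + 2 / (α : ℝ))) ≤ N := by
    rw [mul_div_cancel₀ _ (by positivity)]
  have hAN : F2Bound α (bdry A) N := (hA.mem.f2Bound hα0 hα hδ.le hAδ.le).mono hδN
  have hu : F2Bound α (fun θ => baseOf (bdry A θ)) (2 * N) := hAN.baseOf.mono (by linarith)
  have hu0 : baseOf (bdry A 0) = 0 := by
    have : bdry A 0 = A (expI 0) := rfl
    rw [this, expI_zero, hA1]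
    refine Prod.ext (funext fun j => ?_) rfl
    simp [baseOf]
  obtain ⟨g, F, hg, hF, hF1, hFb, hFd⟩ := hK.exists_transport (hs.f2Bound_xJacobian hu)
    (by funext i j; simp [hu0, xJacobian, hdzero]) (by rw [Fintype.card_fin]; exact hs.le_card)
  obtain ⟨G, hG, hGg, hGu⟩ := isTransport_of_factorization (hh5.differentiable (by norm_num))
    hF hF1 hFb hFd
  refine ⟨G, hG, hGu, fun H hH _ ε hε => ?_⟩
  obtain ⟨κ, hκ, hHκ, hHt⟩ := hH.exists_transverse hk
  -- The integrand with `χ` removed, normalized by `4` so that `q(-1) = G(-1) ∂_tH(q)`, because `|-1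
  -- - 1|² = 4`. Its continuity at `-1` determines `r`.
  set q : ℂ → Fin d → ℝ := fun ζ i =>
    4 / ‖ζ - 1‖ ^ 2 * ∑ j, G ζ i j * κ (baseOf (A ζ), 0) j with hq
  have hneg : (-1 : ℂ) ∈ Metric.sphere (0 : ℂ) 1 := by simp
  have hκA : ContinuousWithinAt (fun ζ => κ (baseOf (A ζ), 0)) (Metric.sphere 0 1) (-1) := by
    have h1 : ContinuousWithinAt A (Metric.sphere 0 1) (-1) :=
      (hA.holo.continuousOn_ball.mono Metric.sphere_subset_closedBall) _ hneg
    have h2 : Continuous fun p : Ambient d m => κ (baseCLM d m p, 0) :=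
      hκ.continuous.comp ((baseCLM d m).continuous.prodMk continuous_const)
    exact h2.continuousAt.comp_continuousWithinAt h1
  have hqc : ContinuousWithinAt q (Metric.sphere 0 1) (-1) := by
    refine continuousWithinAt_pi.2 fun i => ContinuousWithinAt.mul ?_ ?_
    · refine ContinuousAt.continuousWithinAt (ContinuousAt.div continuousAt_const (by fun_prop) ?_)
      norm_num
    · refine tendsto_finsetSum _ fun j _ => ContinuousWithinAt.mul ?_ ?_
      · exact continuousWithinAt_pi.1 (continuousWithinAt_pi.1 (hG.cont _ hneg) i) j
      · exact continuousWithinAt_pi.1 hκA j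
  obtain ⟨r, hr, hqr⟩ := Metric.continuousWithinAt_iff.1 hqc (ε / 2) (by positivity)
  -- The cap `1` makes `χ` vanish where `|ζ - 1| < 1`, so the density is zero near the singularity
  -- of the kernel.
  refine ⟨min r 1, lt_min hr one_pos, fun χ hχ => ?_⟩
  have hfar : ∀ ζ ∈ Metric.sphere (0 : ℂ) 1, ‖ζ - 1‖ < 1 → χ ζ = 0 := by
    intro ζ hζ hlt
    by_contra hne
    have h1 := (hχ.supp ζ hζ hne).trans_le (min_le_right _ _)
    rw [dist_eq_norm] at h1
    have h2 : ‖(2 : ℂ)‖ ≤ ‖ζ - -1‖ + ‖ζ - 1‖ := by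
      have := norm_sub_le (ζ - -1) (ζ - 1)
      rwa [show (ζ - -1) - (ζ - 1) = 2 by ring] at this
    rw [Complex.norm_ofNat] at h2
    linarith
  have hχc : Continuous (bdry χ) := hχ.smooth.continuous
  have hχp : ∀ θ, 0 ≤ bdry χ θ := fun θ => hχ.nonneg _ (expI_mem_sphere θ)
  obtain ⟨Cχ, hCχ⟩ := F2Bound.exists_of_contDiff
    (by exact_mod_cast contDiff_infty.1 hχ.smooth 3) (periodic_bdry χ) hα0'
    (show (α : ℝ) < 1 from hα)
  obtain ⟨η₀, D, y, v, C, hη₀, hD0, hD, hdisc, hlim, hv, hy, hvy⟩ := hs.exists_deformation hα0 hα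
    hzero hδ hδN hA hAδ hAh hA1 hκ hHκ hCχ hχ.nonneg (hfar 1 (by simp) (by simp))
  have hb : ∃ Cb, F2Bound α (fun θ => bdry χ θ • κ (baseOf (bdry A θ), 0)) Cb := by
    obtain ⟨C₁, -, h1, -⟩ := exists_transverse_bounds hκ hCχ (2 * N)
    have h2 := h1 _ 0 (by simp) hu
    simp only [zero_mul] at h2
    exact ⟨_, hCχ.smul h2⟩
  obtain ⟨Cb, hCb⟩ := hb
  have hder := hK.hasDerivWithinAt_linearization (s := 1 / 4) hα0' hg hF hF1 hFb hFd hCb hv hy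
    (fun θ i => by rw [hvy, fderiv_prodMk_zero]; rfl) (by norm_num) (fun θ hθ => by
      have h1 : bdry χ θ = 0 := hfar _ (expI_mem_sphere θ) (hθ.trans_eq (by norm_num))
      rw [h1, zero_smul])
  set c : ℝ := (4 * Real.pi)⁻¹ * ∫ θ in (-Real.pi)..Real.pi, bdry χ θ with hc
  have hint : 0 < ∫ θ in (-Real.pi)..Real.pi, bdry χ θ := by
    refine intervalIntegral.integral_pos (by linarith) hχc.continuousOn (fun θ _ => hχp θ)
      ⟨Real.pi, ⟨by linarith, le_rfl⟩, ?_⟩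
    have : bdry χ Real.pi = χ (expI Real.pi) := rfl
    rw [this, expI_pi, hχ.value]
    exact one_pos
  have hc0 : 0 < c := by positivity
  refine ⟨η₀, D, _, (_, 0), c, hη₀, hD0, hD, hdisc, hlim,
    hder.prodMk (hasDerivWithinAt_const _ _ _), hc0, rfl, ?_⟩
  have hterm : ∀ i θ, (∑ j, g θ i j * (bdry χ θ • κ (baseOf (bdry A θ), 0)) j) /
      ‖expI θ - 1‖ ^ 2 = bdry χ θ * q (expI θ) i / 4 := by
    intro i θ
    have e1 : ∑ j, g θ i j * (bdry χ θ • κ (baseOf (bdry A θ), 0)) j =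
        bdry χ θ * ∑ j, G (expI θ) i j * κ (baseOf (A (expI θ)), 0) j := by
      rw [Finset.mul_sum]
      refine Finset.sum_congr rfl fun j _ => ?_
      rw [hGg, Matrix.of_apply, Pi.smul_apply, smul_eq_mul]
      change _ * (_ * κ (baseOf (A (expI θ)), 0) j) = _
      ring
    rw [e1, hq]
    ring
  have hqneg : ∀ i, transported G H A i = Complex.I * (q (-1) i : ℂ) := by
    intro i
    have e1 : q (-1) i = ∑ j, G (-1) i j * κ (baseOf (A (-1)), 0) j := by
      simp only [hq]
      norm_num
    rw [e1]
    simp only [transported, Matrix.mulVec, dotProduct, hHt, Matrix.map_apply]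
    push_cast
    rw [Finset.mul_sum]
    exact Finset.sum_congr rfl fun j _ => by ring
  have hest : ∀ i, |(∫ θ in (-Real.pi)..Real.pi, bdry χ θ * q (expI θ) i) -
      (∫ θ in (-Real.pi)..Real.pi, bdry χ θ) * q (-1) i| ≤
        (∫ θ in (-Real.pi)..Real.pi, bdry χ θ) * (ε / 2) := by
    intro i
    refine abs_integral_mul_sub_le (by linarith) hχc hχp ?_ fun θ hθ => ?_
    · have hβ := ((hg.mulVec hCb).apply i).continuous hα0'
      have h1 : IntervalIntegrable (fun θ => (∑ j, g θ i j *
          (bdry χ θ • κ (baseOf (bdry A θ), 0)) j) / ‖expI θ - 1‖ ^ 2) volume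
          (-Real.pi) Real.pi := by
        refine (hβ.norm.intervalIntegrable (-Real.pi) Real.pi).mono_fun'
          (hβ.measurable.div (by fun_prop)).aestronglyMeasurable (.of_forall fun θ => ?_)
        simp only [norm_div, norm_pow, norm_norm]
        rcases lt_or_ge ‖expI θ - 1‖ 1 with hlt | hge
        · have h2 : bdry χ θ = 0 := hfar _ (expI_mem_sphere θ) hlt
          simp [h2]
        · exact div_le_self (norm_nonneg _) (one_le_pow₀ hge)
      refine (h1.const_mul 4).congr fun θ _ => ?_
      simp only [hterm]
      ring
    · have h1 := hqr (expI_mem_sphere θ)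
        ((hχ.supp _ (expI_mem_sphere θ) hθ).trans_le (min_le_left _ _))
      rw [← Real.dist_eq]
      exact (dist_le_pi_dist _ _ i).trans h1.le
  simp only [hterm]
  -- The estimate holds with `ε/2`, which makes the final inequality strict; the `w`-component of
  -- the difference is zero.
  refine (max_lt ((pi_norm_lt_iff (by positivity)).2 fun i => ?_) (by simpa using by positivity))
  have e : (-(fun i => -(Complex.I * ((Real.pi⁻¹ * ∫ θ in (-Real.pi)..Real.pi,
      bdry χ θ * q (expI θ) i / 4 : ℝ) : ℂ))) - (c : ℂ) • transported G H A) i =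
      Complex.I * (((4 * Real.pi)⁻¹ * ((∫ θ in (-Real.pi)..Real.pi, bdry χ θ * q (expI θ) i) -
      (∫ θ in (-Real.pi)..Real.pi, bdry χ θ) * q (-1) i) : ℝ) : ℂ) := by
    rw [Pi.sub_apply, Pi.neg_apply, Pi.smul_apply, hqneg, hc, smul_eq_mul,
      intervalIntegral.integral_div]
    push_cast
    field_simp
  have h1 := mul_le_mul_of_nonneg_left (hest i) (show 0 ≤ (4 * Real.pi)⁻¹ by positivity)
  have h2 : (4 * Real.pi)⁻¹ * ((∫ θ in (-Real.pi)..Real.pi, bdry χ θ) * (ε / 2)) = c * (ε / 2) := by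
    rw [hc, mul_assoc]
  rw [h2] at h1
  calc _ = ‖Complex.I * (((4 * Real.pi)⁻¹ * ((∫ θ in (-Real.pi)..Real.pi,
        bdry χ θ * q (expI θ) i) - (∫ θ in (-Real.pi)..Real.pi, bdry χ θ) * q (-1) i) : ℝ) : ℂ)‖ :=
        congrArg _ e
    _ ≤ c * (ε / 2) := by
        rw [norm_mul, Complex.norm_I, one_mul, Complex.norm_real, norm_mul, Real.norm_eq_abs,
          Real.norm_eq_abs, abs_of_pos (show 0 < (4 * Real.pi)⁻¹ by positivity)]
        exact h1
    _ < ε * c := by nlinarith
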